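/- Let $J\ge 2$, let $g\in\mathbb{R}^J$, and let $\{\mathcal S_m\}_{m=1}^M$ be a partition of $\{1,\dots,J\}$ into $M\ge 2$ non-empty sets. For a random vector $\mathbf X=(X_1,\dots,X_J)$ and an auxiliary random variable $T$ (with values in an arbitrary standard Borel space), let $Y=\sum_{j=1}^J g_jX_j+Z$, where $Z\sim\mathcal N(0,1)$ is independent of $(T,\mathbf X)$, so that $T\leftrightarrow\mathbf X\leftrightarrow Y$ is a Markov chain. For $\lambda\ge 0$ put $$s_\lambda(\mathbf X|T)=(\lambda-1)\,I(\mathbf X;Y|T)-\frac{\lambda}{M-1}\sum_{m=1}^M I(X_{\mathcal S_m^c};Y\,|\,X_{\mathcal S_m},T),$$ write $s_\lambda(\mathbf X)$ for the same expression with $T$ constant, let $S_\lambda(\mathbf X)$ be the infimum of $s_\lambda(\mathbf X|T)$ over all $T$ jointly distributed with $\mathbf X$ as above (the lower convex envelope of $s_\lambda$), and for a positive semidefinite $J\times J$ matrix $K$ let $$V_\lambda(K)=\inf_{p(\mathbf x):\,E[\mathbf X\mathbf X^T]=K}S_\lambda(\mathbf X).$$ Then for every $\lambda\ge0$ and every $K\succeq0$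 the value $V_\lambda(K)$ is attained by a single Gaussian input distribution, with $T$ constant: there is a (possibly degenerate, possibly non-centred) Gaussian vector $\mathbf X_*$ with $E[\mathbf X_*\mathbf X_*^T]=K$ and $s_\lambda(\mathbf X_*)=V_\lambda(K)$. Moreover, there is a zero-mean Gaussian vector $\mathbf X^*\sim\mathcal N(0,K')$ with $K'\preceq K$ and $s_\lambda(\mathbf X^*)=V_\lambda(K)$. -/

import Mathlib

open MeasureTheory ProbabilityTheory
open scoped ENNReal

noncomputable section

namespace GMAC

/-- Conditional mutual information `I(U; V | W)` (in nats) of random variables on `(Ω, P)`: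
the relative entropy of the joint law `P_{W,U,V}` with respect to `P_W ⊗ (P_{U|W} × P_{V|W})`. -/
def condMutualInfo {Ω α β γ : Type*} [MeasurableSpace Ω]
    [MeasurableSpace α] [StandardBorelSpace α] [Nonempty α]
    [MeasurableSpace β] [StandardBorelSpace β] [Nonempty β] [MeasurableSpace γ]
    (U : Ω → α) (V : Ω → β) (W : Ω → γ) (P : Measure Ω) [IsFiniteMeasure P] : ℝ≥0∞ :=
  InformationTheory.klDiv (P.map fun ω ↦ (W ω, U ω, V ω))
    ((P.map W) ⊗ₘ ((condDistrib U W P) ×ₖ (condDistrib V W P)))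

section Channel

variable {J : ℕ} {τ : Type*}

/-- A sample point is `((t, x), z)`: auxiliary variable, channel input and noise. -/
def auxT (ω : (τ × (Fin J → ℝ)) × ℝ) : τ := ω.1.1

/-- The channel input. -/
def inputX (ω : (τ × (Fin J → ℝ)) × ℝ) : Fin J → ℝ := ω.1.2

/-- The part `X_S` of the channel input that belongs to the users in `S`. -/
def inputOn (S : Finset (Fin J)) (ω : (τ × (Fin J → ℝ)) × ℝ) : S → ℝ := fun j ↦ ω.1.2 j

/-- The channel output `Y = ∑ j, g j * X j + Z`. -/
def outputY (g : Fin J → ℝ) (ω : (τ × (Fin J → ℝ)) × ℝ) : ℝ := ∑ j, g j * ω.1.2 j + ω.2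

variable [MeasurableSpace τ]

/-- Law of `((T, X), Z)`, where `(T, X)` has law `ρ` and the noise `Z ∼ N(0, 1)` is independent of
`(T, X)`. In particular `T`, `X`, `Y` form a Markov chain in this order. -/
abbrev channelLaw (ρ : Measure (τ × (Fin J → ℝ))) : Measure ((τ × (Fin J → ℝ)) × ℝ) :=
  ρ.prod (gaussianReal 0 1)

/-- The Lagrangian `s_λ(X | T) = (λ - 1) I(X; Y | T) - λ / (M - 1) ∑ₘ I(X_{Sₘᶜ}; Y | X_{Sₘ}, T)`
for the partition of the users into the `M` blocks `Sₘ`, where `ρ` is the joint law of `(T, X)`.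
All the informations here are finite as soon as `X` has finite second moments. -/
def lagrangian (g : Fin J → ℝ) (Q : Finpartition (Finset.univ : Finset (Fin J))) (lam : ℝ)
    (ρ : Measure (τ × (Fin J → ℝ))) [IsProbabilityMeasure ρ] : ℝ :=
  (lam - 1) * (condMutualInfo inputX (outputY g) auxT (channelLaw ρ)).toReal
    - lam / ((Q.parts.card : ℝ) - 1) *
      ∑ S ∈ Q.parts, (condMutualInfo (inputOn Sᶜ) (outputY g)
        (fun ω ↦ (inputOn S ω, auxT ω)) (channelLaw ρ)).toReal

end Channel

variable {J : ℕ}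

/-- `s_λ(X)` for `X` of law `μ`: the Lagrangian with a constant auxiliary variable. -/
def lagrangianConst (g : Fin J → ℝ) (Q : Finpartition (Finset.univ : Finset (Fin J))) (lam : ℝ)
    (μ : Measure (Fin J → ℝ)) [IsProbabilityMeasure μ] : ℝ :=
  lagrangian g Q lam ((Measure.dirac ()).prod μ)

/-- `E[X Xᵀ] = K` for `X` of law `μ` (with finite second moments). -/
def HasSecondMoment (μ : Measure (Fin J → ℝ)) (K : Matrix (Fin J) (Fin J) ℝ) : Prop :=
  (∀ i, MemLp (fun x : Fin J → ℝ ↦ x i) 2 μ) ∧ ∀ i j, ∫ x, x i * x j ∂μ = K i j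

/-- The lower convex envelope `S_λ(X)` for `X` of law `μ`: the infimum of `s_λ(X | T)` over all
random variables `T` jointly distributed with `X` such that `T`, `X`, `Y` is a Markov chain.
The joint law `ρ` of `(T, X)` has second marginal `μ`, and `T` takes values in any
standard Borel space. -/
def envelope (g : Fin J → ℝ) (Q : Finpartition (Finset.univ : Finset (Fin J))) (lam : ℝ)
    (μ : Measure (Fin J → ℝ)) : EReal :=
  ⨅ (τ : Type) (_ : MeasurableSpace τ) (_ : StandardBorelSpace τ)
    (ρ : Measure (τ × (Fin J → ℝ))) (_ : IsProbabilityMeasure ρ) (_ : ρ.snd = μ),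
      ((lagrangian g Q lam ρ : ℝ) : EReal)

/-- The dual function `V_λ(K)`: the infimum of `S_λ(X)` over all input laws with
`E[X Xᵀ] = K`. -/
def dualFunction (g : Fin J → ℝ) (Q : Finpartition (Finset.univ : Finset (Fin J))) (lam : ℝ)
    (K : Matrix (Fin J) (Fin J) ℝ) : EReal :=
  ⨅ (μ : Measure (Fin J → ℝ)) (_ : IsProbabilityMeasure μ) (_ : HasSecondMoment μ K),
    envelope g Q lam μ

end GMAC

end

open MeasureTheory ProbabilityTheory
open scoped ENNReal

noncomputable section

namespace GMAC

/-! ### Gaussian densities and noise -/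

/-! Write c = λ - 1 and d = λ / (M - 1). Up to constants the Lagrangian is c h(Y|T) - d ∑ h(Y|X_S,
T), the sum being over the blocks S. If λ ≤ 1, both terms have the favourable sign and the maximum
entropy property of Gaussians makes the centred Gaussian of covariance K optimal. The substance is
the case λ ≥ 1, where h(Y|T) has to be bounded below.

For a Gaussian input of covariance C the Lagrangian is half of `gaussVal`: c log(1 + gᵀCg) minus d
times the sum of the logarithms of the least squares residual variances of Y given X_S. A minimiser
K₀ over 0 ⪯ C ⪯ K satisfies first order conditions (`IsStationary`); a ridge penalty δ > 0 on the
estimators makes the residual variances smooth enough to derive them. The core is `sum_condEnt_le`: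
the value at any such stationary point bounds the Lagrangian of every (T, X) with E[XXᵀ] = K from
below.

This is proved by monotonicity along a heat flow. Put σ = 1 + gᵀK₀g and let v be the residual
variance attached to S. At time r the output noise has variance 1 + rσ. Relative to S it splits into
l n with l² = σ - v, where the same n also shifts X_S along a direction e with a·e = l, and an
unseen part of variance 1 + rv. After subtraction of multiples of log(1 + r), the combination d ∑
h(Y|X_S, T) - c h(Y|T) equals the wanted quantity at r = 0 and is at most the Gaussian value in the
limit r → ∞. It increases in between. Indeed, the growth of h(Y|T) is a Fisher information
(`hasDerivAt_condEnt`), which is a mean square error in disguise (`integral_sq_sub_noiseMean`). The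
growth of each h(Y|X_S, T) is bounded below by Gibbs' inequality with an explicit estimator of the
innovation (`condEnt_step`). All these errors are quadratic forms of one matrix C with 0 ⪯ C ⪯ K
(`exists_error_cov`), so the first order condition at K₀ compares the increments
(`sum_partLaw_step`), and `sub_le_sub_of_step` adds them up.

Compactness removes δ (`exists_admissible_le`). Finally K - K₀ is put into the covariance except for
a rank one part mmᵀ carrying all its variance along g (`exists_mean_cov`): the output variance is
unchanged and the residual variances can only grow, so nothing is lost. The Gaussian of mean m and
covariance K - mmᵀ is optimal; its value does not depend on the mean, so centring it gives the
second claim. -/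

/-- The density of the centred normal law of variance `s`. -/
def gaussDensity (s x : ℝ) : ℝ := (√(2 * Real.pi * s))⁻¹ * Real.exp (-x ^ 2 / (2 * s))

/-- The centred normal law of variance `s`. -/
abbrev gaussNoise (s : ℝ) : Measure ℝ := gaussianReal 0 s.toNNReal

lemma gaussianPDFReal_eq_gaussDensity {s : ℝ} (hs : 0 < s) (m y : ℝ) :
    gaussianPDFReal m s.toNNReal y = gaussDensity s (y - m) := by
  simp [gaussianPDFReal, gaussDensity, Real.coe_toNNReal s hs.le]

lemma gaussDensity_pos {s : ℝ} (hs : 0 < s) (x : ℝ) : 0 < gaussDensity s x := by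
  unfold gaussDensity; positivity

lemma gaussDensity_le {s : ℝ} (hs : 0 < s) (x : ℝ) :
    gaussDensity s x ≤ (√(2 * Real.pi * s))⁻¹ := by
  unfold gaussDensity
  refine mul_le_of_le_one_right (by positivity) (Real.exp_le_one_iff.2 ?_)
  rw [neg_div]
  have : 0 ≤ x ^ 2 / (2 * s) := by positivity
  linarith

lemma log_sqrt_two_pi_inv {s : ℝ} (hs : 0 < s) :
    Real.log (√(2 * Real.pi * s))⁻¹ = -(1 / 2 * Real.log (2 * Real.pi * s)) := by
  rw [Real.log_inv, Real.log_sqrt (by positivity)]; ring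

lemma log_gaussDensity {s : ℝ} (hs : 0 < s) (x : ℝ) :
    Real.log (gaussDensity s x) = -(1 / 2 * Real.log (2 * Real.pi * s)) - x ^ 2 / (2 * s) := by
  unfold gaussDensity
  rw [Real.log_mul (by positivity) (Real.exp_pos _).ne', Real.log_exp, log_sqrt_two_pi_inv hs]
  ring

lemma continuous_gaussDensity (s : ℝ) : Continuous (gaussDensity s) := by
  unfold gaussDensity; fun_prop

@[fun_prop]
lemma measurable_gaussDensity (s : ℝ) : Measurable (gaussDensity s) :=
  (continuous_gaussDensity s).measurable

lemma lintegral_gaussNoise {s : ℝ} (hs : 0 < s) {F : ℝ → ℝ≥0∞} (hF : Measurable F) :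
    ∫⁻ z, F z ∂gaussNoise s = ∫⁻ z, ENNReal.ofReal (gaussDensity s z) * F z := by
  have hs' : s.toNNReal ≠ 0 := by simpa using hs
  rw [gaussNoise, gaussianReal_of_var_ne_zero _ hs',
    lintegral_withDensity_eq_lintegral_mul _ (measurable_gaussianPDF _ _) hF]
  simp [gaussianPDF, gaussianPDFReal_eq_gaussDensity hs]

lemma lintegral_gaussDensity {s : ℝ} (hs : 0 < s) (c : ℝ) :
    ∫⁻ z, ENNReal.ofReal (gaussDensity s (z - c)) = 1 := by
  have := lintegral_gaussNoise hs (F := 1) measurable_one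
  simp at this
  rw [lintegral_sub_right_eq_self (fun z ↦ ENNReal.ofReal (gaussDensity s z)) c, ← this]

lemma memLp_id_gaussNoise (s : ℝ) : MemLp (fun z : ℝ ↦ z) 2 (gaussNoise s) :=
  memLp_id_gaussianReal 2

lemma integral_id_gaussNoise (s : ℝ) : ∫ z, z ∂gaussNoise s = 0 := by simp

lemma integral_sq_gaussNoise {s : ℝ} (hs : 0 ≤ s) : ∫ z, z ^ 2 ∂gaussNoise s = s := by
  have h := variance_fun_id_gaussianReal (μ := 0) (v := s.toNNReal)
  rw [variance_eq_integral (by fun_prop)] at h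
  simpa [hs] using h

lemma gaussNoise_conv {s t : ℝ} (hs : 0 ≤ s) (ht : 0 ≤ t) :
    ((gaussNoise s).prod (gaussNoise t)).map (fun z ↦ z.1 + z.2) = gaussNoise (s + t) := by
  have := gaussianReal_conv_gaussianReal (m₁ := 0) (m₂ := 0) (v₁ := s.toNNReal) (v₂ := t.toNNReal)
  rw [Measure.conv] at this
  rw [this, gaussNoise, Real.toNNReal_add hs ht, add_zero]

/-! ### Gibbs' inequality -/

/-- Gibbs' inequality: an exponential with integral at most one has nonpositive exponent on
average. -/
lemma integral_nonpos_of_lintegral_exp_le_one {Ω : Type*} [MeasurableSpace Ω] {P : Measure Ω}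
    [IsProbabilityMeasure P] {L : Ω → ℝ} (hL : Integrable L P)
    (h : ∫⁻ ω, ENNReal.ofReal (Real.exp (L ω)) ∂P ≤ 1) : ∫ ω, L ω ∂P ≤ 0 := by
  have hm : AEStronglyMeasurable (fun ω ↦ Real.exp (L ω)) P :=
    Real.continuous_exp.comp_aestronglyMeasurable hL.1
  have hi : Integrable (fun ω ↦ Real.exp (L ω)) P := by
    refine ⟨hm, ?_⟩
    rw [hasFiniteIntegral_iff_ofReal (Filter.Eventually.of_forall fun _ ↦ (Real.exp_pos _).le)]
    exact h.trans_lt ENNReal.one_lt_top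
  have h1 : ∫ ω, Real.exp (L ω) ∂P ≤ 1 := by
    rw [integral_eq_lintegral_of_nonneg_ae (Filter.Eventually.of_forall fun _ ↦ (Real.exp_pos _).le)
      hm]
    exact ENNReal.toReal_le_of_le_ofReal zero_le_one (by simpa using h)
  have h2 : ∫ ω, (L ω + 1) ∂P ≤ ∫ ω, Real.exp (L ω) ∂P :=
    integral_mono (hL.add (integrable_const _)) hi fun ω ↦ Real.add_one_le_exp _
  rw [integral_add hL (integrable_const _)] at h2
  simp at h2
  linarith

/-- Gibbs' inequality for densities. -/
lemma integral_log_le_integral_log_density {Ω : Type*} [MeasurableSpace Ω] {l P : Measure Ω}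
    [IsProbabilityMeasure P] {f q : Ω → ℝ} (hP : P = l.withDensity fun ω ↦ ENNReal.ofReal (f ω))
    (hfm : Measurable f) (hqm : Measurable q)
    (hf : ∀ ω, 0 < f ω) (hq : ∀ ω, 0 < q ω) (hq1 : ∫⁻ ω, ENNReal.ofReal (q ω) ∂l ≤ 1)
    (hfi : Integrable (fun ω ↦ Real.log (f ω)) P) (hqi : Integrable (fun ω ↦ Real.log (q ω)) P) :
    ∫ ω, Real.log (q ω) ∂P ≤ ∫ ω, Real.log (f ω) ∂P := by
  have := integral_nonpos_of_lintegral_exp_le_one (hqi.sub hfi) ?_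
  · simp only [Pi.sub_apply] at this
    rw [integral_sub hqi hfi] at this
    linarith
  · rw [hP, lintegral_withDensity_eq_lintegral_mul _ (by fun_prop) (by fun_prop)]
    refine (lintegral_congr fun ω ↦ ?_).trans_le hq1
    simp only [Pi.mul_apply, Pi.sub_apply]
    rw [Real.exp_sub, Real.exp_log (hq ω), Real.exp_log (hf ω), ← ENNReal.ofReal_mul (hf ω).le,
      mul_div_cancel₀ _ (hf ω).ne']

/-! ### Conditional entropy of a noisy observation -/

section CondEnt

variable {γ : Type*} [MeasurableSpace γ]

/-- The conditional density of `D + G` given `V`, where `(V, D)` has law `θ` and `G` is an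
independent centred normal variable of variance `s`. -/
def mixDensity (θ : Measure (γ × ℝ)) [IsFiniteMeasure θ] (s : ℝ) (z : γ × ℝ) : ℝ :=
  ∫ d, gaussDensity s (z.2 - d) ∂(θ.condKernel z.1)

/-- The law of `(V, D + G)`, where `(V, D)` has law `θ` and `G` is an independent centred normal
variable of variance `s`. -/
def noisyLaw (θ : Measure (γ × ℝ)) (s : ℝ) : Measure (γ × ℝ) :=
  (θ.prod (gaussNoise s)).map fun w ↦ (w.1.1, w.1.2 + w.2)

/-- The conditional differential entropy of `D + G` given `V`, where `(V, D)` has law `θ` and `G`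
is an independent centred normal variable of variance `s`. -/
def condEnt (θ : Measure (γ × ℝ)) [IsFiniteMeasure θ] (s : ℝ) : ℝ :=
  -∫ z, Real.log (mixDensity θ s z) ∂noisyLaw θ s

variable (θ : Measure (γ × ℝ)) [IsProbabilityMeasure θ] {s : ℝ}

instance : IsProbabilityMeasure (noisyLaw θ s) :=
  Measure.isProbabilityMeasure_map (by fun_prop)

lemma integrable_gaussDensity_sub (hs : 0 < s) {μ : Measure ℝ} [IsFiniteMeasure μ] (y : ℝ) :
    Integrable (fun d ↦ gaussDensity s (y - d)) μ := by
  refine Integrable.of_bound (Measurable.aestronglyMeasurable (by fun_prop)) (√(2 * Real.pi * s))⁻¹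
    (Filter.Eventually.of_forall fun d ↦ ?_)
  rw [Real.norm_of_nonneg (gaussDensity_pos hs _).le]
  exact gaussDensity_le hs _


lemma measurable_mixDensity : Measurable (mixDensity θ s) := by
  unfold mixDensity
  have h : StronglyMeasurable (fun p : (γ × ℝ) × ℝ ↦ gaussDensity s (p.1.2 - p.2)) :=
    Measurable.stronglyMeasurable (by fun_prop)
  exact (h.integral_kernel_prod_right' (κ := θ.condKernel.comap Prod.fst measurable_fst)).measurable

lemma mixDensity_pos (hs : 0 < s) (z : γ × ℝ) : 0 < mixDensity θ s z := by
  unfold mixDensity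
  rw [integral_pos_iff_support_of_nonneg (fun d ↦ (gaussDensity_pos hs _).le)
    (integrable_gaussDensity_sub hs _)]
  have : Function.support (fun d ↦ gaussDensity s (z.2 - d)) = Set.univ := by
    ext d; simp [(gaussDensity_pos hs _).ne']
  simp [this]

lemma mixDensity_le (hs : 0 < s) (z : γ × ℝ) : mixDensity θ s z ≤ (√(2 * Real.pi * s))⁻¹ := by
  refine (integral_mono (integrable_gaussDensity_sub hs _) (integrable_const _)
    fun d ↦ gaussDensity_le hs _).trans ?_
  simp

lemma ofReal_mixDensity (hs : 0 < s) (z : γ × ℝ) : ENNReal.ofReal (mixDensity θ s z) =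
    ∫⁻ d, ENNReal.ofReal (gaussDensity s (z.2 - d)) ∂(θ.condKernel z.1) :=
  ofReal_integral_eq_lintegral_ofReal (integrable_gaussDensity_sub hs _)
    (Filter.Eventually.of_forall fun _ ↦ (gaussDensity_pos hs _).le)

lemma lintegral_eq_lintegral_condKernel {F : γ × ℝ → ℝ≥0∞} (hF : Measurable F) :
    ∫⁻ w, F w ∂θ = ∫⁻ v, ∫⁻ d, F (v, d) ∂(θ.condKernel v) ∂θ.fst := by
  conv_lhs => rw [← θ.disintegrate θ.condKernel]
  rw [Measure.lintegral_compProd hF]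

lemma lintegral_noisyLaw (hs : 0 < s) {F : γ × ℝ → ℝ≥0∞} (hF : Measurable F) :
    ∫⁻ z, F z ∂noisyLaw θ s =
      ∫⁻ v, (∫⁻ y, ENNReal.ofReal (mixDensity θ s (v, y)) * F (v, y)) ∂θ.fst := by
  rw [noisyLaw, lintegral_map hF (by fun_prop), lintegral_prod _ (by fun_prop),
    lintegral_eq_lintegral_condKernel θ (F := fun w ↦ ∫⁻ z, F (w.1, w.2 + z) ∂gaussNoise s)
      (Measurable.lintegral_prod_right' (f := fun x : (γ × ℝ) × ℝ ↦ F (x.1.1, x.1.2 + x.2))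
        (by fun_prop))]
  refine lintegral_congr fun v ↦ ?_
  have h1 : ∀ d, ∫⁻ z, F (v, d + z) ∂gaussNoise s
      = ∫⁻ y, ENNReal.ofReal (gaussDensity s (y - d)) * F (v, y) := fun d ↦ by
    rw [lintegral_gaussNoise hs (by fun_prop), ← lintegral_sub_right_eq_self _ d]
    simp
  simp_rw [h1]
  rw [lintegral_lintegral_swap (Measurable.aemeasurable (by fun_prop))]
  refine lintegral_congr fun y ↦ ?_
  rw [lintegral_mul_const _ (by fun_prop), ofReal_mixDensity θ hs]

lemma noisyLaw_eq_withDensity (hs : 0 < s) : noisyLaw θ s =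
    (θ.fst.prod volume).withDensity fun z ↦ ENNReal.ofReal (mixDensity θ s z) := by
  have hm : Measurable fun z ↦ ENNReal.ofReal (mixDensity θ s z) :=
    (measurable_mixDensity θ).ennreal_ofReal
  refine Measure.ext_of_lintegral _ fun F hF ↦ ?_
  rw [lintegral_noisyLaw θ hs hF, lintegral_withDensity_eq_lintegral_mul _ hm hF,
    lintegral_prod _ (hm.mul hF).aemeasurable]
  rfl

lemma lintegral_mixDensity (hs : 0 < s) (v : γ) :
    ∫⁻ y, ENNReal.ofReal (mixDensity θ s (v, y)) = 1 := by
  simp_rw [ofReal_mixDensity θ hs]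
  rw [lintegral_lintegral_swap (Measurable.aemeasurable (by fun_prop))]
  simp [lintegral_gaussDensity hs]

/-- The conditional second moment of `D` given `V`. -/
def condSq (v : γ) : ℝ := ∫ d, d ^ 2 ∂(θ.condKernel v)

variable {θ}

lemma integrable_condSq (h : MemLp (fun w : γ × ℝ ↦ w.2) 2 θ) : Integrable (condSq θ) θ.fst := by
  have h2 := h.integrable_sq
  rw [← θ.disintegrate θ.condKernel] at h2
  have h3 := ((Measure.integrable_compProd_iff h2.1).1 h2).2
  simp only [norm_pow, Real.norm_eq_abs, sq_abs] at h3
  exact h3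

lemma ae_integrable_sq_condKernel (h : MemLp (fun w : γ × ℝ ↦ w.2) 2 θ) :
    ∀ᵐ v ∂θ.fst, Integrable (fun d ↦ d ^ 2) (θ.condKernel v) := by
  have h2 := h.integrable_sq
  rw [← θ.disintegrate θ.condKernel] at h2
  exact h2.ae_of_compProd

lemma condSq_nonneg (v : γ) : 0 ≤ condSq θ v := integral_nonneg fun d ↦ sq_nonneg d

lemma log_mixDensity_le (hs : 0 < s) (z : γ × ℝ) :
    Real.log (mixDensity θ s z) ≤ -(1 / 2 * Real.log (2 * Real.pi * s)) := by
  rw [← log_sqrt_two_pi_inv hs]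
  exact Real.log_le_log (mixDensity_pos θ hs z) (mixDensity_le θ hs z)

/-- Since (y - d)² ≤ 2(y² + d²), the mixture dominates an average of exp(-(y² + d²)/s), and the
tangent line of exp at the mean exponent `x₀` (Jensen) bounds this average from below. Having a
quadratic lower bound is what makes the logarithms of the densities integrable. -/
lemma le_log_mixDensity (hs : 0 < s) {v : γ}
    (hv : Integrable (fun d ↦ d ^ 2) (θ.condKernel v)) (y : ℝ) :
    -(1 / 2 * Real.log (2 * Real.pi * s)) - (y ^ 2 + condSq θ v) / s
      ≤ Real.log (mixDensity θ s (v, y)) := by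
  set x₀ := -(y ^ 2 + condSq θ v) / s with hx₀
  have key : (√(2 * Real.pi * s))⁻¹ * Real.exp x₀ ≤ mixDensity θ s (v, y) := by
    have h1 : ∀ d, (√(2 * Real.pi * s))⁻¹ * (Real.exp x₀ * (1 + (-(y ^ 2 + d ^ 2) / s - x₀)))
        ≤ gaussDensity s (y - d) := fun d ↦ by
      unfold gaussDensity
      gcongr
      have h2 : -(y ^ 2 + d ^ 2) / s ≤ -(y - d) ^ 2 / (2 * s) := by
        rw [div_le_div_iff₀ hs (by positivity)]
        nlinarith [sq_nonneg (y + d)]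
      calc Real.exp x₀ * (1 + (-(y ^ 2 + d ^ 2) / s - x₀))
          ≤ Real.exp x₀ * Real.exp (-(y ^ 2 + d ^ 2) / s - x₀) := by
            gcongr; linarith [Real.add_one_le_exp (-(y ^ 2 + d ^ 2) / s - x₀)]
        _ = Real.exp (-(y ^ 2 + d ^ 2) / s) := by rw [← Real.exp_add]; congr 1; ring
        _ ≤ _ := Real.exp_le_exp.2 h2
    have hi : Integrable (fun d ↦ -(y ^ 2 + d ^ 2) / s) (θ.condKernel v) :=
      (((integrable_const _).add hv).neg).div_const _
    have hi2 : Integrable (fun d ↦ -(y ^ 2 + d ^ 2) / s - x₀) (θ.condKernel v) :=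
      hi.sub (integrable_const _)
    have h3 : ∫ d, (-(y ^ 2 + d ^ 2) / s - x₀) ∂(θ.condKernel v) = 0 := by
      rw [integral_sub hi (integrable_const _), integral_div, integral_neg,
        integral_add (integrable_const _) hv]
      simp [hx₀, condSq]
    refine le_trans (le_of_eq ?_)
      (integral_mono (((((integrable_const (1 : ℝ)).add hi2).const_mul _).const_mul _))
        (integrable_gaussDensity_sub hs _) h1)
    simp only [Pi.add_apply]
    rw [integral_const_mul, integral_const_mul, integral_add (integrable_const _) hi2, h3]
    simp
  calc _ = Real.log ((√(2 * Real.pi * s))⁻¹ * Real.exp x₀) := by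
        rw [Real.log_mul (by positivity) (Real.exp_pos _).ne', Real.log_exp,
          log_sqrt_two_pi_inv hs, hx₀]; ring
    _ ≤ _ := Real.log_le_log (by positivity) key

lemma fst_noisyLaw (θ : Measure (γ × ℝ)) [SFinite θ] (s : ℝ) : (noisyLaw θ s).fst = θ.fst := by
  rw [noisyLaw, Measure.fst, Measure.map_map measurable_fst (by fun_prop)]
  have : (Prod.fst ∘ fun w : (γ × ℝ) × ℝ ↦ (w.1.1, w.1.2 + w.2)) = Prod.fst ∘ Prod.fst := rfl
  rw [this, ← Measure.map_map measurable_fst measurable_fst]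
  congr 1
  exact Measure.fst_prod

lemma memLp_snd_noisyLaw (h : MemLp (fun w : γ × ℝ ↦ w.2) 2 θ) :
    MemLp (fun w : γ × ℝ ↦ w.2) 2 (noisyLaw θ s) := by
  rw [noisyLaw, memLp_map_measure_iff (by fun_prop) (by fun_prop)]
  exact (h.comp_fst (gaussNoise s)).add ((memLp_id_gaussNoise s).comp_snd θ)

lemma integrable_condSq_noisyLaw (h : MemLp (fun w : γ × ℝ ↦ w.2) 2 θ) :
    Integrable (fun z : γ × ℝ ↦ condSq θ z.1) (noisyLaw θ s) := by
  have := integrable_condSq h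
  rw [← fst_noisyLaw θ s, Measure.fst, integrable_map_measure] at this
  · exact this
  · exact this.1
  · fun_prop

lemma integrable_log_mixDensity {t : ℝ} (hs : 0 < s) (h : MemLp (fun w : γ × ℝ ↦ w.2) 2 θ) :
    Integrable (fun z ↦ Real.log (mixDensity θ s z)) (noisyLaw θ t) := by
  have h1 : Integrable (fun z : γ × ℝ ↦ |1 / 2 * Real.log (2 * Real.pi * s)|
      + (z.2 ^ 2 + condSq θ z.1) / s) (noisyLaw θ t) :=
    (integrable_const _).add
      (((memLp_snd_noisyLaw h).integrable_sq.add (integrable_condSq_noisyLaw h)).div_const _)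
  refine h1.mono' (measurable_mixDensity θ).log.aestronglyMeasurable ?_
  have h2 : ∀ᵐ z ∂noisyLaw θ t, Integrable (fun d ↦ d ^ 2) (θ.condKernel z.1) := by
    have := ae_integrable_sq_condKernel h
    rw [← fst_noisyLaw θ t] at this
    exact ae_of_ae_map measurable_fst.aemeasurable this
  filter_upwards [h2] with z hz
  have h3 := le_log_mixDensity hs hz z.2
  have h4 := log_mixDensity_le (θ := θ) hs z
  have h5 : 0 ≤ (z.2 ^ 2 + condSq θ z.1) / s :=
    div_nonneg (add_nonneg (sq_nonneg _) (condSq_nonneg _)) hs.le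
  rw [Real.norm_eq_abs, abs_le]
  constructor
  · linarith [le_abs_self (1 / 2 * Real.log (2 * Real.pi * s))]
  · linarith [neg_abs_le (1 / 2 * Real.log (2 * Real.pi * s))]

end CondEnt

/-! ### Upper and lower bounds for the conditional entropy. -/

section CondEntBounds

variable {γ : Type*} [MeasurableSpace γ] {θ : Measure (γ × ℝ)} [IsProbabilityMeasure θ] {s : ℝ}

/-- Second moment of an independent sum with centred Gaussian noise. -/
lemma integral_add_gaussNoise_sq {Ω : Type*} [MeasurableSpace Ω] {P : Measure Ω}
    [IsProbabilityMeasure P] {f : Ω → ℝ} (hf : MemLp f 2 P) (hs : 0 ≤ s) :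
    ∫ w : Ω × ℝ, (f w.1 + w.2) ^ 2 ∂(P.prod (gaussNoise s)) = ∫ ω, f ω ^ 2 ∂P + s := by
  have h1 : MemLp (fun w : Ω × ℝ ↦ f w.1) 2 (P.prod (gaussNoise s)) := hf.comp_fst _
  have h2 : MemLp (fun w : Ω × ℝ ↦ w.2) 2 (P.prod (gaussNoise s)) :=
    (memLp_id_gaussNoise s).comp_snd _
  have h3 : Integrable (fun w : Ω × ℝ ↦ f w.1 * w.2) (P.prod (gaussNoise s)) :=
    h1.integrable_mul h2
  have : ∀ w : Ω × ℝ, (f w.1 + w.2) ^ 2 = f w.1 ^ 2 + (2 * (f w.1 * w.2) + w.2 ^ 2) := fun w ↦ by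
    ring
  simp_rw [this]
  have h4 : Integrable (fun w : Ω × ℝ ↦ 2 * (f w.1 * w.2) + w.2 ^ 2) (P.prod (gaussNoise s)) :=
    (h3.const_mul 2).add h2.integrable_sq
  rw [integral_add h1.integrable_sq h4, integral_add (h3.const_mul 2) h2.integrable_sq, integral_const_mul, integral_prod_mul f (fun z ↦ z),
    integral_fun_fst (fun ω ↦ f ω ^ 2), integral_fun_snd (fun z : ℝ ↦ z ^ 2)]
  simp [integral_sq_gaussNoise hs]

lemma integral_noisyLaw {θ : Measure (γ × ℝ)} {F : γ × ℝ → ℝ} (hF : Measurable F) :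
    ∫ z, F z ∂noisyLaw θ s = ∫ w, F (w.1.1, w.1.2 + w.2) ∂(θ.prod (gaussNoise s)) := by
  rw [noisyLaw, integral_map (by fun_prop) hF.aestronglyMeasurable]

/-- Gaussian laws maximise the conditional entropy. -/
lemma condEnt_le (hs : 0 < s) (hθ : MemLp (fun w : γ × ℝ ↦ w.2) 2 θ) {b : γ → ℝ}
    (hb : Measurable b) (hbθ : MemLp (fun w : γ × ℝ ↦ w.2 - b w.1) 2 θ) {v : ℝ} (hv : 0 < v) :
    condEnt θ s ≤ 1 / 2 * Real.log (2 * Real.pi * v)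
      + (∫ w, (w.2 - b w.1) ^ 2 ∂θ + s) / (2 * v) := by
  have hm : Measurable fun z : γ × ℝ ↦ gaussDensity v (z.2 - b z.1) := by fun_prop
  have h1 : MemLp (fun w : (γ × ℝ) × ℝ ↦ (w.1.2 - b w.1.1) + w.2) 2 (θ.prod (gaussNoise s)) :=
    (hbθ.comp_fst _).add ((memLp_id_gaussNoise s).comp_snd θ)
  have h2 : Integrable (fun z : γ × ℝ ↦ (z.2 - b z.1) ^ 2) (noisyLaw θ s) := by
    rw [noisyLaw, integrable_map_measure (Measurable.aestronglyMeasurable (by fun_prop))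
      (by fun_prop)]
    refine h1.integrable_sq.congr (Filter.Eventually.of_forall fun w ↦ ?_)
    simp only [Function.comp]; ring
  have h3 : Integrable (fun z : γ × ℝ ↦ Real.log (gaussDensity v (z.2 - b z.1)))
      (noisyLaw θ s) := by
    simp_rw [log_gaussDensity hv]
    exact (integrable_const _).sub (h2.div_const _)
  -- The competitor is the Gaussian conditional density with mean `b` and variance `v`.
  have h4 := integral_log_le_integral_log_density (noisyLaw_eq_withDensity θ hs)
    (measurable_mixDensity θ) hm (mixDensity_pos θ hs) (fun z ↦ gaussDensity_pos hv _) ?_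
    (integrable_log_mixDensity hs hθ) h3
  · simp_rw [log_gaussDensity hv] at h4
    rw [integral_sub (integrable_const _) (h2.div_const _), integral_div,
      integral_noisyLaw (F := fun z ↦ (z.2 - b z.1) ^ 2) (by fun_prop)] at h4
    have h5 := integral_add_gaussNoise_sq hbθ hs.le
    have h6 : ∫ w : (γ × ℝ) × ℝ, (w.1.2 + w.2 - b w.1.1) ^ 2 ∂(θ.prod (gaussNoise s))
        = ∫ w, (w.2 - b w.1) ^ 2 ∂θ + s := by
      rw [← h5]; congr 1; ext w; ring
    rw [h6] at h4
    simp at h4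
    unfold condEnt
    linarith
  · rw [lintegral_prod _ (by fun_prop)]
    simp [lintegral_gaussDensity hv]

/-- A version of `condEnt_le` with the optimal variance. -/
lemma condEnt_le_log (hs : 0 < s) (hθ : MemLp (fun w : γ × ℝ ↦ w.2) 2 θ) {b : γ → ℝ}
    (hb : Measurable b) (hbθ : MemLp (fun w : γ × ℝ ↦ w.2 - b w.1) 2 θ) {v : ℝ}
    (hv : ∫ w, (w.2 - b w.1) ^ 2 ∂θ + s ≤ v) :
    condEnt θ s ≤ 1 / 2 * Real.log (2 * Real.pi * v) + 1 / 2 := by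
  have h0 : 0 ≤ ∫ w, (w.2 - b w.1) ^ 2 ∂θ := integral_nonneg fun w ↦ sq_nonneg _
  have hv0 : 0 < v := by linarith
  refine (condEnt_le hs hθ hb hbθ hv0).trans ?_
  have : (∫ w, (w.2 - b w.1) ^ 2 ∂θ + s) / (2 * v) ≤ 1 / 2 := by
    rw [div_le_div_iff₀ (by positivity) two_pos]
    linarith
  linarith

lemma integral_log_gaussDensity (hs : 0 < s) : ∫ z, Real.log (gaussDensity s z) ∂gaussNoise s
    = -(1 / 2 * Real.log (2 * Real.pi * s)) - 1 / 2 := by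
  simp_rw [log_gaussDensity hs]
  rw [integral_sub (integrable_const _) ((memLp_id_gaussNoise s).integrable_sq.div_const _),
    integral_div, integral_sq_gaussNoise hs.le]
  simp
  field_simp

lemma integrable_log_gaussDensity {t : ℝ} (hs : 0 < s) :
    Integrable (fun z ↦ Real.log (gaussDensity s z)) (gaussNoise t) := by
  simp_rw [log_gaussDensity hs]
  exact (integrable_const _).sub ((memLp_id_gaussNoise t).integrable_sq.div_const _)

lemma integrable_log_mixDensity_add {t : ℝ} (hs : 0 < s)
    (h : MemLp (fun w : γ × ℝ ↦ w.2) 2 θ) :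
    Integrable (fun w : (γ × ℝ) × ℝ ↦ Real.log (mixDensity θ s (w.1.1, w.1.2 + w.2)))
      (θ.prod (gaussNoise t)) := by
  have := integrable_log_mixDensity (t := t) hs h
  rwa [noisyLaw, integrable_map_measure (measurable_mixDensity θ).log.aestronglyMeasurable
      (by fun_prop)] at this

/-- The conditional entropy is at least the entropy of the noise. -/
lemma le_condEnt (hs : 0 < s) (hθ : MemLp (fun w : γ × ℝ ↦ w.2) 2 θ) :
    1 / 2 * Real.log (2 * Real.pi * s) + 1 / 2 ≤ condEnt θ s := by
  have h1 := integrable_log_mixDensity_add (t := s) hs hθ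
  have h2 : Integrable (fun w : (γ × ℝ) × ℝ ↦ Real.log (gaussDensity s w.2))
    (θ.prod (gaussNoise s)) := (integrable_log_gaussDensity hs).comp_snd θ
  -- Conditioning lowers entropy: the exponent is the log ratio of the density of D + G given V to
  -- that given (V, D). For fixed (V, D) its exponential has mean one.
  have h3 := integral_nonpos_of_lintegral_exp_le_one (h1.sub h2) ?_
  · simp only [Pi.sub_apply] at h3
    rw [integral_sub h1 h2, integral_fun_snd (fun z ↦ Real.log (gaussDensity s z)),
      integral_log_gaussDensity hs] at h3
    rw [condEnt, integral_noisyLaw (measurable_mixDensity θ).log]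
    simp at h3
    linarith
  · have hm := measurable_mixDensity (s := s) θ
    rw [lintegral_prod _ (by simp only [Pi.sub_apply]; fun_prop)]
    refine (lintegral_congr fun w ↦ ?_).trans_le (le_of_eq (lintegral_one.trans measure_univ))
    simp only [Pi.sub_apply]
    rw [lintegral_gaussNoise hs (by fun_prop), ← lintegral_mixDensity θ hs w.1,
      ← lintegral_add_left_eq_self (fun y ↦ ENNReal.ofReal (mixDensity θ s (w.1, y))) w.2]
    refine lintegral_congr fun z ↦ ?_
    rw [Real.exp_sub, Real.exp_log (mixDensity_pos θ hs _), Real.exp_log (gaussDensity_pos hs _),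
      ← ENNReal.ofReal_mul (gaussDensity_pos hs _).le, mul_div_cancel₀ _ (gaussDensity_pos hs _).ne']

/-- The conditional entropy computed from any conditional density is a lower bound for
`condEnt`. -/
lemma neg_integral_log_le_condEnt (hs : 0 < s) (hθ : MemLp (fun w : γ × ℝ ↦ w.2) 2 θ)
    {f : γ × ℝ → ℝ} (hfm : Measurable f) (hf : ∀ z, 0 < f z)
    (hfd : noisyLaw θ s = (θ.fst.prod volume).withDensity fun z ↦ ENNReal.ofReal (f z))
    (hfi : Integrable (fun z ↦ Real.log (f z)) (noisyLaw θ s)) :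
    -∫ z, Real.log (f z) ∂noisyLaw θ s ≤ condEnt θ s := by
  refine neg_le_neg (integral_log_le_integral_log_density hfd hfm (measurable_mixDensity θ) hf
    (mixDensity_pos θ hs) ?_ hfi (integrable_log_mixDensity hs hθ))
  have hm := measurable_mixDensity (s := s) θ
  rw [lintegral_prod _ (by fun_prop)]
  simp [lintegral_mixDensity θ hs]

end CondEntBounds

/-! ### Mutual information across a Gaussian channel as a difference of entropies. -/

section MutualInfo

variable {γ : Type*} [MeasurableSpace γ] (θ : Measure (γ × ℝ)) [IsProbabilityMeasure θ] {s : ℝ}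

/-- The conditional law of `D + G` given `V`. -/
def noisyKernel (s : ℝ) : Kernel γ ℝ :=
  (θ.condKernel ×ₖ Kernel.const γ (gaussNoise s)).map fun w ↦ w.1 + w.2

instance : IsMarkovKernel (noisyKernel θ s) :=
  Kernel.IsMarkovKernel.map _ (by fun_prop)

lemma lintegral_noisyKernel (hs : 0 < s) {F : ℝ → ℝ≥0∞} (hF : Measurable F) (v : γ) :
    ∫⁻ y, F y ∂noisyKernel θ s v = ∫⁻ y, ENNReal.ofReal (mixDensity θ s (v, y)) * F y := by
  rw [noisyKernel, Kernel.map_apply _ (by fun_prop), lintegral_map hF (by fun_prop),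
    Kernel.prod_apply, Kernel.const_apply, lintegral_prod _ (by fun_prop)]
  have h1 : ∀ d, ∫⁻ z, F (d + z) ∂gaussNoise s
      = ∫⁻ y, ENNReal.ofReal (gaussDensity s (y - d)) * F y := fun d ↦ by
    rw [lintegral_gaussNoise hs (by fun_prop), ← lintegral_sub_right_eq_self _ d]
    simp
  simp_rw [h1]
  rw [lintegral_lintegral_swap (Measurable.aemeasurable (by fun_prop))]
  refine lintegral_congr fun y ↦ ?_
  rw [lintegral_mul_const _ (by fun_prop), ofReal_mixDensity θ hs]

lemma noisyLaw_eq_compProd (hs : 0 < s) : noisyLaw θ s = θ.fst ⊗ₘ noisyKernel θ s := by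
  refine Measure.ext_of_lintegral _ fun F hF ↦ ?_
  rw [lintegral_noisyLaw θ hs hF, Measure.lintegral_compProd hF]
  exact lintegral_congr fun v ↦ (lintegral_noisyKernel θ hs (by fun_prop) v).symm

variable {θ} {Ω α : Type*} [MeasurableSpace Ω] [MeasurableSpace α] [StandardBorelSpace α]
  [Nonempty α] {P : Measure Ω} [IsProbabilityMeasure P]

/-- The conditional mutual information of an input and a Gaussian observation of it, in terms of
the conditional entropy of the observation. -/
lemma toReal_condMutualInfo {U : Ω → α} {Y : Ω → ℝ} {W : Ω → γ} (hU : Measurable U)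
    (hY : Measurable Y) (hW : Measurable W) {D : γ × α → ℝ} (hD : Measurable D)
    (hlaw : P.map (fun ω ↦ ((W ω, U ω), Y ω)) =
      ((P.map fun ω ↦ (W ω, U ω)).prod (gaussNoise 1)).map fun w ↦ (w.1, D w.1 + w.2))
    (hθ : (P.map fun ω ↦ (W ω, U ω)).map (fun w ↦ (w.1, D w)) = θ)
    (hθ2 : MemLp (fun w : γ × ℝ ↦ w.2) 2 θ) :
    (condMutualInfo U Y W P).toReal
      = condEnt θ 1 - (1 / 2 * Real.log (2 * Real.pi * 1) + 1 / 2) := by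
  have hs : (0 : ℝ) < 1 := one_pos
  have hm := measurable_mixDensity (s := 1) θ
  set WU := P.map fun ω ↦ (W ω, U ω) with hWU
  have : IsProbabilityMeasure WU := Measure.isProbabilityMeasure_map (by fun_prop)
  have hfst : θ.fst = P.map W := by
    rw [← hθ, Measure.fst, Measure.map_map measurable_fst (by fun_prop), hWU,
      Measure.map_map (by fun_prop) (by fun_prop)]
    rfl
  have hWY : P.map (fun ω ↦ (W ω, Y ω)) = noisyLaw θ 1 := by
    have : (fun ω ↦ (W ω, Y ω)) = (fun w : (γ × α) × ℝ ↦ (w.1.1, w.2)) ∘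
        fun ω ↦ ((W ω, U ω), Y ω) := rfl
    rw [this, ← Measure.map_map (by fun_prop) (by fun_prop), hlaw, noisyLaw, ← hθ]
    have h2 : ((WU.map fun w ↦ (w.1, D w)).prod (gaussNoise 1)) =
        (WU.prod (gaussNoise 1)).map (Prod.map (fun w ↦ (w.1, D w)) id) := by
      rw [← Measure.map_prod_map _ _ (by fun_prop) (by fun_prop), Measure.map_id]
    rw [h2, Measure.map_map (by fun_prop) (by fun_prop), Measure.map_map (by fun_prop)
      (by fun_prop)]
    rfl
  have hcY : condDistrib Y W P =ᵐ[P.map W] noisyKernel θ 1 :=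
    condDistrib_ae_eq_of_measure_eq_compProd W hY.aemeasurable
      (by rw [hWY, noisyLaw_eq_compProd θ hs, hfst])
  set ν := (P.map W) ⊗ₘ ((condDistrib U W P) ×ₖ (condDistrib Y W P)) with hν
  -- The likelihood ratio of the joint law to the conditionally independent coupling: channel
  -- density over conditional output density given `W`.
  set h : γ × α × ℝ → ℝ := fun w ↦ gaussDensity 1 (w.2.2 - D (w.1, w.2.1))
    / mixDensity θ 1 (w.1, w.2.2) with hh
  have hhm : Measurable h := by fun_prop
  have hhpos : ∀ w, 0 < h w := fun w ↦ div_pos (gaussDensity_pos hs _) (mixDensity_pos θ hs _)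
  have hμ : P.map (fun ω ↦ (W ω, U ω, Y ω)) = ν.withDensity fun w ↦ ENNReal.ofReal (h w) := by
    refine Measure.ext_of_lintegral _ fun F hF ↦ ?_
    have hprod : Measurable fun w ↦ ENNReal.ofReal (h w) * F w := by fun_prop
    rw [lintegral_withDensity_eq_lintegral_mul _ (by fun_prop) hF, hν,
      Measure.lintegral_compProd (by exact hprod)]
    have h1 : (fun ω ↦ (W ω, U ω, Y ω)) = (fun w : (γ × α) × ℝ ↦ (w.1.1, w.1.2, w.2)) ∘
        fun ω ↦ ((W ω, U ω), Y ω) := rfl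
    rw [h1, ← Measure.map_map (by fun_prop) (by fun_prop), hlaw,
      Measure.map_map (by fun_prop) (by fun_prop), lintegral_map hF (by fun_prop),
      lintegral_prod _ (by fun_prop), hWU, ← compProd_map_condDistrib hU.aemeasurable]
    have h2 : Measurable fun x : γ × α ↦ ∫⁻ z, F (x.1, x.2, D x + z) ∂gaussNoise 1 :=
      Measurable.lintegral_prod_right'
        (f := fun x : (γ × α) × ℝ ↦ F (x.1.1, x.1.2, D x.1 + x.2)) (by fun_prop)
    refine (Measure.lintegral_compProd (μ := P.map W) (κ := condDistrib U W P) h2).trans ?_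
    refine lintegral_congr_ae ?_
    filter_upwards [hcY] with v hv
    rw [Kernel.prod_apply, hv, lintegral_prod _ (by
      exact (hprod.comp (measurable_prodMk_left (x := v))).aemeasurable)]
    refine lintegral_congr fun u ↦ ?_
    simp only [Pi.mul_apply]
    rw [lintegral_noisyKernel θ hs (by fun_prop), lintegral_gaussNoise hs (by fun_prop),
      ← lintegral_sub_right_eq_self _ (D (v, u))]
    refine lintegral_congr fun y ↦ ?_
    rw [← mul_assoc, ← ENNReal.ofReal_mul (mixDensity_pos θ hs _).le, hh]
    simp only
    rw [mul_div_cancel₀ _ (mixDensity_pos θ hs _).ne']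
    simp
  have hpm : IsProbabilityMeasure (P.map fun ω ↦ (W ω, U ω, Y ω)) :=
    Measure.isProbabilityMeasure_map (by fun_prop)
  have hac : P.map (fun ω ↦ (W ω, U ω, Y ω)) ≪ ν := hμ ▸ withDensity_absolutelyContinuous _ _
  have hllr : llr (P.map fun ω ↦ (W ω, U ω, Y ω)) ν =ᵐ[P.map fun ω ↦ (W ω, U ω, Y ω)]
      fun w ↦ Real.log (gaussDensity 1 (w.2.2 - D (w.1, w.2.1)))
        - Real.log (mixDensity θ 1 (w.1, w.2.2)) := by
    have : (P.map fun ω ↦ (W ω, U ω, Y ω)).rnDeriv ν =ᵐ[ν] fun w ↦ ENNReal.ofReal (h w) := by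
      rw [hμ]; exact Measure.rnDeriv_withDensity _ (by fun_prop)
    filter_upwards [hac.ae_le this] with w hw
    rw [llr, hw, ENNReal.toReal_ofReal (hhpos w).le, hh]
    exact Real.log_div (gaussDensity_pos hs _).ne' (mixDensity_pos θ hs _).ne'
  rw [condMutualInfo, InformationTheory.toReal_klDiv_of_measure_eq hac (by
      have := Measure.isProbabilityMeasure_map (μ := P) hW.aemeasurable
      rw [measure_univ, hν, measure_univ]), integral_congr_ae hllr]
  have hassoc : P.map (fun ω ↦ (W ω, U ω, Y ω)) =
      (WU.prod (gaussNoise 1)).map fun w ↦ (w.1.1, w.1.2, D w.1 + w.2) := by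
    have h1 : (fun ω ↦ (W ω, U ω, Y ω)) = (fun w : (γ × α) × ℝ ↦ (w.1.1, w.1.2, w.2)) ∘
        fun ω ↦ ((W ω, U ω), Y ω) := rfl
    rw [h1, ← Measure.map_map (by fun_prop) (by fun_prop), hlaw,
      Measure.map_map (by fun_prop) (by fun_prop)]
    rfl
  rw [hassoc, integral_map (by fun_prop) (Measurable.aestronglyMeasurable (by fun_prop))]
  simp only [Prod.mk.eta, add_sub_cancel_left]
  have hmap : (WU.prod (gaussNoise 1)).map (fun w ↦ (w.1.1, D w.1 + w.2)) = noisyLaw θ 1 := by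
    rw [← hWY]
    have h1 : (fun ω ↦ (W ω, Y ω)) = (fun w : γ × α × ℝ ↦ (w.1, w.2.2)) ∘
        fun ω ↦ (W ω, U ω, Y ω) := rfl
    rw [h1, ← Measure.map_map (by fun_prop) (by fun_prop), hassoc,
      Measure.map_map (by fun_prop) (by fun_prop)]
    rfl
  have hi1 : Integrable (fun w : (γ × α) × ℝ ↦ Real.log (gaussDensity 1 w.2))
    (WU.prod (gaussNoise 1)) := (integrable_log_gaussDensity hs).comp_snd WU
  have hi2 : Integrable (fun w : (γ × α) × ℝ ↦ Real.log (mixDensity θ 1 (w.1.1, D w.1 + w.2)))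
      (WU.prod (gaussNoise 1)) := by
    have := integrable_log_mixDensity (t := 1) hs hθ2
    rwa [← hmap, integrable_map_measure hm.log.aestronglyMeasurable (by fun_prop)] at this
  rw [integral_sub hi1 hi2, integral_fun_snd (fun z ↦ Real.log (gaussDensity 1 z)),
    integral_log_gaussDensity hs, condEnt, ← hmap,
    integral_map (by fun_prop) hm.log.aestronglyMeasurable]
  simp
  ring

end MutualInfo

/-! ### Derivatives of the Gaussian density -/

/-- The derivative of the Gaussian density. -/
def gaussDeriv (s x : ℝ) : ℝ := -(x / s) * gaussDensity s x

/-- The second derivative of the Gaussian density. -/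
def gaussDeriv₂ (s x : ℝ) : ℝ := (x ^ 2 / s ^ 2 - 1 / s) * gaussDensity s x

@[fun_prop]
lemma measurable_gaussDeriv (s : ℝ) : Measurable (gaussDeriv s) := by
  unfold gaussDeriv; fun_prop

@[fun_prop]
lemma measurable_gaussDeriv₂ (s : ℝ) : Measurable (gaussDeriv₂ s) := by
  unfold gaussDeriv₂; fun_prop

lemma hasDerivAt_gaussDensity {s : ℝ} (hs : 0 < s) (x : ℝ) :
    HasDerivAt (gaussDensity s) (gaussDeriv s x) x := by
  unfold gaussDensity gaussDeriv gaussDensity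
  have h : HasDerivAt (fun x : ℝ ↦ -x ^ 2 / (2 * s)) (-(x / s)) x := by
    exact (((hasDerivAt_pow 2 x).neg).div_const (2 * s)).congr_deriv (by simp; field_simp)
  exact (h.exp.const_mul ((√(2 * Real.pi * s))⁻¹)).congr_deriv (by ring)

lemma hasDerivAt_gaussDeriv {s : ℝ} (hs : 0 < s) (x : ℝ) :
    HasDerivAt (gaussDeriv s) (gaussDeriv₂ s x) x := by
  have h := ((hasDerivAt_id x).div_const s).neg.mul (hasDerivAt_gaussDensity hs x)
  have h2 : gaussDeriv₂ s x = -(1 / s) * gaussDensity s x + -(id x / s) * gaussDeriv s x := by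
    simp only [gaussDeriv₂, gaussDeriv, id]; field_simp; ring
  rw [h2]
  exact h

/-- The Gaussian density solves the heat equation. -/
lemma hasDerivAt_gaussDensity_var {s : ℝ} (hs : 0 < s) (x : ℝ) :
    HasDerivAt (fun s ↦ gaussDensity s x) (1 / 2 * gaussDeriv₂ s x) s := by
  have hpos : 0 < 2 * Real.pi * s := by positivity
  have h1 : HasDerivAt (fun s : ℝ ↦ -x ^ 2 / (2 * s)) (x ^ 2 / (2 * s ^ 2)) s := by
    exact ((hasDerivAt_const s (-x ^ 2)).div ((hasDerivAt_id s).const_mul 2)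
      (by simpa using hs.ne')).congr_deriv (by simp; field_simp)
  have h2 : HasDerivAt (fun s : ℝ ↦ (√(2 * Real.pi * s))⁻¹)
      (-(1 / (2 * s)) * (√(2 * Real.pi * s))⁻¹) s := by
    have h3 := (((hasDerivAt_id s).const_mul (2 * Real.pi)).sqrt (by simpa using hs.ne')).inv
      (by simp only [id]; positivity)
    refine h3.congr_deriv ?_
    simp only [id, mul_one]
    rw [Real.sq_sqrt hpos.le]
    field_simp
  unfold gaussDensity gaussDeriv₂ gaussDensity
  refine (h2.mul h1.exp).congr_deriv ?_
  field_simp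
  ring

/-- All the derivatives in question at variances near `s₀` are dominated by the Gaussian density of
variance `2 * s₀`. -/
lemma gaussDensity_dominated {s₀ s : ℝ} (h0 : 0 < s₀) (h1 : s₀ / 2 ≤ s) (h2 : s ≤ 3 * s₀ / 2)
    (x : ℝ) : gaussDensity s x ≤ (100 + 100 / s₀) * gaussDensity (2 * s₀) x ∧
      |gaussDeriv s x| ≤ (100 + 100 / s₀) * gaussDensity (2 * s₀) x ∧
      |gaussDeriv₂ s x| ≤ (100 + 100 / s₀) * gaussDensity (2 * s₀) x ∧
      x ^ 2 / s ^ 2 * gaussDensity s x ≤ (100 + 100 / s₀) * gaussDensity (2 * s₀) x := by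
  have hs : 0 < s := by linarith
  set q := x ^ 2 / (4 * s₀) with hq
  have hq0 : 0 ≤ q := by positivity
  have hx : x ^ 2 = 4 * s₀ * q := by rw [hq]; field_simp
  set g := gaussDensity (2 * s₀) x with hg
  have hg0 : 0 < g := gaussDensity_pos (by positivity) x
  have hge : g = (√(2 * Real.pi * (2 * s₀)))⁻¹ * Real.exp (-q) := by
    rw [hg, gaussDensity, hq]; congr 2; field_simp; ring
  -- As s ≤ 3s₀/2, the exponent is at most -4q/3. The part -q yields the dominating Gaussian, and
  -- the spare factor exp(-q/3) absorbs the polynomial factors.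
  have hA : gaussDensity s x ≤ 2 * g * Real.exp (-(q / 3)) := by
    have e1 : (√(2 * Real.pi * s))⁻¹ ≤ 2 * (√(2 * Real.pi * (2 * s₀)))⁻¹ := by
      have : √(2 * Real.pi * (2 * s₀)) = 2 * √(2 * Real.pi * (s₀ / 2)) := by
        rw [show 2 * Real.pi * (2 * s₀) = 2 ^ 2 * (2 * Real.pi * (s₀ / 2)) by ring,
          Real.sqrt_mul (by positivity), Real.sqrt_sq (by norm_num)]
      rw [this, mul_inv, ← mul_assoc, mul_inv_cancel₀ two_ne_zero, one_mul]
      gcongr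
    have e2 : -x ^ 2 / (2 * s) ≤ -q + -(q / 3) := by
      rw [neg_div, hx]
      have : 4 * s₀ * q / (3 * s₀) ≤ 4 * s₀ * q / (2 * s) := by
        exact div_le_div_of_nonneg_left (by positivity) (by positivity) (by linarith)
      have e3 : 4 * s₀ * q / (3 * s₀) = q + q / 3 := by field_simp; ring
      linarith
    calc gaussDensity s x ≤ (2 * (√(2 * Real.pi * (2 * s₀)))⁻¹) * Real.exp (-q + -(q / 3)) := by
          unfold gaussDensity; gcongr
      _ = _ := by rw [Real.exp_add, hge]; ring
  have hexp1 : Real.exp (-(q / 3)) ≤ 1 := Real.exp_le_one_iff.2 (by linarith)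
  have hexpq : q * Real.exp (-(q / 3)) ≤ 3 := by
    have h3 := Real.add_one_le_exp (q / 3)
    rw [Real.exp_neg, ← div_eq_mul_inv, div_le_iff₀ (Real.exp_pos _)]
    linarith
  have hd0 : 0 < gaussDensity s x := gaussDensity_pos hs x
  have B0 : gaussDensity s x ≤ 2 * g := hA.trans (mul_le_of_le_one_right (by positivity) hexp1)
  have B2 : x ^ 2 * gaussDensity s x ≤ 24 * s₀ * g := by
    calc x ^ 2 * gaussDensity s x ≤ (4 * s₀ * q) * (2 * g * Real.exp (-(q / 3))) := by
          rw [hx]; gcongr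
      _ = 8 * s₀ * g * (q * Real.exp (-(q / 3))) := by ring
      _ ≤ 8 * s₀ * g * 3 := by gcongr
      _ = _ := by ring
  have hinv : 1 / s ≤ 2 / s₀ := by
    rw [div_le_div_iff₀ hs h0]; linarith
  have hinv2 : 1 / s ^ 2 ≤ 4 / s₀ ^ 2 := by
    have : (1 / s) ^ 2 ≤ (2 / s₀) ^ 2 := by gcongr
    calc 1 / s ^ 2 = (1 / s) ^ 2 := by ring
      _ ≤ _ := this
      _ = _ := by ring
  have C2 : x ^ 2 / s ^ 2 * gaussDensity s x ≤ 96 / s₀ * g := by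
    calc x ^ 2 / s ^ 2 * gaussDensity s x = (1 / s ^ 2) * (x ^ 2 * gaussDensity s x) := by ring
      _ ≤ (4 / s₀ ^ 2) * (24 * s₀ * g) := by gcongr
      _ = _ := by field_simp; ring
  have C0 : 1 / s * gaussDensity s x ≤ 4 / s₀ * g := by
    calc _ ≤ 2 / s₀ * (2 * g) := by gcongr
      _ = _ := by ring
  have hs0g : 0 < g / s₀ := by positivity
  have r1 : (100 + 100 / s₀) * g = 100 * g + 100 * (g / s₀) := by ring
  have r2 : 96 / s₀ * g = 96 * (g / s₀) := by ring
  have r3 : 4 / s₀ * g = 4 * (g / s₀) := by ring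
  refine ⟨by linarith, ?_, ?_, by linarith⟩
  · rw [gaussDeriv, abs_mul, abs_neg, abs_div, abs_of_pos hs, abs_of_pos hd0]
    have hx1 : |x| ≤ 1 + x ^ 2 := by
      nlinarith [sq_nonneg (|x| - 1), sq_abs x, abs_nonneg x]
    calc |x| / s * gaussDensity s x = 1 / s * (|x| * gaussDensity s x) := by ring
      _ ≤ 2 / s₀ * ((1 + x ^ 2) * gaussDensity s x) := by gcongr
      _ = 2 / s₀ * (gaussDensity s x + x ^ 2 * gaussDensity s x) := by ring
      _ ≤ 2 / s₀ * (2 * g + 24 * s₀ * g) := by gcongr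
      _ = 4 * (g / s₀) + 48 * g := by field_simp; ring
      _ ≤ _ := by linarith
  · rw [gaussDeriv₂, sub_mul]
    have n1 : 0 ≤ x ^ 2 / s ^ 2 * gaussDensity s x := by positivity
    have n2 : 0 ≤ 1 / s * gaussDensity s x := by positivity
    rw [abs_le]
    constructor <;> linarith

lemma gaussDeriv_bounded {s₀ s : ℝ} (h0 : 0 < s₀) (h1 : s₀ / 2 ≤ s) (h2 : s ≤ 3 * s₀ / 2) (x : ℝ) :
    |gaussDensity s x| ≤ (100 + 100 / s₀) * (√(2 * Real.pi * (2 * s₀)))⁻¹ ∧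
    |gaussDeriv s x| ≤ (100 + 100 / s₀) * (√(2 * Real.pi * (2 * s₀)))⁻¹ ∧
    |gaussDeriv₂ s x| ≤ (100 + 100 / s₀) * (√(2 * Real.pi * (2 * s₀)))⁻¹ ∧
    |x ^ 2 / s ^ 2 * gaussDensity s x| ≤ (100 + 100 / s₀) * (√(2 * Real.pi * (2 * s₀)))⁻¹ := by
  have hs : 0 < s := by linarith
  have hg := gaussDensity_le (show 0 < 2 * s₀ by positivity) x
  have hg' : (100 + 100 / s₀) * gaussDensity (2 * s₀) x
      ≤ (100 + 100 / s₀) * (√(2 * Real.pi * (2 * s₀)))⁻¹ := by gcongr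
  have hd := gaussDensity_pos hs x
  obtain ⟨a, b, c, d⟩ := gaussDensity_dominated h0 h1 h2 x
  rw [abs_of_pos hd, abs_of_nonneg (show 0 ≤ x ^ 2 / s ^ 2 * gaussDensity s x by positivity)]
  exact ⟨a.trans hg', b.trans hg', c.trans hg', d.trans hg'⟩

/-! ### Mixtures -/

section Mix

variable {γ : Type*} [MeasurableSpace γ] (θ : Measure (γ × ℝ)) [IsProbabilityMeasure θ] {s : ℝ}

/-- The mixture of the translates of `F` under the conditional law of `D` given `V`. -/
def mix (F : ℝ → ℝ) (z : γ × ℝ) : ℝ := ∫ d, F (z.2 - d) ∂(θ.condKernel z.1)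

lemma measurable_mix {F : ℝ → ℝ} (hF : Measurable F) : Measurable (mix θ F) := by
  unfold mix
  have h : StronglyMeasurable (fun p : (γ × ℝ) × ℝ ↦ F (p.1.2 - p.2)) :=
    Measurable.stronglyMeasurable (by fun_prop)
  exact (h.integral_kernel_prod_right' (κ := θ.condKernel.comap Prod.fst measurable_fst)).measurable

lemma integrable_mix {F : ℝ → ℝ} (hF : Measurable F) {C : ℝ} (hC : ∀ x, |F x| ≤ C) (z : γ × ℝ) :
    Integrable (fun d ↦ F (z.2 - d)) (θ.condKernel z.1) :=
  Integrable.of_bound (Measurable.aestronglyMeasurable (by fun_prop)) C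
    (Filter.Eventually.of_forall fun d ↦ hC _)

lemma abs_mix_le {s : ℝ} (hs : 0 < s) {F : ℝ → ℝ} {C : ℝ}
    (hC : ∀ x, |F x| ≤ C * gaussDensity s x) (z : γ × ℝ) : |mix θ F z| ≤ C * mixDensity θ s z := by
  unfold mix mixDensity
  rw [← integral_const_mul, ← Real.norm_eq_abs]
  exact norm_integral_le_of_norm_le ((integrable_gaussDensity_sub hs _).const_mul _)
    (Filter.Eventually.of_forall fun d ↦ by simpa using hC (z.2 - d))

lemma hasDerivAt_mix {F F' : ℝ → ℝ} (hF : Measurable F) (hF' : Measurable F') {C : ℝ}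
    (hC : ∀ x, |F x| ≤ C) (hC' : ∀ x, |F' x| ≤ C) (hd : ∀ x, HasDerivAt F (F' x) x) (v : γ) (y : ℝ) :
    HasDerivAt (fun y ↦ mix θ F (v, y)) (mix θ F' (v, y)) y := by
  refine (hasDerivAt_integral_of_dominated_loc_of_deriv_le (μ := θ.condKernel v)
    (F := fun y d ↦ F (y - d)) (F' := fun y d ↦ F' (y - d)) (bound := fun _ ↦ C)
    Filter.univ_mem (Filter.Eventually.of_forall fun y ↦ Measurable.aestronglyMeasurable (by fun_prop))
    (integrable_mix θ hF hC (v, y)) (Measurable.aestronglyMeasurable (by fun_prop))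
    (Filter.Eventually.of_forall fun d y _ ↦ hC' _) (integrable_const _)
    (Filter.Eventually.of_forall fun d y _ ↦ ?_)).2
  exact ((hd (y - d)).comp y ((hasDerivAt_id y).sub_const d)).congr_deriv (mul_one _)

lemma hasDerivAt_mixDensity (hs : 0 < s) (v : γ) (y : ℝ) :
    HasDerivAt (fun y ↦ mixDensity θ s (v, y)) (mix θ (gaussDeriv s) (v, y)) y :=
  hasDerivAt_mix θ (by fun_prop) (by fun_prop)
    (fun x ↦ (gaussDeriv_bounded hs (by linarith) (by linarith) x).1)
    (fun x ↦ (gaussDeriv_bounded hs (by linarith) (by linarith) x).2.1)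
    (hasDerivAt_gaussDensity hs) v y

lemma hasDerivAt_mix_gaussDeriv (hs : 0 < s) (v : γ) (y : ℝ) :
    HasDerivAt (fun y ↦ mix θ (gaussDeriv s) (v, y)) (mix θ (gaussDeriv₂ s) (v, y)) y :=
  hasDerivAt_mix θ (by fun_prop) (by fun_prop)
    (fun x ↦ (gaussDeriv_bounded hs (by linarith) (by linarith) x).2.1)
    (fun x ↦ (gaussDeriv_bounded hs (by linarith) (by linarith) x).2.2.1)
    (hasDerivAt_gaussDeriv hs) v y

lemma mem_ball_half {s₀ s : ℝ} (h : s ∈ Metric.ball s₀ (s₀ / 2)) :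
    s₀ / 2 ≤ s ∧ s ≤ 3 * s₀ / 2 := by
  rw [Real.ball_eq_Ioo] at h
  exact ⟨by linarith [h.1], by linarith [h.2]⟩

lemma hasDerivAt_mixDensity_var (hs : 0 < s) (z : γ × ℝ) :
    HasDerivAt (fun s ↦ mixDensity θ s z) (1 / 2 * mix θ (gaussDeriv₂ s) z) s := by
  have h := (hasDerivAt_integral_of_dominated_loc_of_deriv_le (μ := θ.condKernel z.1)
    (F := fun s d ↦ gaussDensity s (z.2 - d)) (F' := fun s d ↦ 1 / 2 * gaussDeriv₂ s (z.2 - d))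
    (bound := fun _ ↦ 1 / 2 * ((100 + 100 / s) * (√(2 * Real.pi * (2 * s)))⁻¹))
    (Metric.ball_mem_nhds s (half_pos hs))
    (Filter.Eventually.of_forall fun y ↦ Measurable.aestronglyMeasurable (by fun_prop))
    (integrable_gaussDensity_sub hs _) (Measurable.aestronglyMeasurable (by fun_prop))
    (Filter.Eventually.of_forall fun d t ht ↦ ?_) (integrable_const _)
    (Filter.Eventually.of_forall fun d t ht ↦ ?_)).2
  · rw [integral_const_mul] at h
    exact h
  · obtain ⟨h1, h2⟩ := mem_ball_half ht
    rw [norm_mul, Real.norm_of_nonneg (by norm_num : (0 : ℝ) ≤ 1 / 2)]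
    gcongr
    exact (gaussDeriv_bounded hs h1 h2 _).2.2.1
  · obtain ⟨h1, h2⟩ := mem_ball_half ht
    exact hasDerivAt_gaussDensity_var (by linarith) _

lemma continuousAt_mix_gaussDeriv (hs : 0 < s) (z : γ × ℝ) :
    ContinuousAt (fun s ↦ mix θ (gaussDeriv s) z) s := by
  refine continuousAt_of_dominated (bound := fun _ ↦ (100 + 100 / s) * (√(2 * Real.pi * (2 * s)))⁻¹)
    (Filter.Eventually.of_forall fun y ↦ Measurable.aestronglyMeasurable (by fun_prop)) ?_
    (integrable_const _) (Filter.Eventually.of_forall fun d ↦ ?_)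
  · filter_upwards [Metric.ball_mem_nhds s (half_pos hs)] with t ht
    obtain ⟨h1, h2⟩ := mem_ball_half ht
    exact Filter.Eventually.of_forall fun d ↦ (gaussDeriv_bounded hs h1 h2 _).2.1
  · unfold gaussDeriv
    exact ((continuousAt_const.div continuousAt_id hs.ne').neg).mul
      (hasDerivAt_gaussDensity_var hs _).continuousAt

/-- Integration against the noisy law. -/
lemma integrable_noisyLaw_iff (hs : 0 < s) {F : γ × ℝ → ℝ} :
    Integrable F (noisyLaw θ s) ↔
      Integrable (fun z ↦ mixDensity θ s z * F z) (θ.fst.prod volume) := by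
  rw [noisyLaw_eq_withDensity θ hs, integrable_withDensity_iff_integrable_smul'
    (measurable_mixDensity θ).ennreal_ofReal (Filter.Eventually.of_forall fun _ ↦ by simp)]
  simp [ENNReal.toReal_ofReal (mixDensity_pos θ hs _).le]

lemma integral_noisyLaw_eq (hs : 0 < s) (F : γ × ℝ → ℝ) :
    ∫ z, F z ∂noisyLaw θ s = ∫ z, mixDensity θ s z * F z ∂(θ.fst.prod volume) := by
  rw [noisyLaw_eq_withDensity θ hs, integral_withDensity_eq_integral_toReal_smul
    (measurable_mixDensity θ).ennreal_ofReal (Filter.Eventually.of_forall fun _ ↦ by simp)]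
  simp [ENNReal.toReal_ofReal (mixDensity_pos θ hs _).le]

/-- The Fisher information of `D + G` given `V`. -/
def fisherInfo (s : ℝ) : ℝ :=
  ∫ z, mix θ (gaussDeriv s) z ^ 2 / mixDensity θ s z ∂(θ.fst.prod volume)

/-- Cauchy-Schwarz under the conditional law of D, as γ'²/γ = (x/s)² γ for the Gaussian density γ.
It is obtained by integrating a perfect square, and yields both finiteness of the Fisher information
and a dominating function for its continuity. -/
lemma sq_div_mixDensity_le (hs : 0 < s) (z : γ × ℝ) :
    mix θ (gaussDeriv s) z ^ 2 / mixDensity θ s z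
      ≤ mix θ (fun x ↦ x ^ 2 / s ^ 2 * gaussDensity s x) z := by
  set p := mixDensity θ s z with hp
  have hp0 : 0 < p := mixDensity_pos θ hs z
  set a := mix θ (gaussDeriv s) z with ha
  have hb := fun x ↦ gaussDeriv_bounded (s := s) hs (by linarith) (by linarith) x
  have i1 := integrable_mix θ (F := fun x ↦ x ^ 2 / s ^ 2 * gaussDensity s x) (by fun_prop)
    (fun x ↦ (hb x).2.2.2) z
  have i2 := integrable_mix θ (F := gaussDeriv s) (by fun_prop) (fun x ↦ (hb x).2.1) z
  have i3 := integrable_mix θ (F := gaussDensity s) (by fun_prop) (fun x ↦ (hb x).1) z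
  have key : 0 ≤ ∫ d, ((z.2 - d) ^ 2 / s ^ 2 * gaussDensity s (z.2 - d)
      + -2 * (a / p) * gaussDeriv s (z.2 - d) + (a / p) ^ 2 * gaussDensity s (z.2 - d))
        ∂(θ.condKernel z.1) := by
    refine integral_nonneg fun d ↦ ?_
    have : (z.2 - d) ^ 2 / s ^ 2 * gaussDensity s (z.2 - d)
      + -2 * (a / p) * gaussDeriv s (z.2 - d) + (a / p) ^ 2 * gaussDensity s (z.2 - d)
        = ((z.2 - d) / s + a / p) ^ 2 * gaussDensity s (z.2 - d) := by
      unfold gaussDeriv; ring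
    simp only [Pi.zero_apply, this]
    have := gaussDensity_pos hs (z.2 - d)
    positivity
  rw [integral_add (by exact i1.add (i2.const_mul _)) (i3.const_mul _),
    integral_add i1 (i2.const_mul _), integral_const_mul, integral_const_mul] at key
  change 0 ≤ mix θ (fun x ↦ x ^ 2 / s ^ 2 * gaussDensity s x) z + -2 * (a / p) * a
    + (a / p) ^ 2 * p at key
  have : -2 * (a / p) * a + (a / p) ^ 2 * p = -(a ^ 2 / p) := by field_simp; ring
  linarith

lemma sq_div_mixDensity_dominated {s₀ : ℝ} (h0 : 0 < s₀) (h1 : s₀ / 2 ≤ s) (h2 : s ≤ 3 * s₀ / 2)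
    (z : γ × ℝ) : mix θ (gaussDeriv s) z ^ 2 / mixDensity θ s z
      ≤ (100 + 100 / s₀) * mixDensity θ (2 * s₀) z := by
  have hs : 0 < s := by linarith
  refine (sq_div_mixDensity_le θ hs z).trans ((le_abs_self _).trans
    (abs_mix_le θ (by positivity) (fun x ↦ ?_) z))
  have := gaussDensity_pos hs x
  rw [abs_of_nonneg (by positivity)]
  exact (gaussDensity_dominated h0 h1 h2 x).2.2.2

lemma integrable_mixDensity (hs : 0 < s) : Integrable (mixDensity θ s) (θ.fst.prod volume) := by
  simpa using (integrable_noisyLaw_iff θ hs (F := fun _ ↦ 1)).1 (integrable_const _)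

lemma integrable_fisherInfo (hs : 0 < s) :
    Integrable (fun z ↦ mix θ (gaussDeriv s) z ^ 2 / mixDensity θ s z) (θ.fst.prod volume) := by
  have hm := measurable_mixDensity (s := s) θ
  have hm1 := measurable_mix θ (measurable_gaussDeriv s)
  refine ((integrable_mixDensity θ (s := 2 * s) (by positivity)).const_mul (100 + 100 / s)).mono'
    (Measurable.aestronglyMeasurable (by fun_prop)) (Filter.Eventually.of_forall fun z ↦ ?_)
  rw [Real.norm_of_nonneg (div_nonneg (sq_nonneg _) (mixDensity_pos θ hs z).le)]
  exact sq_div_mixDensity_dominated θ hs (by linarith) (by linarith) z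

lemma continuousAt_fisherInfo (hs : 0 < s) : ContinuousAt (fisherInfo θ) s := by
  refine continuousAt_of_dominated (bound := fun z ↦ (100 + 100 / s) * mixDensity θ (2 * s) z)
    (Filter.Eventually.of_forall fun t ↦ ?_) ?_
    ((integrable_mixDensity θ (s := 2 * s) (by positivity)).const_mul (100 + 100 / s))
    (Filter.Eventually.of_forall fun z ↦ ?_)
  · have hm := measurable_mixDensity (s := t) θ
    have hm1 := measurable_mix θ (measurable_gaussDeriv t)
    exact Measurable.aestronglyMeasurable (by fun_prop)
  · filter_upwards [Metric.ball_mem_nhds s (half_pos hs)] with t ht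
    obtain ⟨h1, h2⟩ := mem_ball_half ht
    refine Filter.Eventually.of_forall fun z ↦ ?_
    rw [Real.norm_of_nonneg (div_nonneg (sq_nonneg _) (mixDensity_pos θ (by linarith) z).le)]
    exact sq_div_mixDensity_dominated θ hs h1 h2 z
  · exact ((continuousAt_mix_gaussDeriv θ hs z).pow 2).div
      (hasDerivAt_mixDensity_var θ hs z).continuousAt (mixDensity_pos θ hs z).ne'

end Mix

/-! ### De Bruijn's identity. -/

section DeBruijn

variable {γ : Type*} [MeasurableSpace γ] {θ : Measure (γ × ℝ)} [IsProbabilityMeasure θ] {s : ℝ}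

lemma condEnt_eq_integral (hs : 0 < s) : condEnt θ s =
    ∫ z, -(mixDensity θ s z * Real.log (mixDensity θ s z)) ∂(θ.fst.prod volume) := by
  rw [condEnt, integral_noisyLaw_eq θ hs, integral_neg]

lemma abs_log_mixDensity_le {s₀ : ℝ} (h0 : 0 < s₀) (h1 : s₀ / 2 ≤ s) (h2 : s ≤ 3 * s₀ / 2) {v : γ}
    (hv : Integrable (fun d ↦ d ^ 2) (θ.condKernel v)) (y : ℝ) :
    |Real.log (mixDensity θ s (v, y))| ≤ |1 / 2 * Real.log (2 * Real.pi * (s₀ / 2))|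
      + |1 / 2 * Real.log (2 * Real.pi * (3 * s₀ / 2))| + 2 / s₀ * (y ^ 2 + condSq θ v) := by
  have hs : 0 < s := by linarith
  have l1 := le_log_mixDensity hs hv y
  have l2 := log_mixDensity_le (θ := θ) hs (v, y)
  have m1 : Real.log (2 * Real.pi * (s₀ / 2)) ≤ Real.log (2 * Real.pi * s) :=
    Real.log_le_log (by positivity) (by gcongr)
  have m2 : Real.log (2 * Real.pi * s) ≤ Real.log (2 * Real.pi * (3 * s₀ / 2)) :=
    Real.log_le_log (by positivity) (by gcongr)
  have hq : 0 ≤ y ^ 2 + condSq θ v := add_nonneg (sq_nonneg _) (condSq_nonneg _)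
  have m3 : (y ^ 2 + condSq θ v) / s ≤ 2 / s₀ * (y ^ 2 + condSq θ v) := by
    rw [div_eq_mul_inv, mul_comm]
    gcongr
    rw [inv_eq_one_div, div_le_div_iff₀ hs h0]; linarith
  have m4 : 0 ≤ (y ^ 2 + condSq θ v) / s := by positivity
  have a1 := neg_abs_le (1 / 2 * Real.log (2 * Real.pi * (s₀ / 2)))
  have a2 := le_abs_self (1 / 2 * Real.log (2 * Real.pi * (3 * s₀ / 2)))
  have a3 := abs_nonneg (1 / 2 * Real.log (2 * Real.pi * (s₀ / 2)))
  have a4 := abs_nonneg (1 / 2 * Real.log (2 * Real.pi * (3 * s₀ / 2)))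
  rw [abs_le]
  constructor <;> linarith

lemma ae_prod_integrable_sq_condKernel (h : MemLp (fun w : γ × ℝ ↦ w.2) 2 θ) :
    ∀ᵐ z ∂(θ.fst.prod (volume : Measure ℝ)), Integrable (fun d ↦ d ^ 2) (θ.condKernel z.1) :=
  Measure.quasiMeasurePreserving_fst.ae (ae_integrable_sq_condKernel h)

/-- The envelope that dominates all the integrands below. -/
def domFun (θ : Measure (γ × ℝ)) [IsProbabilityMeasure θ] (s₀ : ℝ) (z : γ × ℝ) : ℝ :=
  (100 + 100 / s₀) * (mixDensity θ (2 * s₀) z *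
    (1 + |1 / 2 * Real.log (2 * Real.pi * (s₀ / 2))|
      + |1 / 2 * Real.log (2 * Real.pi * (3 * s₀ / 2))| + 2 / s₀ * (z.2 ^ 2 + condSq θ z.1)))

lemma integrable_domFun (h : MemLp (fun w : γ × ℝ ↦ w.2) 2 θ) (hs : 0 < s) :
    Integrable (domFun θ s) (θ.fst.prod volume) := by
  refine Integrable.const_mul ((integrable_noisyLaw_iff θ (by positivity)).1 ?_) _
  exact (integrable_const _).add
    (((memLp_snd_noisyLaw h).integrable_sq.add (integrable_condSq_noisyLaw h)).const_mul _)

lemma abs_mul_log_le_domFun {s₀ : ℝ} (h0 : 0 < s₀) (h1 : s₀ / 2 ≤ s) (h2 : s ≤ 3 * s₀ / 2)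
    {z : γ × ℝ} (hv : Integrable (fun d ↦ d ^ 2) (θ.condKernel z.1)) {a : ℝ}
    (ha : |a| ≤ (100 + 100 / s₀) * mixDensity θ (2 * s₀) z) :
    |a * (Real.log (mixDensity θ s z) + 1)| ≤ domFun θ s₀ z := by
  have hl := abs_log_mixDensity_le (θ := θ) h0 h1 h2 hv z.2
  have hp := mixDensity_pos θ (show 0 < 2 * s₀ by positivity) z
  rw [abs_mul, domFun, ← mul_assoc]
  gcongr
  refine (abs_add_le _ _).trans ?_
  rw [abs_one]
  change |Real.log (mixDensity θ s z)| ≤ _ at hl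
  linarith

/-- The derivative of the conditional entropy along the heat flow is half the Fisher
information. -/
lemma hasDerivAt_condEnt (h : MemLp (fun w : γ × ℝ ↦ w.2) 2 θ) (hs : 0 < s) :
    HasDerivAt (condEnt θ) (1 / 2 * fisherInfo θ s) s := by
  have hm : ∀ t, Measurable (mixDensity θ t) := fun t ↦ measurable_mixDensity θ
  have hm1 := measurable_mix θ (measurable_gaussDeriv s)
  have hm2 := measurable_mix θ (measurable_gaussDeriv₂ s)
  have hF := hasDerivAt_integral_of_dominated_loc_of_deriv_le (μ := θ.fst.prod (volume : Measure ℝ))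
    (F := fun s z ↦ -(mixDensity θ s z * Real.log (mixDensity θ s z)))
    (F' := fun s z ↦ -(1 / 2 * mix θ (gaussDeriv₂ s) z * (Real.log (mixDensity θ s z) + 1)))
    (bound := domFun θ s) (Metric.ball_mem_nhds s (half_pos hs))
    (Filter.Eventually.of_forall fun t ↦ Measurable.aestronglyMeasurable (by fun_prop))
    ((integrable_noisyLaw_iff θ hs).1 (integrable_log_mixDensity hs h)).neg
    (Measurable.aestronglyMeasurable (by fun_prop)) ?_ (integrable_domFun h hs) ?_
  · have hF2 : HasDerivAt (condEnt θ) _ s := hF.2.congr_of_eventuallyEq (by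
      filter_upwards [lt_mem_nhds hs] with t ht using condEnt_eq_integral ht)
    refine hF2.congr_deriv ?_
    have i1 : Integrable (fun z ↦ (Real.log (mixDensity θ s z) + 1) * mix θ (gaussDeriv₂ s) z)
        (θ.fst.prod volume) := by
      refine (hF.1.const_mul (-2)).congr (Filter.Eventually.of_forall fun z ↦ ?_)
      ring
    have i2 := integrable_fisherInfo θ hs
    have i3 : Integrable (fun z ↦ (Real.log (mixDensity θ s z) + 1) * mix θ (gaussDeriv s) z)
        (θ.fst.prod volume) := by
      refine (integrable_domFun h hs).mono' (Measurable.aestronglyMeasurable (by fun_prop)) ?_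
      filter_upwards [ae_prod_integrable_sq_condKernel h] with z hz
      rw [mul_comm]
      exact abs_mul_log_le_domFun hs (by linarith) (by linarith) hz
        (abs_mix_le θ (by positivity)
          (fun x ↦ (gaussDensity_dominated hs (by linarith) (by linarith) x).2.1) z)
    -- The heat equation has put the second derivative of the mixture against log p + 1. One
    -- integration by parts in y turns this into minus the integrand of the Fisher information.
    have ibp : ∀ᵐ v ∂θ.fst, ∫ y, (Real.log (mixDensity θ s (v, y)) + 1) * mix θ (gaussDeriv₂ s) (v, y)
        = -∫ y, mix θ (gaussDeriv s) (v, y) ^ 2 / mixDensity θ s (v, y) := by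
      filter_upwards [i1.prod_right_ae, i2.prod_right_ae, i3.prod_right_ae] with v j1 j2 j3
      have hd : ∀ y, mix θ (gaussDeriv s) (v, y) ^ 2 / mixDensity θ s (v, y)
          = mix θ (gaussDeriv s) (v, y) / mixDensity θ s (v, y) * mix θ (gaussDeriv s) (v, y) :=
        fun y ↦ by ring
      simp_rw [hd] at j2 ⊢
      exact integral_mul_deriv_eq_deriv_mul_of_integrable
        (u := fun y ↦ Real.log (mixDensity θ s (v, y)) + 1)
        (v := fun y ↦ mix θ (gaussDeriv s) (v, y))
        (fun y _ ↦ ((hasDerivAt_mixDensity θ hs v y).log (mixDensity_pos θ hs _).ne').add_const 1)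
        (fun y _ ↦ hasDerivAt_mix_gaussDeriv θ hs v y) j1 j2 j3
    have e1 : ∀ z, -(1 / 2 * mix θ (gaussDeriv₂ s) z * (Real.log (mixDensity θ s z) + 1))
        = -(1 / 2) * ((Real.log (mixDensity θ s z) + 1) * mix θ (gaussDeriv₂ s) z) :=
      fun z ↦ by ring
    simp_rw [e1]
    rw [integral_const_mul, integral_prod _ i1, integral_congr_ae ibp, integral_neg, fisherInfo,
      integral_prod _ i2]
    ring
  · filter_upwards [ae_prod_integrable_sq_condKernel h] with z hz t ht
    obtain ⟨h1, h2⟩ := mem_ball_half ht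
    rw [norm_neg]
    refine abs_mul_log_le_domFun hs h1 h2 hz ?_
    have hb := abs_mix_le θ (by positivity)
      (fun x ↦ (gaussDensity_dominated hs h1 h2 x).2.2.1) z
    rw [abs_mul, abs_of_pos (by norm_num : (0 : ℝ) < 1 / 2)]
    have := abs_nonneg (mix θ (gaussDeriv₂ t) z)
    linarith
  · refine Filter.Eventually.of_forall fun z t ht ↦ ?_
    obtain ⟨h1, h2⟩ := mem_ball_half ht
    have ht0 : 0 < t := by linarith
    have hp := mixDensity_pos θ ht0 z
    have hd := hasDerivAt_mixDensity_var θ ht0 z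
    refine (hd.mul (hd.log hp.ne')).neg.congr_deriv ?_
    field_simp

/-! ### Estimating the noise from the observation -/

/-- The conditional mean of the noise `G` given `V` and `D + G`. -/
def noiseMean (θ : Measure (γ × ℝ)) [IsProbabilityMeasure θ] (s : ℝ) (z : γ × ℝ) : ℝ :=
  -(s * (mix θ (gaussDeriv s) z / mixDensity θ s z))

lemma measurable_noiseMean : Measurable (noiseMean θ s) := by
  have hm := measurable_mixDensity (s := s) θ
  have hm1 := measurable_mix θ (measurable_gaussDeriv s)
  unfold noiseMean; fun_prop

lemma memLp_noiseMean (hs : 0 < s) : MemLp (noiseMean θ s) 2 (noisyLaw θ s) := by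
  rw [memLp_two_iff_integrable_sq measurable_noiseMean.aestronglyMeasurable,
    integrable_noisyLaw_iff θ hs]
  refine ((integrable_fisherInfo θ hs).const_mul (s ^ 2)).congr
    (Filter.Eventually.of_forall fun z ↦ ?_)
  have := mixDensity_pos θ hs z
  simp only [noiseMean]
  field_simp

/-- Bayes' formula: given V and the output y, a value d of the signal has weight `gaussDensity s (y
- d)` under the conditional law, and the noise is y - d. -/
lemma lintegral_prod_gaussNoise (hs : 0 < s) {F : γ × ℝ × ℝ → ℝ≥0∞} (hF : Measurable F) :
    ∫⁻ w, F (w.1.1, w.1.2 + w.2, w.2) ∂(θ.prod (gaussNoise s)) = ∫⁻ z, ∫⁻ d,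
      ENNReal.ofReal (gaussDensity s (z.2 - d)) * F (z.1, z.2, z.2 - d) ∂(θ.condKernel z.1)
        ∂(θ.fst.prod volume) := by
  have hmeas : Measurable fun w : γ × ℝ ↦ ∫⁻ z, F (w.1, w.2 + z, z) ∂gaussNoise s :=
    Measurable.lintegral_prod_right'
      (f := fun x : (γ × ℝ) × ℝ ↦ F (x.1.1, x.1.2 + x.2, x.2)) (by fun_prop)
  have hmeas2 : Measurable fun z : γ × ℝ ↦ ∫⁻ d,
      ENNReal.ofReal (gaussDensity s (z.2 - d)) * F (z.1, z.2, z.2 - d) ∂(θ.condKernel z.1) :=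
    Measurable.lintegral_kernel_prod_right' (κ := θ.condKernel.comap Prod.fst measurable_fst)
      (f := fun x : (γ × ℝ) × ℝ ↦ ENNReal.ofReal (gaussDensity s (x.1.2 - x.2))
        * F (x.1.1, x.1.2, x.1.2 - x.2)) (by fun_prop)
  rw [lintegral_prod _ (by fun_prop), lintegral_eq_lintegral_condKernel θ hmeas,
    lintegral_prod _ hmeas2.aemeasurable]
  refine lintegral_congr fun v ↦ ?_
  have h1 : ∀ d, ∫⁻ z, F (v, d + z, z) ∂gaussNoise s
      = ∫⁻ y, ENNReal.ofReal (gaussDensity s (y - d)) * F (v, y, y - d) := fun d ↦ by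
    rw [lintegral_gaussNoise hs (by fun_prop), ← lintegral_sub_right_eq_self _ d]
    simp
  simp_rw [h1]
  rw [lintegral_lintegral_swap (Measurable.aemeasurable (by fun_prop))]

/-- The mean square error of the conditional mean of the noise, in terms of the Fisher
information. -/
lemma integral_sq_sub_noiseMean (hs : 0 < s) :
    ∫ w, (w.2 - noiseMean θ s (w.1.1, w.1.2 + w.2)) ^ 2 ∂(θ.prod (gaussNoise s))
      = s - s ^ 2 * fisherInfo θ s := by
  have hnm := measurable_noiseMean (θ := θ) (s := s)
  have hb := fun x ↦ gaussDeriv_bounded (s := s) hs (by linarith) (by linarith) x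
  set q : γ × ℝ → ℝ := fun z ↦ s ^ 2 * mix θ (fun x ↦ x ^ 2 / s ^ 2 * gaussDensity s x) z with hq
  have hqm : Measurable q := (measurable_mix θ (by fun_prop)).const_mul _
  have i1 := fun z ↦ integrable_mix θ (F := fun x ↦ x ^ 2 / s ^ 2 * gaussDensity s x) (by fun_prop)
    (fun x ↦ (hb x).2.2.2) z
  have i2 := fun z ↦ integrable_mix θ (F := gaussDeriv s) (by fun_prop) (fun x ↦ (hb x).2.1) z
  have i3 := fun z ↦ integrable_mix θ (F := gaussDensity s) (by fun_prop) (fun x ↦ (hb x).1) z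
  have hq0 : ∀ z, 0 ≤ q z := fun z ↦ mul_nonneg (sq_nonneg _) (integral_nonneg fun d ↦ by
    have := gaussDensity_pos hs (z.2 - d)
    simp only [Pi.zero_apply]; positivity)
  -- Integrating out D leaves a quadratic polynomial in the value of the estimator ψ; the cross term
  -- is a mixture of γ' because γ'(x) = -(x/s) γ(x). For ψ = 0 it gives ∫ q = s, and `noiseMean` is
  -- its pointwise minimiser.
  have key : ∀ (ψ : γ × ℝ → ℝ), Measurable ψ →
      ∫⁻ w, ENNReal.ofReal ((w.2 - ψ (w.1.1, w.1.2 + w.2)) ^ 2) ∂(θ.prod (gaussNoise s))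
        = ∫⁻ z, ENNReal.ofReal (q z + 2 * ψ z * (s * mix θ (gaussDeriv s) z)
          + ψ z ^ 2 * mixDensity θ s z) ∂(θ.fst.prod volume) := fun ψ hψ ↦ by
    rw [lintegral_prod_gaussNoise hs
      (F := fun x ↦ ENNReal.ofReal ((x.2.2 - ψ (x.1, x.2.1)) ^ 2)) (by fun_prop)]
    refine lintegral_congr fun z ↦ ?_
    have e : ∀ d, gaussDensity s (z.2 - d) * (z.2 - d - ψ z) ^ 2
        = s ^ 2 * ((z.2 - d) ^ 2 / s ^ 2 * gaussDensity s (z.2 - d))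
          + 2 * ψ z * s * gaussDeriv s (z.2 - d) + ψ z ^ 2 * gaussDensity s (z.2 - d) := fun d ↦ by
      unfold gaussDeriv; field_simp; ring
    have hi : Integrable (fun d ↦ gaussDensity s (z.2 - d) * (z.2 - d - ψ z) ^ 2)
        (θ.condKernel z.1) := by
      simp_rw [e]
      exact (((i1 z).const_mul _).add ((i2 z).const_mul _)).add ((i3 z).const_mul _)
    simp_rw [← ENNReal.ofReal_mul (gaussDensity_pos hs _).le]
    rw [← ofReal_integral_eq_lintegral_ofReal hi (Filter.Eventually.of_forall fun d ↦
      mul_nonneg (gaussDensity_pos hs _).le (sq_nonneg _))]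
    congr 1
    simp_rw [e]
    rw [integral_add (by exact ((i1 z).const_mul _).add ((i2 z).const_mul _)) ((i3 z).const_mul _),
      integral_add ((i1 z).const_mul _) ((i2 z).const_mul _), integral_const_mul,
      integral_const_mul, integral_const_mul]
    change _ + 2 * ψ z * s * mix θ (gaussDeriv s) z + ψ z ^ 2 * mixDensity θ s z = _
    rw [hq]
    simp only [mix]
    ring
  have hqint : Integrable q (θ.fst.prod volume) := by
    refine Integrable.const_mul ((integrable_mixDensity θ (s := 2 * s) (by positivity)).const_mul
      (100 + 100 / s) |>.mono' (measurable_mix θ (by fun_prop)).aestronglyMeasurable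
      (Filter.Eventually.of_forall fun z ↦ abs_mix_le θ (by positivity) (fun x ↦ ?_) z)) _
    have := gaussDensity_pos hs x
    rw [abs_of_nonneg (by positivity)]
    exact (gaussDensity_dominated hs (by linarith) (by linarith) x).2.2.2
  have hqs : ∫ z, q z ∂(θ.fst.prod volume) = s := by
    have h0 := key (fun _ ↦ 0) measurable_const
    simp only [sub_zero, mul_zero, zero_mul, add_zero, ne_eq, OfNat.ofNat_ne_zero,
      not_false_eq_true, zero_pow] at h0
    rw [integral_eq_lintegral_of_nonneg_ae (Filter.Eventually.of_forall hq0)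
      hqm.aestronglyMeasurable, ← h0, ← integral_eq_lintegral_of_nonneg_ae
      (f := fun w : (γ × ℝ) × ℝ ↦ w.2 ^ 2) (Filter.Eventually.of_forall fun w ↦ sq_nonneg w.2)
      (Measurable.aestronglyMeasurable (by fun_prop)), integral_fun_snd (fun z : ℝ ↦ z ^ 2),
      integral_sq_gaussNoise hs.le]
    simp
  have hval : ∀ z, q z + 2 * noiseMean θ s z * (s * mix θ (gaussDeriv s) z)
      + noiseMean θ s z ^ 2 * mixDensity θ s z
        = q z - s ^ 2 * (mix θ (gaussDeriv s) z ^ 2 / mixDensity θ s z) := fun z ↦ by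
    have := mixDensity_pos θ hs z
    simp only [noiseMean]
    field_simp
    ring
  have hval0 : ∀ z, 0 ≤ q z - s ^ 2 * (mix θ (gaussDeriv s) z ^ 2 / mixDensity θ s z) := fun z ↦ by
    have := sq_div_mixDensity_le θ hs z
    have h2 : s ^ 2 * (mix θ (gaussDeriv s) z ^ 2 / mixDensity θ s z) ≤ q z := by
      exact mul_le_mul_of_nonneg_left this (sq_nonneg s)
    linarith
  have hvi : Integrable (fun z ↦ q z - s ^ 2 * (mix θ (gaussDeriv s) z ^ 2 / mixDensity θ s z))
      (θ.fst.prod volume) := hqint.sub ((integrable_fisherInfo θ hs).const_mul _)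
  rw [integral_eq_lintegral_of_nonneg_ae (Filter.Eventually.of_forall fun w ↦ sq_nonneg _)
    (Measurable.aestronglyMeasurable (by fun_prop)), key _ hnm]
  simp_rw [hval]
  rw [← integral_eq_lintegral_of_nonneg_ae (Filter.Eventually.of_forall hval0) hvi.1,
    integral_sub hqint ((integrable_fisherInfo θ hs).const_mul _), hqs, integral_const_mul,
    fisherInfo]

end DeBruijn

/-! ### A Gibbs estimate along the heat flow -/

section HeatFlow

lemma lintegral_gaussNoise_add {r t : ℝ} (hr : 0 ≤ r) (ht : 0 ≤ t) {F : ℝ → ℝ≥0∞}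
    (hF : Measurable F) :
    ∫⁻ x, ∫⁻ y, F (x + y) ∂gaussNoise t ∂gaussNoise r = ∫⁻ z, F z ∂gaussNoise (r + t) := by
  rw [← gaussNoise_conv hr ht, lintegral_map hF (by fun_prop), lintegral_prod _ (by fun_prop)]

variable {Ω τ ι : Type*} [MeasurableSpace Ω] [MeasurableSpace τ]

/-- The law of `((Q + n • e, T), D + l * n)`, where `(T, Q, D)` is defined on `(Ω, ρ)` and `n` is an
independent centred normal variable of variance `r`. -/
def heatLaw (ρ : Measure Ω) (T : Ω → τ) (Q : Ω → ι → ℝ) (D : Ω → ℝ) (e : ι → ℝ) (l r : ℝ) :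
    Measure (((ι → ℝ) × τ) × ℝ) :=
  (ρ.prod (gaussNoise r)).map fun ω ↦ ((Q ω.1 + ω.2 • e, T ω.1), D ω.1 + l * ω.2)

instance {κ : Type*} (ρ : Measure Ω) [IsFiniteMeasure ρ] (T : Ω → τ) (Q : Ω → κ → ℝ) (D : Ω → ℝ)
    (e : κ → ℝ) (l r : ℝ) : IsFiniteMeasure (heatLaw ρ T Q D e l r) := by
  unfold heatLaw; infer_instance

variable {ρ : Measure Ω} [IsProbabilityMeasure ρ] {T : Ω → τ} {Q : Ω → ι → ℝ} {D : Ω → ℝ}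
  (hT : Measurable T) (hQ : Measurable Q) (hD : Measurable D) (e : ι → ℝ) (l : ℝ)

include hT hQ hD

lemma isProbabilityMeasure_heatLaw (r : ℝ) : IsProbabilityMeasure (heatLaw ρ T Q D e l r) :=
  Measure.isProbabilityMeasure_map (by fun_prop)

lemma memLp_heatLaw (hD2 : MemLp D 2 ρ) (r : ℝ) :
    MemLp (fun w : ((ι → ℝ) × τ) × ℝ ↦ w.2) 2 (heatLaw ρ T Q D e l r) := by
  rw [heatLaw, memLp_map_measure_iff (by fun_prop) (by fun_prop)]
  exact (hD2.comp_fst _).add (((memLp_id_gaussNoise r).comp_snd ρ).const_mul l)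

lemma lintegral_noisyLaw_heatLaw (r t : ℝ) {F : ((ι → ℝ) × τ) × ℝ → ℝ≥0∞} (hF : Measurable F) :
    ∫⁻ z, F z ∂noisyLaw (heatLaw ρ T Q D e l r) t = ∫⁻ x, ∫⁻ n, ∫⁻ z,
      F ((Q x + n • e, T x), D x + l * n + z) ∂gaussNoise t ∂gaussNoise r ∂ρ := by
  have := isProbabilityMeasure_heatLaw (ρ := ρ) hT hQ hD e l r
  have h1 : Measurable fun w : ((ι → ℝ) × τ) × ℝ ↦ ∫⁻ z, F (w.1, w.2 + z) ∂gaussNoise t :=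
    Measurable.lintegral_prod_right'
      (f := fun x : (((ι → ℝ) × τ) × ℝ) × ℝ ↦ F (x.1.1, x.1.2 + x.2)) (by fun_prop)
  rw [noisyLaw, lintegral_map hF (by fun_prop), lintegral_prod _ (by fun_prop), heatLaw,
    lintegral_map h1 (by fun_prop), lintegral_prod _ (by
      exact (h1.comp (g := fun w : ((ι → ℝ) × τ) × ℝ ↦ ∫⁻ z, F (w.1, w.2 + z) ∂gaussNoise t)
        (f := fun ω : Ω × ℝ ↦ ((Q ω.1 + ω.2 • e, T ω.1), D ω.1 + l * ω.2))
        (by fun_prop)).aemeasurable)]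

/-- The sample space of one step of the heat flow: `((x, n₁), z₁), (n₂, z₂)`. -/
abbrev stepLaw (ρ : Measure Ω) (r v η : ℝ) : Measure (((Ω × ℝ) × ℝ) × ℝ × ℝ) :=
  ((ρ.prod (gaussNoise r)).prod (gaussNoise (1 + r * v))).prod
    ((gaussNoise η).prod (gaussNoise (η * v)))

lemma map_stepLaw_left (r v η : ℝ) : (stepLaw ρ r v η).map
    (fun ω ↦ ((Q ω.1.1.1 + ω.1.1.2 • e, T ω.1.1.1), D ω.1.1.1 + l * ω.1.1.2 + ω.1.2))
      = noisyLaw (heatLaw ρ T Q D e l r) (1 + r * v) := by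
  refine Measure.ext_of_lintegral _ fun F hF ↦ ?_
  rw [lintegral_noisyLaw_heatLaw hT hQ hD e l _ _ hF, lintegral_map hF (by fun_prop),
    lintegral_prod _ (by fun_prop)]
  simp only [lintegral_const, measure_univ, mul_one]
  rw [lintegral_prod _ (by fun_prop), lintegral_prod _ (by
    exact (Measurable.lintegral_prod_right' (f := fun ω : (Ω × ℝ) × ℝ ↦
      F ((Q ω.1.1 + ω.1.2 • e, T ω.1.1), D ω.1.1 + l * ω.1.2 + ω.2)) (by fun_prop)).aemeasurable)]

/-- Independent increments of variances η and ηv carry the flow from time r to time r + η. Both ends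
of the step thus live on one sample space, where Gibbs' inequality can compare them. -/
lemma map_stepLaw_right {r v η : ℝ} (hr : 0 ≤ r) (hv : 0 ≤ v) (hη : 0 ≤ η) : (stepLaw ρ r v η).map
    (fun ω ↦ ((Q ω.1.1.1 + (ω.1.1.2 + ω.2.1) • e, T ω.1.1.1),
      D ω.1.1.1 + l * (ω.1.1.2 + ω.2.1) + (ω.1.2 + ω.2.2)))
      = noisyLaw (heatLaw ρ T Q D e l (r + η)) (1 + (r + η) * v) := by
  refine Measure.ext_of_lintegral _ fun F hF ↦ ?_
  have e1 : 1 + (r + η) * v = (1 + r * v) + η * v := by ring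
  rw [lintegral_noisyLaw_heatLaw hT hQ hD e l _ _ hF, lintegral_map hF (by fun_prop),
    lintegral_prod _ (by fun_prop), lintegral_prod _ (by
      exact (Measurable.lintegral_prod_right' (f := fun ω : ((Ω × ℝ) × ℝ) × ℝ × ℝ ↦
        F ((Q ω.1.1.1 + (ω.1.1.2 + ω.2.1) • e, T ω.1.1.1),
          D ω.1.1.1 + l * (ω.1.1.2 + ω.2.1) + (ω.1.2 + ω.2.2))) (by fun_prop)).aemeasurable),
    lintegral_prod _ (by
      exact (Measurable.lintegral_prod_right' (f := fun ω' : (Ω × ℝ) × ℝ ↦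
        ∫⁻ p : ℝ × ℝ, F ((Q ω'.1.1 + (ω'.1.2 + p.1) • e, T ω'.1.1),
          D ω'.1.1 + l * (ω'.1.2 + p.1) + (ω'.2 + p.2)) ∂((gaussNoise η).prod (gaussNoise (η * v))))
        (Measurable.lintegral_prod_right' (f := fun ω : ((Ω × ℝ) × ℝ) × ℝ × ℝ ↦
        F ((Q ω.1.1.1 + (ω.1.1.2 + ω.2.1) • e, T ω.1.1.1),
          D ω.1.1.1 + l * (ω.1.1.2 + ω.2.1) + (ω.1.2 + ω.2.2))) (by fun_prop))).aemeasurable)]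
  refine lintegral_congr fun x ↦ ?_
  have hm : Measurable fun n ↦ ∫⁻ z, F ((Q x + n • e, T x), D x + l * n + z)
      ∂gaussNoise (1 + (r + η) * v) :=
    Measurable.lintegral_prod_right'
      (f := fun p : ℝ × ℝ ↦ F ((Q x + p.1 • e, T x), D x + l * p.1 + p.2)) (by fun_prop)
  rw [← lintegral_gaussNoise_add hr hη hm]
  refine lintegral_congr fun n₁ ↦ ?_
  have h2 : ∀ z₁, ∫⁻ p : ℝ × ℝ, F ((Q x + (n₁ + p.1) • e, T x),
      D x + l * (n₁ + p.1) + (z₁ + p.2)) ∂((gaussNoise η).prod (gaussNoise (η * v)))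
      = ∫⁻ n₂, ∫⁻ z₂, F ((Q x + (n₁ + n₂) • e, T x), D x + l * (n₁ + n₂) + (z₁ + z₂))
        ∂gaussNoise (η * v) ∂gaussNoise η := fun z₁ ↦ lintegral_prod _ (by fun_prop)
  simp only [h2]
  rw [lintegral_lintegral_swap (by
    exact (Measurable.lintegral_prod_right' (f := fun p : (ℝ × ℝ) × ℝ ↦
      F ((Q x + (n₁ + p.1.2) • e, T x), D x + l * (n₁ + p.1.2) + (p.1.1 + p.2)))
        (by fun_prop)).aemeasurable)]
  refine lintegral_congr fun n₂ ↦ ?_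
  exact (lintegral_gaussNoise_add (F := fun z ↦ F ((Q x + (n₁ + n₂) • e, T x),
    D x + l * (n₁ + n₂) + z)) (by positivity) (by positivity) (by fun_prop)).trans (by rw [e1])

/-- One step of the heat flow: the increment of the conditional entropy is bounded below by means
of an arbitrary estimator `m` of the innovation. -/
lemma condEnt_step [Fintype ι] (hD2 : MemLp D 2 ρ) {a : ι → ℝ} (hae : a ⬝ᵥ e = l) {r v η κ w : ℝ}
    (hr : 0 ≤ r) (hv : 0 < v) (hη : 0 < η) (hw : 0 < w) {m : τ × ℝ → ℝ} (hm : Measurable m)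
    (hm2 : MemLp (fun ω ↦ (1 - κ) * ω.2.2 - κ * (D ω.1.1.1 - a ⬝ᵥ Q ω.1.1.1 + ω.1.2)
      - m (T ω.1.1.1, D ω.1.1.1 + l * (ω.1.1.2 + ω.2.1) + (ω.1.2 + ω.2.2))) 2 (stepLaw ρ r v η)) :
    condEnt (heatLaw ρ T Q D e l r) (1 + r * v) + 1 / 2 * Real.log (2 * Real.pi * (η * v)) + 1 / 2
      ≤ condEnt (heatLaw ρ T Q D e l (r + η)) (1 + (r + η) * v)
        + 1 / 2 * Real.log (2 * Real.pi * w)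
        + (∫ ω, ((1 - κ) * ω.2.2 - κ * (D ω.1.1.1 - a ⬝ᵥ Q ω.1.1.1 + ω.1.2)
      - m (T ω.1.1.1, D ω.1.1.1 + l * (ω.1.1.2 + ω.2.1) + (ω.1.2 + ω.2.2))) ^ 2
          ∂(stepLaw ρ r v η)) / (2 * w) := by
  have := isProbabilityMeasure_heatLaw (ρ := ρ) hT hQ hD e l r
  have := isProbabilityMeasure_heatLaw (ρ := ρ) hT hQ hD e l (r + η)
  set P := stepLaw ρ r v η with hP
  set θ := heatLaw ρ T Q D e l r with hθ
  set θ' := heatLaw ρ T Q D e l (r + η) with hθ'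
  have hs : 0 < 1 + r * v := by positivity
  have hs' : 0 < 1 + (r + η) * v := by positivity
  have hηv : 0 < η * v := by positivity
  have mθ := measurable_mixDensity (s := 1 + r * v) θ
  have mθ' := measurable_mixDensity (s := 1 + (r + η) * v) θ'
  have hL := map_stepLaw_left (ρ := ρ) hT hQ hD e l r v η
  have hR := map_stepLaw_right (ρ := ρ) hT hQ hD e l hr hv.le hη.le
  set Z : ((Ω × ℝ) × ℝ) × ℝ × ℝ → ((ι → ℝ) × τ) × ℝ :=
    fun ω ↦ ((Q ω.1.1.1 + ω.1.1.2 • e, T ω.1.1.1), D ω.1.1.1 + l * ω.1.1.2 + ω.1.2) with hZ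
  set Z' : ((Ω × ℝ) × ℝ) × ℝ × ℝ → ((ι → ℝ) × τ) × ℝ :=
    fun ω ↦ ((Q ω.1.1.1 + (ω.1.1.2 + ω.2.1) • e, T ω.1.1.1),
      D ω.1.1.1 + l * (ω.1.1.2 + ω.2.1) + (ω.1.2 + ω.2.2)) with hZ'
  -- Let V', Y' be the shifted inputs and the output after the step. Since `a ⬝ᵥ e = l`, Y' - a ⬝ᵥ
  -- V' = D - a ⬝ᵥ Q + z₁ + z₂, so `E` is the error of estimating z₂ by κ (Y' - a ⬝ᵥ V') + m (T,
  -- Y').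
  set E : ((Ω × ℝ) × ℝ) × ℝ × ℝ → ℝ :=
    fun ω ↦ (1 - κ) * ω.2.2 - κ * (D ω.1.1.1 - a ⬝ᵥ Q ω.1.1.1 + ω.1.2)
      - m (T ω.1.1.1, D ω.1.1.1 + l * (ω.1.1.2 + ω.2.1) + (ω.1.2 + ω.2.2)) with hE
  have mZ : Measurable Z := by fun_prop
  have mZ' : Measurable Z' := by fun_prop
  have i1 : Integrable (fun ω ↦ Real.log (mixDensity θ (1 + r * v) (Z ω))) P := by
    have := integrable_log_mixDensity (t := 1 + r * v) hs (memLp_heatLaw (ρ := ρ) hT hQ hD e l hD2 r)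
    rwa [← hL, integrable_map_measure mθ.log.aestronglyMeasurable mZ.aemeasurable] at this
  have i2 : Integrable (fun ω ↦ Real.log (mixDensity θ' (1 + (r + η) * v) (Z' ω))) P := by
    have := integrable_log_mixDensity (t := 1 + (r + η) * v) hs'
      (memLp_heatLaw (ρ := ρ) hT hQ hD e l hD2 (r + η))
    rwa [← hR, integrable_map_measure mθ'.log.aestronglyMeasurable mZ'.aemeasurable] at this
  have i3 : Integrable (fun ω ↦ Real.log (gaussDensity (η * v) ω.2.2)) P :=
    ((integrable_log_gaussDensity hηv).comp_snd _).comp_snd _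
  have i4 : Integrable (fun ω ↦ Real.log (gaussDensity w (E ω))) P := by
    simp_rw [log_gaussDensity hw]
    exact (integrable_const _).sub (hm2.integrable_sq.div_const _)
  have v1 : ∫ ω, Real.log (mixDensity θ (1 + r * v) (Z ω)) ∂P = -condEnt θ (1 + r * v) := by
    rw [condEnt, neg_neg, ← hL, integral_map mZ.aemeasurable mθ.log.aestronglyMeasurable]
  have v2 : ∫ ω, Real.log (mixDensity θ' (1 + (r + η) * v) (Z' ω)) ∂P
      = -condEnt θ' (1 + (r + η) * v) := by
    rw [condEnt, neg_neg, ← hR, integral_map mZ'.aemeasurable mθ'.log.aestronglyMeasurable]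
  have v3 : ∫ ω, Real.log (gaussDensity (η * v) ω.2.2) ∂P
      = -(1 / 2 * Real.log (2 * Real.pi * (η * v))) - 1 / 2 := by
    rw [hP, integral_fun_snd (fun p : ℝ × ℝ ↦ Real.log (gaussDensity (η * v) p.2)),
      integral_fun_snd (fun z : ℝ ↦ Real.log (gaussDensity (η * v) z)),
      integral_log_gaussDensity hηv]
    simp
  have v4 : ∫ ω, Real.log (gaussDensity w (E ω)) ∂P
      = -(1 / 2 * Real.log (2 * Real.pi * w)) - (∫ ω, E ω ^ 2 ∂P) / (2 * w) := by
    simp_rw [log_gaussDensity hw]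
    rw [integral_sub (integrable_const _) (hm2.integrable_sq.div_const _), integral_div]
    simp
  -- The chain rule as one Gibbs inequality: the true density of (Y, z₂) given (V, T, n₂) is
  -- compared with the trial density p(Y' | V', T) times the normal density of variance `w` at `E`.
  have key := integral_nonpos_of_lintegral_exp_le_one ((i2.add i4).sub (i1.add i3)) ?_
  · simp only [Pi.sub_apply, Pi.add_apply] at key
    rw [integral_sub (by exact i2.add i4) (by exact i1.add i3), integral_add i2 i4,
      integral_add i1 i3, v1, v2, v3, v4] at key
    linarith
  set q : ((ι → ℝ) × τ) × ℝ → ℝ → ℝ → ℝ := fun z n₂ z₂ ↦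
    mixDensity θ' (1 + (r + η) * v) ((z.1.1 + n₂ • e, z.1.2), z.2 + l * n₂ + z₂)
      * gaussDensity w ((1 - κ) * z₂ - κ * (z.2 - a ⬝ᵥ z.1.1) - m (z.1.2, z.2 + l * n₂ + z₂))
    with hq
  have hq0 : ∀ z n₂ z₂, 0 < q z n₂ z₂ := fun z n₂ z₂ ↦
    mul_pos (mixDensity_pos θ' hs' _) (gaussDensity_pos hw _)
  have mdot : Measurable fun x : ι → ℝ ↦ a ⬝ᵥ x := by unfold dotProduct; fun_prop
  have mq : Measurable fun x : ((((ι → ℝ) × τ) × ℝ) × ℝ) × ℝ ↦ q x.1.1 x.1.2 x.2 := by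
    rw [hq]; fun_prop
  set Φ : (((ι → ℝ) × τ) × ℝ) × ℝ × ℝ → ℝ≥0∞ := fun x ↦
    ENNReal.ofReal (q x.1 x.2.1 x.2.2 / (mixDensity θ (1 + r * v) x.1 * gaussDensity (η * v) x.2.2))
    with hΦ
  have mq' : Measurable fun x : (((ι → ℝ) × τ) × ℝ) × ℝ × ℝ ↦ q x.1 x.2.1 x.2.2 :=
    mq.comp (f := fun x : (((ι → ℝ) × τ) × ℝ) × ℝ × ℝ ↦ ((x.1, x.2.1), x.2.2)) (by fun_prop)
  have mΦ : Measurable Φ := by rw [hΦ]; fun_prop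
  have step1 : ∀ ω, ENNReal.ofReal (Real.exp ((((fun ω ↦ Real.log (mixDensity θ' (1 + (r + η) * v)
      (Z' ω))) + fun ω ↦ Real.log (gaussDensity w (E ω))) - ((fun ω ↦ Real.log (mixDensity θ
        (1 + r * v) (Z ω))) + fun ω : ((Ω × ℝ) × ℝ) × ℝ × ℝ ↦
          Real.log (gaussDensity (η * v) ω.2.2))) ω)) = Φ (Z ω, ω.2) := fun ω ↦ by
    simp only [Pi.sub_apply, Pi.add_apply]
    rw [Real.exp_sub, Real.exp_add, Real.exp_add, Real.exp_log (mixDensity_pos θ' hs' _),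
      Real.exp_log (mixDensity_pos θ hs _), Real.exp_log (gaussDensity_pos hw _),
      Real.exp_log (gaussDensity_pos hηv _), hΦ]
    congr 2
    rw [hq, hE, hZ, hZ']
    simp only [dotProduct_add, dotProduct_smul, hae, smul_eq_mul]
    have e1 : Q ω.1.1.1 + (ω.1.1.2 + ω.2.1) • e = Q ω.1.1.1 + ω.1.1.2 • e + ω.2.1 • e := by
      rw [add_smul, add_assoc]
    have e2 : D ω.1.1.1 + l * (ω.1.1.2 + ω.2.1) + (ω.1.2 + ω.2.2)
        = D ω.1.1.1 + l * ω.1.1.2 + ω.1.2 + l * ω.2.1 + ω.2.2 := by ring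
    rw [e1, e2]
    congr 2
    ring
  simp_rw [step1]
  have step2 : ∫⁻ ω, Φ (Z ω, ω.2) ∂P
      = ∫⁻ z, ∫⁻ p, Φ (z, p) ∂((gaussNoise η).prod (gaussNoise (η * v)))
        ∂noisyLaw θ (1 + r * v) := by
    have mi : Measurable fun z ↦ ∫⁻ p, Φ (z, p) ∂((gaussNoise η).prod (gaussNoise (η * v))) :=
      Measurable.lintegral_prod_right' mΦ
    rw [← hL, lintegral_map mi mZ]
    have e1 : ∫⁻ ω, Φ (Z ω, ω.2) ∂P = _ := lintegral_prod _ (by fun_prop)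
    have e2 : ∫⁻ ω, (∫⁻ p, Φ (Z ω, p) ∂((gaussNoise η).prod (gaussNoise (η * v)))) ∂P = _ :=
      lintegral_prod _ (by exact (mi.comp mZ).aemeasurable)
    rw [e1, e2]
    refine lintegral_congr fun x ↦ ?_
    have e3 : ∀ y, ∫⁻ p, Φ (Z (x, y), p) ∂((gaussNoise η).prod (gaussNoise (η * v)))
      = ∫⁻ p, Φ (Z (x, p), p) ∂((gaussNoise η).prod (gaussNoise (η * v))) := fun y ↦ rfl
    simp only [e3, lintegral_const, measure_univ, mul_one]
  rw [step2, lintegral_noisyLaw θ hs (Measurable.lintegral_prod_right' mΦ)]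
  -- The trial density has mass one: in the coordinates y' = y + l n₂ + z₂ and z₂, which have
  -- Jacobian one, `E` is z₂ minus a function of y', so z₂ integrates out first and y' next.
  have inner : ∀ (u : (ι → ℝ) × τ) (n₂ : ℝ), ∫⁻ y, ∫⁻ z₂, ENNReal.ofReal (q (u, y) n₂ z₂) = 1 := by
    intro u n₂
    have mqu : Measurable fun x : ℝ × ℝ ↦ q (u, x.1) n₂ x.2 :=
      mq.comp (f := fun x : ℝ × ℝ ↦ (((u, x.1), n₂), x.2)) (by fun_prop)
    rw [lintegral_lintegral_swap (by exact mqu.ennreal_ofReal.aemeasurable)]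
    have e1 : ∀ z₂, ∫⁻ y, ENNReal.ofReal (q (u, y) n₂ z₂)
        = ∫⁻ y, ENNReal.ofReal (mixDensity θ' (1 + (r + η) * v) ((u.1 + n₂ • e, u.2), y))
          * ENNReal.ofReal (gaussDensity w
            (z₂ - (κ * (y - l * n₂ - a ⬝ᵥ u.1) + m (u.2, y)))) := fun z₂ ↦ by
      rw [← lintegral_sub_right_eq_self _ (l * n₂ + z₂)]
      refine lintegral_congr fun y ↦ ?_
      rw [← ENNReal.ofReal_mul (mixDensity_pos θ' hs' _).le]
      simp only [hq]
      have : y - (l * n₂ + z₂) + l * n₂ + z₂ = y := by ring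
      rw [this]
      congr 3
      ring
    simp_rw [e1]
    rw [lintegral_lintegral_swap (by fun_prop)]
    rw [← lintegral_mixDensity θ' hs' (u.1 + n₂ • e, u.2)]
    refine lintegral_congr fun y ↦ ?_
    rw [lintegral_const_mul _ (by fun_prop), lintegral_gaussDensity hw, mul_one]
  have step3 : ∀ u : (ι → ℝ) × τ, ∫⁻ y, ENNReal.ofReal (mixDensity θ (1 + r * v) (u, y))
      * ∫⁻ p, Φ ((u, y), p) ∂((gaussNoise η).prod (gaussNoise (η * v))) = 1 := fun u ↦ by
    have mqu : Measurable fun x : (ℝ × ℝ) × ℝ ↦ q (u, x.1.1) x.1.2 x.2 :=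
      mq.comp (f := fun x : (ℝ × ℝ) × ℝ ↦ (((u, x.1.1), x.1.2), x.2)) (by fun_prop)
    have e1 : ∀ y, ENNReal.ofReal (mixDensity θ (1 + r * v) (u, y))
        * ∫⁻ p, Φ ((u, y), p) ∂((gaussNoise η).prod (gaussNoise (η * v)))
          = ∫⁻ n₂, ∫⁻ z₂, ENNReal.ofReal (q (u, y) n₂ z₂) ∂volume ∂gaussNoise η := fun y ↦ by
      rw [← lintegral_const_mul _ (by fun_prop), lintegral_prod _ (by fun_prop)]
      refine lintegral_congr fun n₂ ↦ ?_
      rw [lintegral_gaussNoise hηv (by fun_prop)]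
      refine lintegral_congr fun z₂ ↦ ?_
      rw [hΦ]
      have p1 := mixDensity_pos θ hs (u, y)
      have p2 := gaussDensity_pos hηv z₂
      rw [← ENNReal.ofReal_mul p1.le, ← ENNReal.ofReal_mul p2.le]
      congr 1
      simp only
      generalize mixDensity θ (1 + r * v) (u, y) = A at p1
      generalize gaussDensity (η * v) z₂ = B at p2
      field_simp
    simp_rw [e1]
    rw [lintegral_lintegral_swap (by
      exact (Measurable.lintegral_prod_right' (f := fun x : (ℝ × ℝ) × ℝ ↦
        ENNReal.ofReal (q (u, x.1.1) x.1.2 x.2)) mqu.ennreal_ofReal).aemeasurable)]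
    simp_rw [inner]
    simp
  simp_rw [step3]
  have : IsProbabilityMeasure θ.fst := inferInstance
  simp

end HeatFlow

/-! ### Least squares estimators and Gaussian residuals -/

section Posterior

/-- Least squares estimation of a square integrable variable `X` from an observation `V`. -/
lemma exists_orthogonal_estimator {Ω β : Type*} [mΩ : MeasurableSpace Ω] [mβ : MeasurableSpace β]
    {P : Measure Ω} [IsProbabilityMeasure P] {V : Ω → β} (hV : Measurable V) {X : Ω → ℝ}
    (hX : MemLp X 2 P) : ∃ f : β → ℝ, Measurable f ∧ MemLp (fun ω ↦ f (V ω)) 2 P ∧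
      ∀ ψ : β → ℝ, Measurable ψ → MemLp (fun ω ↦ ψ (V ω)) 2 P →
        ∫ ω, (X ω - f (V ω)) * ψ (V ω) ∂P = 0 := by
  have hm : mβ.comap V ≤ mΩ := hV.comap_le
  obtain ⟨f, hf, hfe⟩ := (stronglyMeasurable_condExp (m := mβ.comap V) (μ := P)
    (f := X)).exists_eq_measurable_comp
  have hf2 : MemLp (fun ω ↦ f (V ω)) 2 P := by
    have := hX.condExp (m := mβ.comap V) one_le_two
    rwa [hfe] at this
  refine ⟨f, hf.measurable, hf2, fun ψ hψ hψ2 ↦ ?_⟩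
  have hi : Integrable (fun ω ↦ X ω * ψ (V ω)) P := hX.integrable_mul hψ2
  have hi' : Integrable (fun ω ↦ f (V ω) * ψ (V ω)) P := hf2.integrable_mul hψ2
  simp_rw [sub_mul]
  rw [integral_sub hi hi', sub_eq_zero, ← integral_condExp hm]
  refine integral_congr_ae ?_
  have := condExp_mul_of_stronglyMeasurable_right (m := mβ.comap V) (μ := P) (f := X)
    (g := fun ω ↦ ψ (V ω)) ((hψ.comp (comap_measurable V)).stronglyMeasurable) hi
    (hX.integrable one_le_two)
  rw [hfe] at this
  exact this

/-- Pythagoras: the error X - f(V) is orthogonal to f(V) - ψ(V). -/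
lemma integral_sq_sub_le_of_orthogonal {Ω β : Type*} [MeasurableSpace Ω] [MeasurableSpace β]
    {P : Measure Ω} {V : Ω → β} {X : Ω → ℝ} (hX : MemLp X 2 P) {f : β → ℝ}
    (hf : Measurable f) (hf2 : MemLp (fun ω ↦ f (V ω)) 2 P)
    (horth : ∀ ψ : β → ℝ, Measurable ψ → MemLp (fun ω ↦ ψ (V ω)) 2 P →
        ∫ ω, (X ω - f (V ω)) * ψ (V ω) ∂P = 0)
    {ψ : β → ℝ} (hψ : Measurable ψ) (hψ2 : MemLp (fun ω ↦ ψ (V ω)) 2 P) :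
    ∫ ω, (X ω - f (V ω)) ^ 2 ∂P ≤ ∫ ω, (X ω - ψ (V ω)) ^ 2 ∂P := by
  have h0 := horth (fun b ↦ f b - ψ b) (hf.sub hψ) (hf2.sub hψ2)
  have i1 : Integrable (fun ω ↦ (X ω - f (V ω)) ^ 2) P := (hX.sub hf2).integrable_sq
  have i2 : Integrable (fun ω ↦ (f (V ω) - ψ (V ω)) ^ 2) P := (hf2.sub hψ2).integrable_sq
  have i3 : Integrable (fun ω ↦ (X ω - f (V ω)) * (f (V ω) - ψ (V ω))) P :=
    (hX.sub hf2).integrable_mul (hf2.sub hψ2)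
  have e : ∀ ω, (X ω - ψ (V ω)) ^ 2 = (X ω - f (V ω)) ^ 2 + (f (V ω) - ψ (V ω)) ^ 2
      + 2 * ((X ω - f (V ω)) * (f (V ω) - ψ (V ω))) := fun ω ↦ by ring
  simp_rw [e]
  rw [integral_add (by exact i1.add i2) (i3.const_mul 2), integral_add i1 i2, integral_const_mul,
    h0]
  have : 0 ≤ ∫ ω, (f (V ω) - ψ (V ω)) ^ 2 ∂P := integral_nonneg fun ω ↦ sq_nonneg _
  linarith

/-- Uncorrelated centred jointly Gaussian variables are independent. -/
lemma map_prodMk_eq_prod_gaussNoise {E : Type*} [NormedAddCommGroup E] [NormedSpace ℝ E]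
    [MeasurableSpace E] [BorelSpace E] [SecondCountableTopology E] [CompleteSpace E]
    {P : Measure E} [IsGaussian P] {A B : E →L[ℝ] ℝ} {s q : ℝ} (hA : ∫ x, A x ∂P = 0)
    (hB : ∫ x, B x ∂P = 0) (hAB : ∫ x, A x * B x ∂P = 0) (hA2 : ∫ x, A x ^ 2 ∂P = s)
    (hB2 : ∫ x, B x ^ 2 ∂P = q) :
    P.map (fun x ↦ (A x, B x)) = (gaussNoise s).prod (gaussNoise q) := by
  have h : HasGaussianLaw (fun x ↦ (A x, B x)) P :=
    (IsGaussian.hasGaussianLaw_id (μ := P)).map_fun (A.prod B)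
  have hAm : MemLp A 2 P := h.fst.memLp_two
  have hBm : MemLp B 2 P := h.snd.memLp_two
  have hi : IndepFun A B P := by
    refine h.indepFun_of_covariance_eq_zero ?_
    rw [covariance_eq_sub hAm hBm, hA, hB]
    simpa using hAB
  rw [(indepFun_iff_map_prod_eq_prod_map_map (by fun_prop) (by fun_prop)).1 hi,
    h.fst.map_eq_gaussianReal, h.snd.map_eq_gaussianReal, hA, hB,
    variance_eq_integral (by fun_prop), variance_eq_integral (by fun_prop), hA, hB]
  simp only [sub_zero, hA2, hB2]

lemma integral_mul_gaussNoise_prod {Ω : Type*} [MeasurableSpace Ω] {P : Measure Ω}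
    [IsProbabilityMeasure P] {f f' : Ω → ℝ} (hf : MemLp f 2 P) (hf' : MemLp f' 2 P) {r : ℝ}
    (hr : 0 ≤ r) (a a' : ℝ) :
    ∫ p : ℝ × Ω, (a * p.1 + f p.2) * (a' * p.1 + f' p.2) ∂((gaussNoise r).prod P)
      = a * a' * r + ∫ ω, f ω * f' ω ∂P := by
  have h1 : MemLp (fun p : ℝ × Ω ↦ p.1) 2 ((gaussNoise r).prod P) :=
    (memLp_id_gaussNoise r).comp_fst _
  have h2 : MemLp (fun p : ℝ × Ω ↦ f p.2) 2 ((gaussNoise r).prod P) := hf.comp_snd _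
  have h3 : MemLp (fun p : ℝ × Ω ↦ f' p.2) 2 ((gaussNoise r).prod P) := hf'.comp_snd _
  have e : ∀ p : ℝ × Ω, (a * p.1 + f p.2) * (a' * p.1 + f' p.2) = a * a' * p.1 ^ 2
      + (a * (p.1 * f' p.2) + (a' * (p.1 * f p.2) + f p.2 * f' p.2)) := fun p ↦ by ring
  have i1 := (h1.integrable_sq).const_mul (a * a')
  have i2 : Integrable (fun p : ℝ × Ω ↦ a * (p.1 * f' p.2)) ((gaussNoise r).prod P) :=
    (h1.integrable_mul h3).const_mul a
  have i3 : Integrable (fun p : ℝ × Ω ↦ a' * (p.1 * f p.2)) ((gaussNoise r).prod P) :=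
    (h1.integrable_mul h2).const_mul a'
  have i4 : Integrable (fun p : ℝ × Ω ↦ f p.2 * f' p.2) ((gaussNoise r).prod P) :=
    h2.integrable_mul h3
  simp_rw [e]
  rw [integral_add i1 (by exact i2.add (i3.add i4)), integral_add i2 (by exact i3.add i4),
    integral_add i3 i4, integral_const_mul, integral_const_mul, integral_const_mul,
    integral_prod_mul (fun x : ℝ ↦ x) f', integral_prod_mul (fun x : ℝ ↦ x) f,
    integral_fun_fst (fun x : ℝ ↦ x ^ 2), integral_fun_snd (fun x ↦ f x * f' x),
    integral_sq_gaussNoise hr, integral_id_gaussNoise]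
  simp

lemma integral_gaussNoise_prod {Ω : Type*} [MeasurableSpace Ω] {P : Measure Ω}
    [IsProbabilityMeasure P] {f : Ω → ℝ} (hf : Integrable f P) {r a : ℝ} :
    ∫ p : ℝ × Ω, (a * p.1 + f p.2) ∂((gaussNoise r).prod P) = ∫ ω, f ω ∂P := by
  rw [integral_add ((((memLp_id_gaussNoise r).integrable one_le_two).const_mul a).comp_fst _)
    (hf.comp_snd _), integral_fun_fst (fun x : ℝ ↦ a * x), integral_fun_snd f, integral_const_mul,
    integral_id_gaussNoise]
  simp

/-- The linear form on `ℝ⁴` with given coefficients. -/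
def noiseForm (a b c d : ℝ) : ℝ × ℝ × ℝ × ℝ →L[ℝ] ℝ :=
  (a • ContinuousLinearMap.id ℝ ℝ).coprod ((b • ContinuousLinearMap.id ℝ ℝ).coprod
    ((c • ContinuousLinearMap.id ℝ ℝ).coprod (d • ContinuousLinearMap.id ℝ ℝ)))

lemma noiseForm_apply (a b c d : ℝ) (p : ℝ × ℝ × ℝ × ℝ) :
    noiseForm a b c d p = a * p.1 + (b * p.2.1 + (c * p.2.2.1 + d * p.2.2.2)) := by
  simp [noiseForm]

/-- The product of four centred normal laws. -/
abbrev fourNoise (r b h k : ℝ) : Measure (ℝ × ℝ × ℝ × ℝ) :=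
  (gaussNoise r).prod ((gaussNoise b).prod ((gaussNoise h).prod (gaussNoise k)))

lemma integral_noiseForm_mul {r b h k : ℝ} (hr : 0 ≤ r) (hb : 0 ≤ b) (hh : 0 ≤ h) (hk : 0 ≤ k)
    (a₁ a₂ a₃ a₄ b₁ b₂ b₃ b₄ : ℝ) :
    ∫ p, noiseForm a₁ a₂ a₃ a₄ p * noiseForm b₁ b₂ b₃ b₄ p ∂fourNoise r b h k
      = a₁ * b₁ * r + (a₂ * b₂ * b + (a₃ * b₃ * h + a₄ * b₄ * k)) := by
  simp_rw [noiseForm_apply]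
  have m4 : ∀ a : ℝ, MemLp (fun z : ℝ ↦ a * z) 2 (gaussNoise k) :=
    fun a ↦ (memLp_id_gaussNoise k).const_mul a
  have m3 : ∀ c a : ℝ, MemLp (fun p : ℝ × ℝ ↦ c * p.1 + a * p.2) 2
      ((gaussNoise h).prod (gaussNoise k)) := fun c a ↦
    (((memLp_id_gaussNoise h).const_mul c).comp_fst _).add ((m4 a).comp_snd _)
  have m2 : ∀ e c a : ℝ, MemLp (fun p : ℝ × ℝ × ℝ ↦ e * p.1 + (c * p.2.1 + a * p.2.2)) 2
      ((gaussNoise b).prod ((gaussNoise h).prod (gaussNoise k))) := fun e c a ↦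
    (((memLp_id_gaussNoise b).const_mul e).comp_fst _).add ((m3 c a).comp_snd _)
  rw [integral_mul_gaussNoise_prod (m2 a₂ a₃ a₄) (m2 b₂ b₃ b₄) hr,
    integral_mul_gaussNoise_prod (m3 a₃ a₄) (m3 b₃ b₄) hb,
    integral_mul_gaussNoise_prod (m4 a₄) (m4 b₄) hh]
  have e : ∀ z : ℝ, a₄ * z * (b₄ * z) = a₄ * b₄ * z ^ 2 := fun z ↦ by ring
  simp_rw [e]
  rw [integral_const_mul, integral_sq_gaussNoise hk]

lemma integral_noiseForm (r b h k a₁ a₂ a₃ a₄ : ℝ) :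
    ∫ p, noiseForm a₁ a₂ a₃ a₄ p ∂fourNoise r b h k = 0 := by
  simp_rw [noiseForm_apply]
  have m4 : Integrable (fun z : ℝ ↦ a₄ * z) (gaussNoise k) :=
    ((memLp_id_gaussNoise k).integrable one_le_two).const_mul a₄
  have m3 : Integrable (fun p : ℝ × ℝ ↦ a₃ * p.1 + a₄ * p.2)
      ((gaussNoise h).prod (gaussNoise k)) :=
    ((((memLp_id_gaussNoise h).integrable one_le_two).const_mul a₃).comp_fst _).add (m4.comp_snd _)
  have m2 : Integrable (fun p : ℝ × ℝ × ℝ ↦ a₂ * p.1 + (a₃ * p.2.1 + a₄ * p.2.2))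
      ((gaussNoise b).prod ((gaussNoise h).prod (gaussNoise k))) :=
    ((((memLp_id_gaussNoise b).integrable one_le_two).const_mul a₂).comp_fst _).add (m3.comp_snd _)
  rw [integral_gaussNoise_prod m2, integral_gaussNoise_prod m3, integral_gaussNoise_prod m4,
    integral_const_mul, integral_id_gaussNoise, mul_zero]

/-- In one step of the heat flow the residual of the innovation after regression on the output
noise is independent of the input and of the output noise. -/
lemma map_stepLaw_residual {Ω : Type*} [MeasurableSpace Ω] (ρ : Measure Ω)
    [IsProbabilityMeasure ρ] {r v η κ l s t : ℝ} (hr : 0 ≤ r) (hv : 0 ≤ v) (hη : 0 ≤ η)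
    (hs : s = 1 + (r + η) * (v + l ^ 2)) (hκ : κ * (1 + r + η) = η) (ht : t * s = κ * (v - 1)) :
    (stepLaw ρ r v η).map (fun ω ↦ ((ω.1.1.1, l * (ω.1.1.2 + ω.2.1) + (ω.1.2 + ω.2.2)),
        (1 - κ) * ω.2.2 - κ * ω.1.2 - t * (l * (ω.1.1.2 + ω.2.1) + (ω.1.2 + ω.2.2))))
      = (ρ.prod (gaussNoise s)).prod
        (gaussNoise ((1 - κ) ^ 2 * (η * v) + κ ^ 2 * (1 + r * v) - t ^ 2 * s)) := by
  set q := (1 - κ) ^ 2 * (η * v) + κ ^ 2 * (1 + r * v) - t ^ 2 * s with hq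
  have hb : 0 ≤ 1 + r * v := by positivity
  have hk : 0 ≤ η * v := by positivity
  have hpair : (fourNoise r (1 + r * v) η (η * v)).map (fun p ↦ (noiseForm l 1 l 1 p,
      noiseForm (-(t * l)) (-κ - t) (-(t * l)) (1 - κ - t) p))
      = (gaussNoise s).prod (gaussNoise q) := by
    -- The left side is the covariance of (1 - κ) z₂ - κ z₁ with the output noise, whose variance is
    -- `s`. So `t` is the regression coefficient, the residual is uncorrelated with the output
    -- noise, and joint Gaussianity makes it independent.
    have hc : (1 - κ) * (η * v) - κ * (1 + r * v) = κ * (v - 1) := by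
      linear_combination (-v) * hκ
    refine map_prodMk_eq_prod_gaussNoise (integral_noiseForm ..) (integral_noiseForm ..) ?_ ?_ ?_
    · rw [integral_noiseForm_mul hr hb hη hk]
      linear_combination t * hs - ht + hc
    · simp_rw [sq]
      rw [integral_noiseForm_mul hr hb hη hk, hs]
      ring
    · simp_rw [sq]
      rw [integral_noiseForm_mul hr hb hη hk, hq]
      linear_combination -t ^ 2 * hs - 2 * t * hc + 2 * t * ht
  have h1 := (measurePreserving_prodAssoc ρ (gaussNoise r) ((gaussNoise (1 + r * v)).prod
    ((gaussNoise η).prod (gaussNoise (η * v))))).comp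
      (measurePreserving_prodAssoc (ρ.prod (gaussNoise r)) (gaussNoise (1 + r * v))
        ((gaussNoise η).prod (gaussNoise (η * v))))
  have h2 : MeasurePreserving (fun p ↦ (noiseForm l 1 l 1 p,
      noiseForm (-(t * l)) (-κ - t) (-(t * l)) (1 - κ - t) p))
      (fourNoise r (1 + r * v) η (η * v)) ((gaussNoise s).prod (gaussNoise q)) :=
    ⟨by fun_prop, hpair⟩
  have h3 := (measurePreserving_prodAssoc ρ (gaussNoise s) (gaussNoise q)).symm
  have h4 := h3.comp (((MeasurePreserving.id ρ).prod h2).comp h1)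
  rw [← h4.map_eq]
  congr 1
  ext ω
  · rfl
  · simp [MeasurableEquiv.prodAssoc, noiseForm_apply]; ring
  · simp [MeasurableEquiv.prodAssoc, noiseForm_apply]; ring

end Posterior

/-! ### One step of the heat flow -/

section Step

variable {Ω τ ι : Type*} [MeasurableSpace Ω] [MeasurableSpace τ] [Fintype ι]

@[fun_prop]
lemma measurable_dotProduct_left (b : ι → ℝ) : Measurable fun x : ι → ℝ ↦ b ⬝ᵥ x := by
  unfold dotProduct; fun_prop

lemma memLp_dotProduct {P : Measure Ω} {X : Ω → ι → ℝ} (hX : ∀ i, MemLp (fun ω ↦ X ω i) 2 P)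
    (b : ι → ℝ) : MemLp (fun ω ↦ b ⬝ᵥ X ω) 2 P := by
  unfold dotProduct
  exact memLp_finsetSum _ fun i _ ↦ (hX i).const_mul (b i)

lemma integral_dotProduct_mul {P : Measure Ω} {X : Ω → ι → ℝ}
    (hX : ∀ i, MemLp (fun ω ↦ X ω i) 2 P) (b c : ι → ℝ) :
    ∫ ω, (b ⬝ᵥ X ω) * (c ⬝ᵥ X ω) ∂P
      = b ⬝ᵥ (Matrix.of fun i j ↦ ∫ ω, X ω i * X ω j ∂P).mulVec c := by
  simp only [dotProduct, Matrix.mulVec, Matrix.of_apply, Finset.sum_mul_sum]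
  simp only [Finset.mul_sum]
  have hi : ∀ i j, Integrable (fun ω ↦ b i * X ω i * (c j * X ω j)) P := fun i j ↦
    ((hX i).const_mul (b i)).integrable_mul ((hX j).const_mul (c j))
  rw [integral_finsetSum _ fun i _ ↦ integrable_finsetSum _ fun j _ ↦ hi i j]
  refine Finset.sum_congr rfl fun i _ ↦ ?_
  rw [integral_finsetSum _ fun j _ ↦ hi i j]
  refine Finset.sum_congr rfl fun j _ ↦ ?_
  rw [mul_comm (∫ ω, X ω i * X ω j ∂P), ← mul_assoc, ← integral_const_mul]
  congr 1 with ω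
  ring

/-- The observation `(T, g ⬝ X + n)`. -/
def observe (T : Ω → τ) (X : Ω → ι → ℝ) (g : ι → ℝ) (p : Ω × ℝ) : τ × ℝ :=
  (T p.1, g ⬝ᵥ X p.1 + p.2)

variable {ρ : Measure Ω} [IsProbabilityMeasure ρ] {T : Ω → τ} {X : Ω → ι → ℝ}
  (hT : Measurable T) (hX : Measurable X) (hX2 : ∀ i, MemLp (fun ω ↦ X ω i) 2 ρ)

include hT hX in
lemma measurable_observe (g : ι → ℝ) : Measurable (observe T X g) := by
  unfold observe; fun_prop

include hT hX hX2 in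
-- `f` is the coordinatewise conditional mean. By linearity one `f` is optimal in every direction
-- `b`, which lets all blocks S share a single error matrix.
lemma exists_estimator (g : ι → ℝ) (s : ℝ) : ∃ f : τ × ℝ → ι → ℝ, Measurable f ∧
    (∀ i, MemLp (fun p ↦ X p.1 i - f (observe T X g p) i) 2 (ρ.prod (gaussNoise s))) ∧
    ∀ (b : ι → ℝ) (ψ : τ × ℝ → ℝ), Measurable ψ →
      MemLp (fun p ↦ ψ (observe T X g p)) 2 (ρ.prod (gaussNoise s)) →
      ∫ p, (b ⬝ᵥ (X p.1 - f (observe T X g p))) ^ 2 ∂(ρ.prod (gaussNoise s))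
        ≤ ∫ p, (b ⬝ᵥ X p.1 - ψ (observe T X g p)) ^ 2 ∂(ρ.prod (gaussNoise s)) := by
  have hV := measurable_observe hT hX g
  have hXP : ∀ i, MemLp (fun p : Ω × ℝ ↦ X p.1 i) 2 (ρ.prod (gaussNoise s)) :=
    fun i ↦ (hX2 i).comp_fst _
  choose f hf hf2 horth using fun i ↦ exists_orthogonal_estimator hV (hXP i)
  have hfm : Measurable fun y i ↦ f i y := measurable_pi_lambda _ hf
  refine ⟨fun y i ↦ f i y, hfm, fun i ↦ (hXP i).sub (hf2 i), fun b ψ hψ hψ2 ↦ ?_⟩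
  have key := integral_sq_sub_le_of_orthogonal (V := observe T X g) (f := fun y ↦ b ⬝ᵥ fun i ↦ f i y)
    (memLp_dotProduct hXP b) (by fun_prop) (memLp_dotProduct hf2 b) (fun ψ hψ hψ2 ↦ ?_) hψ hψ2
  · refine le_of_eq_of_le ?_ key
    congr 1 with p
    rw [dotProduct_sub]
  · have e : ∀ p, (b ⬝ᵥ X p.1 - b ⬝ᵥ fun i ↦ f i (observe T X g p)) * ψ (observe T X g p)
        = ∑ i, b i * ((X p.1 i - f i (observe T X g p)) * ψ (observe T X g p)) := fun p ↦ by
      rw [← dotProduct_sub, dotProduct, Finset.sum_mul]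
      exact Finset.sum_congr rfl fun i _ ↦ by simp; ring
    simp_rw [e]
    have hi : ∀ i, Integrable (fun p ↦ b i * ((X p.1 i - f i (observe T X g p))
        * ψ (observe T X g p))) (ρ.prod (gaussNoise s)) := fun i ↦
      (((hXP i).sub (hf2 i)).integrable_mul hψ2).const_mul (b i)
    rw [integral_finsetSum _ fun i _ ↦ hi i]
    simp_rw [integral_const_mul]
    simp [horth _ ψ hψ hψ2]

include hT hX hX2 in
/-- The mean square error of the best estimator of the signal is bounded by the Fisher
information of the output. -/
lemma integral_sq_le_fisherInfo {g : ι → ℝ} {s : ℝ} (hs : 0 < s) {E : ℝ}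
    (hE : ∀ ψ : τ × ℝ → ℝ, Measurable ψ →
      MemLp (fun p ↦ ψ (observe T X g p)) 2 (ρ.prod (gaussNoise s)) →
      E ≤ ∫ p, (g ⬝ᵥ X p.1 - ψ (observe T X g p)) ^ 2 ∂(ρ.prod (gaussNoise s)))
    [IsProbabilityMeasure (ρ.map fun ω ↦ (T ω, g ⬝ᵥ X ω))] :
    E ≤ s - s ^ 2 * fisherInfo (ρ.map fun ω ↦ (T ω, g ⬝ᵥ X ω)) s := by
  set θ := ρ.map fun ω ↦ (T ω, g ⬝ᵥ X ω) with hθ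
  have hmap : (ρ.prod (gaussNoise s)).map (fun p ↦ ((T p.1, g ⬝ᵥ X p.1), p.2))
      = θ.prod (gaussNoise s) := by
    have := Measure.map_prod_map (f := fun ω ↦ (T ω, g ⬝ᵥ X ω)) (g := id) ρ (gaussNoise s)
      (by fun_prop) measurable_id
    rw [Measure.map_id] at this
    rw [hθ, this]
    rfl
  have mN := measurable_noiseMean (θ := θ) (s := s)
  have hV : MemLp (fun p ↦ (observe T X g p).2) 2 (ρ.prod (gaussNoise s)) :=
    ((memLp_dotProduct hX2 g).comp_fst _).add ((memLp_id_gaussNoise s).comp_snd _)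
  have hN : MemLp (fun p ↦ noiseMean θ s (observe T X g p)) 2 (ρ.prod (gaussNoise s)) := by
    have := memLp_noiseMean (θ := θ) hs
    rw [noisyLaw, ← hmap, Measure.map_map (by fun_prop) (by fun_prop),
      memLp_map_measure_iff mN.aestronglyMeasurable (by fun_prop)] at this
    exact this
  -- Output minus estimated noise estimates the signal, and its error is minus the error made on the
  -- noise.
  refine (hE (fun y ↦ y.2 - noiseMean θ s y) (by fun_prop) (hV.sub hN)).trans_eq ?_
  rw [← integral_sq_sub_noiseMean hs, ← hmap, integral_map (by fun_prop) (by fun_prop)]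
  congr 1 with p
  simp only [observe]
  ring

include hT hX hX2 in
-- `condEnt_step` with `m` built from an estimator `f` of X. In the error, the noise (1 - k) z₂ - k
-- z₁ is t N plus an independent Gaussian, N being the output noise. As N = Y' - g ⬝ᵥ X, the rest is
-- a function of Y' minus a linear form in X; `m` cancels the former and replaces X by X - f in the
-- latter.
lemma condEnt_heatLaw_step {κ : Type*} [Fintype κ] {Q : Ω → κ → ℝ} (hQ : Measurable Q)
    {g w : ι → ℝ} {a e : κ → ℝ} {l : ℝ} (hae : a ⬝ᵥ e = l)
    (hw : ∀ ω, w ⬝ᵥ X ω = g ⬝ᵥ X ω - a ⬝ᵥ Q ω) {r v η k s u : ℝ}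
    (hr : 0 ≤ r) (hv : 0 < v) (hη : 0 < η) (hs : s = 1 + (r + η) * (v + l ^ 2))
    (hk : k * (1 + r + η) = η) (hu : 0 < u) {f : τ × ℝ → ι → ℝ} (hf : Measurable f)
    (hf2 : ∀ i, MemLp (fun p ↦ X p.1 i - f (observe T X g p) i) 2 (ρ.prod (gaussNoise s))) :
    condEnt (heatLaw ρ T Q (fun ω ↦ g ⬝ᵥ X ω) e l r) (1 + r * v)
        + 1 / 2 * Real.log (2 * Real.pi * (η * v)) + 1 / 2
      ≤ condEnt (heatLaw ρ T Q (fun ω ↦ g ⬝ᵥ X ω) e l (r + η)) (1 + (r + η) * v)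
        + 1 / 2 * Real.log (2 * Real.pi * u)
        + (k ^ 2 * ∫ p, (w ⬝ᵥ (X p.1 - f (observe T X g p))
            + (v - 1) / s * (g ⬝ᵥ (X p.1 - f (observe T X g p)))) ^ 2 ∂(ρ.prod (gaussNoise s))
          + ((1 - k) ^ 2 * (η * v) + k ^ 2 * (1 + r * v) - k ^ 2 * (v - 1) ^ 2 / s)) / (2 * u) := by
  have hs0 : 0 < s := by rw [hs]; positivity
  set t := k * (v - 1) / s with ht
  have hts : t * s = k * (v - 1) := by rw [ht]; field_simp
  have hq : (1 - k) ^ 2 * (η * v) + k ^ 2 * (1 + r * v) - k ^ 2 * (v - 1) ^ 2 / s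
      = (1 - k) ^ 2 * (η * v) + k ^ 2 * (1 + r * v) - t ^ 2 * s := by rw [ht]; field_simp
  clear_value t
  have hmap := map_stepLaw_residual ρ hr hv.le hη.le hs hk hts
  rw [hq]
  set q := (1 - k) ^ 2 * (η * v) + k ^ 2 * (1 + r * v) - t ^ 2 * s with hqd
  have hq0 : 0 ≤ q := by
    have h1 : q = (1 - k - t) ^ 2 * (η * v) + (k + t) ^ 2 * (1 + r * v)
        + t ^ 2 * l ^ 2 * (r + η) := by
      rw [hqd]
      linear_combination t ^ 2 * hs - 2 * t * hts - 2 * t * v * hk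
    rw [h1]; positivity
  set φ : Ω × ℝ → ℝ := fun p ↦ w ⬝ᵥ (X p.1 - f (observe T X g p))
    + (v - 1) / s * (g ⬝ᵥ (X p.1 - f (observe T X g p))) with hφ
  have hφ2 : MemLp φ 2 (ρ.prod (gaussNoise s)) :=
    (memLp_dotProduct (X := fun p ↦ X p.1 - f (observe T X g p)) hf2 w).add
      ((memLp_dotProduct (X := fun p ↦ X p.1 - f (observe T X g p)) hf2 g).const_mul _)
  have hV := measurable_observe hT hX g
  have mφ : Measurable φ := by rw [hφ]; fun_prop
  have hF2 : MemLp (fun x : (Ω × ℝ) × ℝ ↦ -(k * φ x.1) + x.2) 2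
      ((ρ.prod (gaussNoise s)).prod (gaussNoise q)) :=
    ((hφ2.const_mul k).neg.comp_fst _).add ((memLp_id_gaussNoise q).comp_snd _)
  have hint := integral_add_gaussNoise_sq (hφ2.const_mul k).neg hq0
  set m : τ × ℝ → ℝ := fun y ↦ k * (-(w ⬝ᵥ f y) + (v - 1) / s * (y.2 - g ⬝ᵥ f y)) with hm
  have hE : ∀ ω : ((Ω × ℝ) × ℝ) × ℝ × ℝ,
      (1 - k) * ω.2.2 - k * (g ⬝ᵥ X ω.1.1.1 - a ⬝ᵥ Q ω.1.1.1 + ω.1.2)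
      - m (T ω.1.1.1, g ⬝ᵥ X ω.1.1.1 + l * (ω.1.1.2 + ω.2.1) + (ω.1.2 + ω.2.2))
      = -(k * φ (ω.1.1.1, l * (ω.1.1.2 + ω.2.1) + (ω.1.2 + ω.2.2)))
        + ((1 - k) * ω.2.2 - k * ω.1.2 - t * (l * (ω.1.1.2 + ω.2.1) + (ω.1.2 + ω.2.2))) := by
    intro ω
    simp only [hm, hφ, observe, ← hw, dotProduct_sub, ← add_assoc, ht]
    ring
  have key := condEnt_step hT hQ (D := fun ω ↦ g ⬝ᵥ X ω) (by fun_prop) e l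
    (memLp_dotProduct hX2 g) hae hr hv hη hu (κ := k) (m := m) (by rw [hm]; fun_prop) ?_
  · refine key.trans_eq ?_
    congr 2
    simp_rw [hE]
    have h5 : ∫ x, (-(k * φ x.1) + x.2) ^ 2 ∂((ρ.prod (gaussNoise s)).prod (gaussNoise q)) = _ :=
      hint
    rw [← hmap, integral_map (by fun_prop) (by fun_prop)] at h5
    simp only at h5
    rw [h5, ← integral_const_mul]
    congr 2 with p
    simp only [Pi.neg_apply]
    ring
  · simp_rw [hE]
    rw [← hmap, memLp_map_measure_iff (by fun_prop) (by fun_prop)] at hF2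
    exact hF2

end Step

/-! ### Comparison of increments -/

/-- No derivative of `F` is needed, only lower bounds for its finite increments. These are η h(r +
η) up to the factor (1 + r + η)/(1 + r), which tends to one; by the mean value theorem and uniform
continuity of `h` they dominate the increments of `H` up to ε η. The steps are summed over a uniform
grid. -/
lemma sub_le_sub_of_step {F H h : ℝ → ℝ} {b : ℝ} (hb : 0 ≤ b)
    (hH : ∀ r ∈ Set.Icc 0 b, HasDerivAt H (h r) r) (hc : ContinuousOn h (Set.Icc 0 b))
    (hF : ∀ r η, 0 ≤ r → 0 < η → r + η ≤ b →
      η / (1 + r) * ((1 + r + η) * h (r + η)) ≤ F (r + η) - F r) :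
    H b - H 0 ≤ F b - F 0 := by
  obtain rfl | hb' := hb.eq_or_lt
  · simp
  obtain ⟨C, hC⟩ := isCompact_Icc.exists_bound_of_continuousOn hc
  have hC0 : 0 ≤ C := (norm_nonneg _).trans (hC 0 ⟨le_rfl, hb⟩)
  have huc := isCompact_Icc.uniformContinuousOn_of_continuous hc
  have key : ∀ ε > 0, H b - H 0 ≤ F b - F 0 + ε * b := by
    intro ε hε
    rw [Metric.uniformContinuousOn_iff] at huc
    obtain ⟨δ, hδ, hδ'⟩ := huc (ε / 2) (by positivity)
    have hstep : ∀ r η, 0 ≤ r → 0 < η → r + η ≤ b → η < δ → η * (C + 1) ≤ ε / 2 →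
        H (r + η) - H r ≤ F (r + η) - F r + ε * η := by
      intro r η hr hη hrb hηδ hηC
      have hsub : Set.Icc r (r + η) ⊆ Set.Icc 0 b := Set.Icc_subset_Icc hr hrb
      obtain ⟨ξ, hξ, hξ'⟩ := exists_hasDerivAt_eq_slope H h (lt_add_of_pos_right r hη)
        (fun x hx ↦ (hH x (hsub hx)).continuousAt.continuousWithinAt)
        (fun x hx ↦ hH x (hsub (Set.Ioo_subset_Icc_self hx)))
      rw [add_sub_cancel_left, eq_div_iff hη.ne'] at hξ'
      have hm : r + η ∈ Set.Icc 0 b := ⟨by positivity, hrb⟩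
      have h1 := hδ' ξ (hsub (Set.Ioo_subset_Icc_self hξ)) (r + η) hm (by
        rw [Real.dist_eq, abs_lt]; constructor <;> linarith [hξ.1, hξ.2])
      rw [Real.dist_eq] at h1
      have h2 := hC _ hm
      rw [Real.norm_eq_abs] at h2
      have h3 : η / (1 + r) * ((1 + r + η) * h (r + η))
          = η * (h (r + η) + η * h (r + η) / (1 + r)) := by field_simp
      have h4 : |η * h (r + η) / (1 + r)| ≤ ε / 2 := by
        rw [abs_div, abs_mul, abs_of_pos hη, abs_of_pos (by linarith : 0 < 1 + r)]
        refine (div_le_self (by positivity) (by linarith)).trans (le_trans ?_ hηC)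
        exact mul_le_mul_of_nonneg_left (by linarith) hη.le
      have h5 := hF r η hr hη hrb
      rw [h3] at h5
      have h6 : h ξ - ε ≤ h (r + η) + η * h (r + η) / (1 + r) := by
        linarith [(abs_lt.1 h1).2, (abs_le.1 h4).1]
      nlinarith [mul_le_mul_of_nonneg_left h6 hη.le]
    obtain ⟨n, hn⟩ := exists_nat_gt (max (b / δ) (b * (C + 1) / (ε / 2)))
    have hn1 := (le_max_left _ _).trans_lt hn
    have hn2 := (le_max_right _ _).trans_lt hn
    have hn0 : (0 : ℝ) < n := lt_of_le_of_lt (by positivity) hn1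
    set η := b / n with hη
    have hη0 : 0 < η := by positivity
    have hnη : n * η = b := by rw [hη]; field_simp
    have hc1 : η < δ := by
      rw [hη, div_lt_iff₀ hn0]; rw [div_lt_iff₀ hδ] at hn1; linarith
    have hc2 : η * (C + 1) ≤ ε / 2 := by
      rw [div_lt_iff₀ (by positivity)] at hn2
      rw [hη, div_mul_eq_mul_div, div_le_iff₀ hn0]; linarith
    have hind : ∀ k : ℕ, k ≤ n → H (k * η) - H 0 ≤ F (k * η) - F 0 + ε * (k * η) := by
      intro k
      induction k with
      | zero => intro _; simp
      | succ k ih =>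
        intro hk
        have hk' : ((k : ℝ) + 1) ≤ n := by exact_mod_cast hk
        have := hstep (k * η) η (by positivity) hη0
          (by rw [← hnη]; nlinarith) hc1 hc2
        have ih := ih (by omega)
        have e : ((k + 1 : ℕ) : ℝ) * η = k * η + η := by push_cast; ring
        rw [e]; linarith
    have := hind n le_rfl
    rwa [hnη] at this
  by_contra! hcon
  have h1 := key ((H b - H 0 - (F b - F 0)) / (2 * b)) (div_pos (by linarith) (by positivity))
  have h2 : (H b - H 0 - (F b - F 0)) / (2 * b) * b = (H b - H 0 - (F b - F 0)) / 2 := by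
    field_simp
  linarith

/-! ### The error covariance -/

section Covariance

variable {ι : Type*} [Fintype ι]

lemma posSemidef_iff_real {C : Matrix ι ι ℝ} :
    C.PosSemidef ↔ (∀ i j, C i j = C j i) ∧ ∀ b : ι → ℝ, 0 ≤ b ⬝ᵥ C.mulVec b := by
  rw [Matrix.posSemidef_iff_dotProduct_mulVec, Matrix.IsHermitian.ext_iff]
  simp only [star_trivial]
  exact and_congr_left fun _ ↦ forall_comm

lemma dotProduct_mulVec_comm {C : Matrix ι ι ℝ} (hC : ∀ i j, C i j = C j i) (b c : ι → ℝ) :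
    b ⬝ᵥ C.mulVec c = c ⬝ᵥ C.mulVec b := by
  have : C.transpose = C := by ext i j; exact (hC i j).symm
  rw [Matrix.dotProduct_mulVec, ← Matrix.mulVec_transpose, this, dotProduct_comm]

lemma sq_dotProduct_mulVec_le {C : Matrix ι ι ℝ} (hC : C.PosSemidef) (b c : ι → ℝ) :
    (b ⬝ᵥ C.mulVec c) ^ 2 ≤ (b ⬝ᵥ C.mulVec b) * (c ⬝ᵥ C.mulVec c) := by
  rw [posSemidef_iff_real] at hC
  have h : ∀ t : ℝ, 0 ≤ (c ⬝ᵥ C.mulVec c) * (t * t) + (2 * (b ⬝ᵥ C.mulVec c)) * t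
      + b ⬝ᵥ C.mulVec b := fun t ↦ by
    have h1 := hC.2 (b + t • c)
    simp only [Matrix.mulVec_add, Matrix.mulVec_smul, dotProduct_add, add_dotProduct,
      smul_dotProduct, dotProduct_smul, smul_eq_mul, dotProduct_mulVec_comm hC.1 c b] at h1
    linarith
  have := discrim_le_zero h
  rw [discrim] at this
  linarith

variable {Ω τ : Type*} [MeasurableSpace Ω] [MeasurableSpace τ]
  {ρ : Measure Ω} [IsProbabilityMeasure ρ] {T : Ω → τ} {X : Ω → ι → ℝ}

/-- Imagine independent centred Gaussians G₁, G₂ of covariances rK₀ and ηK₀, and the output Y' = g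
⬝ᵥ (X + G₁ + G₂) plus noise of variance 1 + r + η, so that the total noise has variance `s`. Then
k(1 + r) C is the error covariance of (1 - k) G₂ - k (X + G₁) when X is estimated by `f` and the
Gaussian part through its regression on the output noise. That part has covariance (k(1 + r) - k²)
K₀, and its covariance with the output noise is k K₀g. -/
lemma exists_error_cov (hX2 : ∀ i, MemLp (fun ω ↦ X ω i) 2 ρ) {K K₀ : Matrix ι ι ℝ}
    (hK : ∀ i j, ∫ ω, X ω i * X ω j ∂ρ = K i j) (hK₀ : K₀.PosSemidef) (hKK : (K - K₀).PosSemidef)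
    {g : ι → ℝ} {r η k s : ℝ} (hr : 0 ≤ r) (hη : 0 < η)
    (hs : s = 1 + (r + η) * (1 + g ⬝ᵥ K₀.mulVec g)) (hk : k * (1 + r + η) = η)
    {f : τ × ℝ → ι → ℝ}
    (hf2 : ∀ i, MemLp (fun p ↦ X p.1 i - f (observe T X g p) i) 2 (ρ.prod (gaussNoise s)))
    (hmin : ∀ (b : ι → ℝ) (ψ : τ × ℝ → ℝ), Measurable ψ →
      MemLp (fun p ↦ ψ (observe T X g p)) 2 (ρ.prod (gaussNoise s)) →
      ∫ p, (b ⬝ᵥ (X p.1 - f (observe T X g p))) ^ 2 ∂(ρ.prod (gaussNoise s))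
        ≤ ∫ p, (b ⬝ᵥ X p.1 - ψ (observe T X g p)) ^ 2 ∂(ρ.prod (gaussNoise s))) :
    ∃ C : Matrix ι ι ℝ, C.PosSemidef ∧ (K - C).PosSemidef ∧ ∀ b : ι → ℝ,
      k * (1 + r) * (b ⬝ᵥ C.mulVec b) = k ^ 2 * (∫ p, (b ⬝ᵥ (X p.1 - f (observe T X g p))
          + (b ⬝ᵥ K₀.mulVec g) / s * (g ⬝ᵥ (X p.1 - f (observe T X g p)))) ^ 2
            ∂(ρ.prod (gaussNoise s)))
        + (k * (1 + r) - k ^ 2) * (b ⬝ᵥ K₀.mulVec b)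
        - k ^ 2 * (b ⬝ᵥ K₀.mulVec g) ^ 2 / s := by
  have hK₀' := posSemidef_iff_real.1 hK₀
  have hKK' := posSemidef_iff_real.1 hKK
  have hγ := hK₀'.2 g
  have hs0 : 0 < s := by rw [hs]; positivity
  have hk0 : 0 < k := by
    by_contra! h
    nlinarith [mul_nonpos_of_nonpos_of_nonneg h (by positivity : 0 ≤ (1 + r + η))]
  set P := ρ.prod (gaussNoise s)
  set ξ : Ω × ℝ → ι → ℝ := fun p ↦ X p.1 - f (observe T X g p) with hξ
  set z : ι → ℝ := K₀.mulVec g with hz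
  set ζ : Ω × ℝ → ι → ℝ := fun p ↦ ξ p + (s⁻¹ * (g ⬝ᵥ ξ p)) • z with hζ
  have hζ2 : ∀ i, MemLp (fun p ↦ ζ p i) 2 P := fun i ↦ by
    have := (hf2 i).add (((memLp_dotProduct (X := ξ) hf2 g).const_mul s⁻¹).mul_const (z i))
    exact this
  have hbζ : ∀ b p, b ⬝ᵥ ζ p = b ⬝ᵥ ξ p + (b ⬝ᵥ z) / s * (g ⬝ᵥ ξ p) := fun b p ↦ by
    rw [hζ]; simp only [dotProduct_add, dotProduct_smul, smul_eq_mul]; ring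
  set Z : Matrix ι ι ℝ := Matrix.of fun i j ↦ ∫ p, ζ p i * ζ p j ∂P with hZ
  have hZb : ∀ b, b ⬝ᵥ Z.mulVec b
      = ∫ p, (b ⬝ᵥ ξ p + (b ⬝ᵥ z) / s * (g ⬝ᵥ ξ p)) ^ 2 ∂P := fun b ↦ by
    rw [hZ, ← integral_dotProduct_mul hζ2]
    congr 1 with p
    rw [← hbζ, sq]
  set C : Matrix ι ι ℝ := (k * (1 + r))⁻¹ • (k ^ 2 • Z + (k * (1 + r) - k ^ 2) • K₀
    - (k ^ 2 / s) • Matrix.vecMulVec z z) with hC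
  have hu : 0 < k * (1 + r) := by positivity
  have hCb : ∀ b, k * (1 + r) * (b ⬝ᵥ C.mulVec b)
      = k ^ 2 * (∫ p, (b ⬝ᵥ ξ p + (b ⬝ᵥ z) / s * (g ⬝ᵥ ξ p)) ^ 2 ∂P)
        + (k * (1 + r) - k ^ 2) * (b ⬝ᵥ K₀.mulVec b) - k ^ 2 * (b ⬝ᵥ z) ^ 2 / s := fun b ↦ by
    rw [← hZb, hC]
    simp only [Matrix.smul_mulVec, Matrix.sub_mulVec, Matrix.add_mulVec, dotProduct_smul,
      dotProduct_sub, dotProduct_add, smul_eq_mul, Matrix.vecMulVec_mulVec]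
    rw [mul_inv_cancel_left₀ hu.ne']
    simp [dotProduct_comm z b]
    ring
  have hCsym : ∀ i j, C i j = C j i := fun i j ↦ by
    simp only [hC, Matrix.smul_apply, Matrix.sub_apply, Matrix.add_apply, smul_eq_mul, hZ,
      Matrix.of_apply, Matrix.vecMulVec_apply, hK₀'.1 i j, mul_comm (z i)]
    simp_rw [mul_comm (ζ _ i)]
  have hKsym : ∀ i j, K i j = K j i := fun i j ↦ by
    have := hKK'.1 i j
    simp only [Matrix.sub_apply, hK₀'.1 i j] at this
    linarith
  have hKb : ∀ b, ∫ ω, (b ⬝ᵥ X ω) ^ 2 ∂ρ = b ⬝ᵥ K.mulVec b := fun b ↦ by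
    have := integral_dotProduct_mul hX2 b b
    simp_rw [← sq] at this
    rw [this]
    congr 2
    ext i j
    exact hK i j
  refine ⟨C, posSemidef_iff_real.2 ⟨hCsym, fun b ↦ ?_⟩, posSemidef_iff_real.2 ⟨fun i j ↦ ?_,
    fun b ↦ ?_⟩, hCb⟩
  · have h1 : 0 ≤ ∫ p, (b ⬝ᵥ ξ p + (b ⬝ᵥ z) / s * (g ⬝ᵥ ξ p)) ^ 2 ∂P :=
      integral_nonneg fun p ↦ sq_nonneg _
    have h2 := sq_dotProduct_mulVec_le hK₀ b g
    rw [← hz] at h2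
    have h3 : k ^ 2 * (b ⬝ᵥ z) ^ 2 / s ≤ (k * (1 + r) - k ^ 2) * (b ⬝ᵥ K₀.mulVec b) := by
      rw [div_le_iff₀ hs0]
      -- This is what remains after Cauchy-Schwarz for K₀ has bounded (b ⬝ᵥ z)².
      have h4 : k * (g ⬝ᵥ z) ≤ ((1 + r) - k) * s := by
        have hk1 : k ≤ 1 := by nlinarith
        have h5 : k * (1 + r) ≤ (1 + r - k) * (r + η) := by nlinarith
        rw [hs]
        nlinarith [mul_nonneg hr hη.le]
      have h5 := mul_le_mul_of_nonneg_left h4 (mul_nonneg hk0.le (hK₀'.2 b))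
      have h6 := mul_le_mul_of_nonneg_left h2 (sq_nonneg k)
      nlinarith
    have h4 := hCb b
    have h5 : 0 ≤ k * (1 + r) * (b ⬝ᵥ C.mulVec b) := by
      rw [h4]
      have := mul_nonneg (sq_nonneg k) h1
      linarith
    exact nonneg_of_mul_nonneg_right h5 hu
  · simp only [Matrix.sub_apply]; rw [hKsym i j, hCsym i j]
  · have hV : MemLp (fun p : Ω × ℝ ↦ (b ⬝ᵥ z) / s * (observe T X g p).2) 2 P :=
      (((memLp_dotProduct hX2 g).comp_fst _).add ((memLp_id_gaussNoise s).comp_snd _)).const_mul _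
    -- Competing with this multiple of the output leaves the error b ⬝ᵥ X minus (b ⬝ᵥ z)/s times the
    -- noise. Its second moment is bᵀKb + (b ⬝ᵥ z)²/s, whose last term cancels the negative term in
    -- the form of C.
    have h1 := hmin (b + ((b ⬝ᵥ z) / s) • g) (fun y ↦ (b ⬝ᵥ z) / s * y.2) (by fun_prop) hV
    have e1 : ∀ p, (b + ((b ⬝ᵥ z) / s) • g) ⬝ᵥ ξ p
        = b ⬝ᵥ ξ p + (b ⬝ᵥ z) / s * (g ⬝ᵥ ξ p) := fun p ↦ by
      simp [add_dotProduct]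
    have e2 : ∀ p : Ω × ℝ, ((b + ((b ⬝ᵥ z) / s) • g) ⬝ᵥ X p.1
        - (b ⬝ᵥ z) / s * (observe T X g p).2) ^ 2
        = (1 * (b ⬝ᵥ X p.1) + -((b ⬝ᵥ z) / s) * p.2) ^ 2 := fun p ↦ by
      simp only [observe, add_dotProduct, smul_dotProduct, smul_eq_mul]; ring
    have e3 : ∫ p : Ω × ℝ, (1 * (b ⬝ᵥ X p.1) + -((b ⬝ᵥ z) / s) * p.2) ^ 2 ∂P
        = b ⬝ᵥ K.mulVec b + (b ⬝ᵥ z) ^ 2 / s := by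
      have := integral_mul_gaussNoise_prod (memLp_dotProduct hX2 b) (memLp_dotProduct hX2 b)
        hs0.le (-((b ⬝ᵥ z) / s)) (-((b ⬝ᵥ z) / s))
      simp_rw [← sq] at this
      rw [hKb] at this
      have h0 := integral_prod_swap (μ := ρ) (ν := gaussNoise s)
        fun p : Ω × ℝ ↦ (1 * (b ⬝ᵥ X p.1) + -((b ⬝ᵥ z) / s) * p.2) ^ 2
      simp only [Prod.fst_swap, Prod.snd_swap] at h0
      simp_rw [one_mul, add_comm (b ⬝ᵥ X _)] at h0 ⊢
      rw [← h0, this]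
      field_simp
      ring
    replace h1 : ∫ p, (b ⬝ᵥ ξ p + (b ⬝ᵥ z) / s * (g ⬝ᵥ ξ p)) ^ 2 ∂P
        ≤ b ⬝ᵥ K.mulVec b + (b ⬝ᵥ z) ^ 2 / s := by
      rw [← e3]
      simp_rw [← e1, ← e2]
      exact h1
    have h2 := hCb b
    have h3 := hKK'.2 b
    rw [Matrix.sub_mulVec, dotProduct_sub] at h3 ⊢
    have hk1 : 0 ≤ k * (1 + r) - k ^ 2 := by
      have : k ≤ 1 := by nlinarith
      nlinarith
    have h4 : k * (1 + r) * (b ⬝ᵥ C.mulVec b) ≤ k * (1 + r) * (b ⬝ᵥ K.mulVec b) := by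
      rw [h2]
      have h5 := mul_le_mul_of_nonneg_left h1 (sq_nonneg k)
      have h6 := mul_nonneg hk1 h3
      have h7 : k ^ 2 * (b ⬝ᵥ K.mulVec b + (b ⬝ᵥ z) ^ 2 / s)
        = k ^ 2 * (b ⬝ᵥ K.mulVec b) + k ^ 2 * (b ⬝ᵥ z) ^ 2 / s := by ring
      linarith
    have := le_of_mul_le_mul_left h4 hu
    linarith

end Covariance

/-! ### The entropy inequality at a stationary point -/

section Stationary

variable {ι : Type*} [Fintype ι]

/-- The regularised variance of the output after subtraction of the linear estimator `a`. -/
def residVar (K : Matrix ι ι ℝ) (g : ι → ℝ) (δ : ℝ) (a : ι → ℝ) : ℝ :=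
  1 + (g - a) ⬝ᵥ K.mulVec (g - a) + δ * (a ⬝ᵥ a)

/-- First order conditions at a minimiser `K₀` of the regularised Gaussian problem; `a S` is the
regularised linear estimator of the output from the inputs in `S`. -/
structure IsStationary (K K₀ : Matrix ι ι ℝ) (g : ι → ℝ) (parts : Finset (Finset ι))
    (c d δ : ℝ) (a : Finset ι → ι → ℝ) : Prop where
  posSemidef : K₀.PosSemidef
  le : (K - K₀).PosSemidef
  supp : ∀ S ∈ parts, ∀ i ∉ S, a S i = 0
  normal : ∀ S ∈ parts, ∀ i ∈ S, K₀.mulVec (g - a S) i = δ * a S i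
  kkt : ∀ C : Matrix ι ι ℝ, C.PosSemidef → (K - C).PosSemidef →
    c * ((g ⬝ᵥ K₀.mulVec g) / (1 + g ⬝ᵥ K₀.mulVec g))
        - d * ∑ S ∈ parts, ((g - a S) ⬝ᵥ K₀.mulVec (g - a S)) / residVar K₀ g δ (a S)
      ≤ c * ((g ⬝ᵥ C.mulVec g) / (1 + g ⬝ᵥ K₀.mulVec g))
        - d * ∑ S ∈ parts, ((g - a S) ⬝ᵥ C.mulVec (g - a S)) / residVar K₀ g δ (a S)

namespace IsStationary

variable {K K₀ : Matrix ι ι ℝ} {g : ι → ℝ} {parts : Finset (Finset ι)} {c d δ : ℝ}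
  {a : Finset ι → ι → ℝ} (h : IsStationary K K₀ g parts c d δ a) {S : Finset ι}

include h

lemma dotProduct_resid (hS : S ∈ parts) : a S ⬝ᵥ K₀.mulVec (g - a S) = δ * (a S ⬝ᵥ a S) := by
  simp only [dotProduct, Finset.mul_sum]
  refine Finset.sum_congr rfl fun i _ ↦ ?_
  by_cases hi : i ∈ S
  · rw [h.normal S hS i hi]; ring
  · rw [h.supp S hS i hi]; ring

/-- The normal equations make the residual K₀-orthogonal to the estimator up to the ridge term. This
value matches the coefficient (v - 1)/s of `condEnt_heatLaw_step` with the coefficient (b ⬝ᵥ K₀g)/s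
of `exists_error_cov` at b = g - a S. -/
lemma resid_dotProduct (hS : S ∈ parts) :
    (g - a S) ⬝ᵥ K₀.mulVec g = residVar K₀ g δ (a S) - 1 := by
  have h1 := (posSemidef_iff_real.1 h.posSemidef).1
  have h2 := h.dotProduct_resid hS
  rw [dotProduct_mulVec_comm h1] at h2
  have h3 : (g - a S) ⬝ᵥ K₀.mulVec g
      = (g - a S) ⬝ᵥ K₀.mulVec (g - a S) + (g - a S) ⬝ᵥ K₀.mulVec (a S) := by
    rw [← dotProduct_add, ← Matrix.mulVec_add, sub_add_cancel]
  rw [h3, h2, residVar]; ring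

/-- The explained variance is nonnegative, so that it is the square of the amplitude l used in
`partLaw`. -/
lemma sub_residVar (hS : S ∈ parts) : 1 + g ⬝ᵥ K₀.mulVec g - residVar K₀ g δ (a S)
    = δ * (a S ⬝ᵥ a S) + a S ⬝ᵥ K₀.mulVec (a S) := by
  have h1 := h.resid_dotProduct hS
  have h2 := h.dotProduct_resid hS
  rw [sub_dotProduct] at h1
  rw [Matrix.mulVec_sub, dotProduct_sub] at h2
  linarith

lemma residVar_le (hδ : 0 ≤ δ) (hS : S ∈ parts) :
    residVar K₀ g δ (a S) ≤ 1 + g ⬝ᵥ K₀.mulVec g := by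
  have h1 := h.sub_residVar hS
  have h2 := (posSemidef_iff_real.1 h.posSemidef).2 (a S)
  have h3 : 0 ≤ a S ⬝ᵥ a S := dotProduct_self_star_nonneg (a S)
  have := mul_nonneg hδ h3
  linarith

lemma one_le_residVar (hδ : 0 ≤ δ) : 1 ≤ residVar K₀ g δ (a S) := by
  have h2 := (posSemidef_iff_real.1 h.posSemidef).2 (g - a S)
  have h3 : 0 ≤ a S ⬝ᵥ a S := dotProduct_self_star_nonneg (a S)
  have := mul_nonneg hδ h3
  rw [residVar]; linarith

end IsStationary

lemma sum_subtype_of_supp {S : Finset ι} {a : ι → ℝ} (ha : ∀ i ∉ S, a i = 0) (x : ι → ℝ) :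
    (fun j : S ↦ a j) ⬝ᵥ (fun j : S ↦ x j) = a ⬝ᵥ x := by
  simp only [dotProduct]
  rw [Finset.sum_coe_sort S (fun j ↦ a j * x j)]
  exact Finset.sum_subset (Finset.subset_univ S) fun i _ hi ↦ by rw [ha i hi, zero_mul]

variable {Ω τ : Type*} [MeasurableSpace Ω] [MeasurableSpace τ]

/-- The heat flow attached to the part `S` and the linear estimator `a`. -/
def partLaw (ρ : Measure Ω) (T : Ω → τ) (X : Ω → ι → ℝ) (K₀ : Matrix ι ι ℝ) (g : ι → ℝ) (δ : ℝ)
    (S : Finset ι) (a : ι → ℝ) (r : ℝ) : Measure (((S → ℝ) × τ) × ℝ) :=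
  heatLaw ρ T (fun ω (j : S) ↦ X ω j) (fun ω ↦ g ⬝ᵥ X ω)
    (fun j : S ↦ √(1 + g ⬝ᵥ K₀.mulVec g - residVar K₀ g δ a) / (a ⬝ᵥ a) * a j)
    √(1 + g ⬝ᵥ K₀.mulVec g - residVar K₀ g δ a) r

instance (ρ : Measure Ω) [IsFiniteMeasure ρ] (T : Ω → τ) (X : Ω → ι → ℝ) (K₀ : Matrix ι ι ℝ)
    (g : ι → ℝ) (δ : ℝ) (S : Finset ι) (a : ι → ℝ) (r : ℝ) :
    IsFiniteMeasure (partLaw ρ T X K₀ g δ S a r) := by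
  unfold partLaw; infer_instance

variable {ρ : Measure Ω} [IsProbabilityMeasure ρ] {T : Ω → τ} {X : Ω → ι → ℝ}
  (hT : Measurable T) (hX : Measurable X) (hX2 : ∀ i, MemLp (fun ω ↦ X ω i) 2 ρ)

/-- The normalisation makes `a S` read the injected noise with amplitude exactly l. If a S = 0, the
division by zero is harmless because then l = 0. -/
lemma partLaw_dir {K K₀ : Matrix ι ι ℝ} {g : ι → ℝ} {parts : Finset (Finset ι)} {c d δ : ℝ}
    {a : Finset ι → ι → ℝ} (h : IsStationary K K₀ g parts c d δ a) {S : Finset ι} (hS : S ∈ parts) :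
    (fun j : S ↦ a S j) ⬝ᵥ (fun j : S ↦
      √(1 + g ⬝ᵥ K₀.mulVec g - residVar K₀ g δ (a S)) / (a S ⬝ᵥ a S) * a S j)
      = √(1 + g ⬝ᵥ K₀.mulVec g - residVar K₀ g δ (a S)) := by
  have e := sum_subtype_of_supp (h.supp S hS) (fun j ↦
    √(1 + g ⬝ᵥ K₀.mulVec g - residVar K₀ g δ (a S)) / (a S ⬝ᵥ a S) * a S j)
  rw [e]
  change a S ⬝ᵥ ((√(1 + g ⬝ᵥ K₀.mulVec g - residVar K₀ g δ (a S)) / (a S ⬝ᵥ a S)) • a S) = _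
  rw [dotProduct_smul, smul_eq_mul]
  by_cases h0 : a S ⬝ᵥ a S = 0
  · have h1 : a S = 0 := dotProduct_self_eq_zero.1 h0
    rw [h.sub_residVar hS, h1]
    simp
  · field_simp

include hT hX hX2

/-- The trial variance is k(1 + r)v, to which the error bound `hE` reduces when C and K₀ agree along
g - a S. With it the logarithms give exactly the increment of ½ log(1 + r), and the remaining term
is linear in C, as in the first order condition. -/
lemma partLaw_step {K K₀ : Matrix ι ι ℝ} {g : ι → ℝ} {parts : Finset (Finset ι)} {c d δ : ℝ}
    {a : Finset ι → ι → ℝ} (h : IsStationary K K₀ g parts c d δ a) (hδ : 0 ≤ δ)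
    {S : Finset ι} (hS : S ∈ parts) {r η k s : ℝ} (hr : 0 ≤ r) (hη : 0 < η)
    (hs : s = 1 + (r + η) * (1 + g ⬝ᵥ K₀.mulVec g)) (hk : k * (1 + r + η) = η)
    {f : τ × ℝ → ι → ℝ} (hf : Measurable f)
    (hf2 : ∀ i, MemLp (fun p ↦ X p.1 i - f (observe T X g p) i) 2 (ρ.prod (gaussNoise s)))
    {C : Matrix ι ι ℝ} (hC : ∀ b : ι → ℝ,
      k * (1 + r) * (b ⬝ᵥ C.mulVec b) = k ^ 2 * (∫ p, (b ⬝ᵥ (X p.1 - f (observe T X g p))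
          + (b ⬝ᵥ K₀.mulVec g) / s * (g ⬝ᵥ (X p.1 - f (observe T X g p)))) ^ 2
            ∂(ρ.prod (gaussNoise s)))
        + (k * (1 + r) - k ^ 2) * (b ⬝ᵥ K₀.mulVec b)
        - k ^ 2 * (b ⬝ᵥ K₀.mulVec g) ^ 2 / s) :
    1 / 2 * (Real.log (1 + (r + η)) - Real.log (1 + r))
      + 1 / 2 * (((g - a S) ⬝ᵥ K₀.mulVec (g - a S)) / residVar K₀ g δ (a S)
        - ((g - a S) ⬝ᵥ C.mulVec (g - a S)) / residVar K₀ g δ (a S))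
    ≤ condEnt (partLaw ρ T X K₀ g δ S (a S) (r + η)) (1 + (r + η) * residVar K₀ g δ (a S))
      - condEnt (partLaw ρ T X K₀ g δ S (a S) r) (1 + r * residVar K₀ g δ (a S)) := by
  set w := g - a S with hw
  set v := residVar K₀ g δ (a S) with hv
  have hv1 : 1 ≤ v := h.one_le_residVar hδ
  have hv0 : 0 < v := by linarith
  set l := √(1 + g ⬝ᵥ K₀.mulVec g - v) with hl
  have hl2 : l ^ 2 = 1 + g ⬝ᵥ K₀.mulVec g - v := Real.sq_sqrt (sub_nonneg.2 (h.residVar_le hδ hS))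
  have hae := partLaw_dir h hS
  have hk0 : 0 < k := by
    by_contra! hk'
    nlinarith [mul_nonpos_of_nonpos_of_nonneg hk' (by positivity : 0 ≤ (1 + r + η))]
  have hu : 0 < k * (1 + r) * v := by positivity
  have hQ : Measurable (fun ω (j : S) ↦ X ω j) := by fun_prop
  have key := condEnt_heatLaw_step hT hX hX2 hQ (w := w) hae (fun ω ↦ by
    rw [sum_subtype_of_supp (h.supp S hS), hw, sub_dotProduct]) hr hv0 hη
    (hs.trans (by rw [hl2]; ring)) hk hu hf hf2
  change condEnt (partLaw ρ T X K₀ g δ S (a S) r) (1 + r * v) + _ + _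
    ≤ condEnt (partLaw ρ T X K₀ g δ S (a S) (r + η)) (1 + (r + η) * v) + _ + _ at key
  generalize condEnt (partLaw ρ T X K₀ g δ S (a S) r) (1 + r * v) = B₁ at key ⊢
  generalize condEnt (partLaw ρ T X K₀ g δ S (a S) (r + η)) (1 + (r + η) * v) = B₂ at key ⊢
  have hCw := hC w
  rw [h.resid_dotProduct hS, ← hv] at hCw
  generalize ∫ p, (w ⬝ᵥ (X p.1 - f (observe T X g p))
    + (v - 1) / s * (g ⬝ᵥ (X p.1 - f (observe T X g p)))) ^ 2 ∂(ρ.prod (gaussNoise s)) = I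
    at key hCw
  have hvw : v = 1 + w ⬝ᵥ K₀.mulVec w + δ * (a S ⬝ᵥ a S) := rfl
  have hn : 0 ≤ δ * (a S ⬝ᵥ a S) := mul_nonneg hδ (dotProduct_self_star_nonneg (a S))
  generalize w ⬝ᵥ K₀.mulVec w = A at hCw hvw ⊢
  generalize w ⬝ᵥ C.mulVec w = Cw at hCw ⊢
  -- By `hCw` the two sides differ by k² times the ridge term δ |a S|², which has the right sign.
  have hE : k ^ 2 * I + ((1 - k) ^ 2 * (η * v) + k ^ 2 * (1 + r * v) - k ^ 2 * (v - 1) ^ 2 / s)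
      ≤ k * (1 + r) * (Cw + v - A) := by
    have e1 : (1 - k) ^ 2 * η + k ^ 2 * r = k * (1 + r) - k ^ 2 := by
      linear_combination (k - 1) * hk
    have e2 : k * (1 + r) * (Cw + v - A) = k ^ 2 * I + ((1 - k) ^ 2 * (η * v)
        + k ^ 2 * (1 + r * v) - k ^ 2 * (v - 1) ^ 2 / s) + k ^ 2 * (v - 1 - A) := by
      linear_combination hCw - v * e1
    have e3 : 0 ≤ k ^ 2 * (v - 1 - A) := mul_nonneg (sq_nonneg k) (by linarith)
    linarith
  have hlog : Real.log (2 * Real.pi * (η * v)) - Real.log (2 * Real.pi * (k * (1 + r) * v))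
      = Real.log (1 + (r + η)) - Real.log (1 + r) := by
    rw [← Real.log_div (by positivity) (by positivity), ← Real.log_div (by positivity)
      (by positivity)]
    congr 1
    rw [div_eq_div_iff (by positivity) (by positivity)]
    linear_combination (-2 * Real.pi * v * (1 + r)) * hk
  have hd := div_le_div_of_nonneg_right hE (by positivity : 0 ≤ 2 * (k * (1 + r) * v))
  have e2 : k * (1 + r) * (Cw + v - A) / (2 * (k * (1 + r) * v))
      = 1 / 2 - 1 / 2 * (A / v - Cw / v) := by
    field_simp
    ring
  linarith

/-- One matrix C controls everything: its values along g - a S bound the increments for the blocks,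
its value along g bounds the Fisher information, and the first order condition at K₀ compares the
two. -/
lemma sum_partLaw_step {K K₀ : Matrix ι ι ℝ} (hK : ∀ i j, ∫ ω, X ω i * X ω j ∂ρ = K i j)
    {g : ι → ℝ} {parts : Finset (Finset ι)} {c d δ : ℝ}
    {a : Finset ι → ι → ℝ} (h : IsStationary K K₀ g parts c d δ a) (hδ : 0 ≤ δ) (hc : 0 ≤ c)
    (hd : 0 ≤ d) {σ : ℝ} (hσ : σ = 1 + g ⬝ᵥ K₀.mulVec g) {r η : ℝ} (hr : 0 ≤ r) (hη : 0 < η)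
    [IsProbabilityMeasure (ρ.map fun ω ↦ (T ω, g ⬝ᵥ X ω))] :
    η / (1 + r) * ((1 + r + η) * (c / 2 * (σ * fisherInfo (ρ.map fun ω ↦ (T ω, g ⬝ᵥ X ω))
        (1 + (r + η) * σ) - 1 / (1 + (r + η)))))
      ≤ (d * ∑ S ∈ parts, (condEnt (partLaw ρ T X K₀ g δ S (a S) (r + η))
          (1 + (r + η) * residVar K₀ g δ (a S)) - 1 / 2 * Real.log (1 + (r + η))))
        - d * ∑ S ∈ parts, (condEnt (partLaw ρ T X K₀ g δ S (a S) r)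
          (1 + r * residVar K₀ g δ (a S)) - 1 / 2 * Real.log (1 + r)) := by
  have hγ : 0 ≤ g ⬝ᵥ K₀.mulVec g := (posSemidef_iff_real.1 h.posSemidef).2 g
  obtain ⟨s, hs⟩ : ∃ s, s = 1 + (r + η) * σ := ⟨_, rfl⟩
  obtain ⟨k, hk'⟩ : ∃ k, k = η / (1 + r + η) := ⟨_, rfl⟩
  have hk : k * (1 + r + η) = η := by rw [hk']; field_simp
  have hk0 : 0 < k := by rw [hk']; positivity
  have hs0 : 0 < s := by rw [hs, hσ]; positivity
  have hs' : s = 1 + (r + η) * (1 + g ⬝ᵥ K₀.mulVec g) := by rw [hs, hσ]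
  obtain ⟨f, hf, hf2, hmin⟩ := exists_estimator hT hX hX2 g s
  obtain ⟨C, hC, hKC, hCb⟩ := exists_error_cov hX2 hK h.posSemidef h.le hr hη hs' hk hf2 hmin
  have hJ := integral_sq_le_fisherInfo hT hX hX2 hs0 (hmin g)
  rw [← hs]
  generalize fisherInfo (ρ.map fun ω ↦ (T ω, g ⬝ᵥ X ω)) s = J at hJ ⊢
  have hpart := fun S hS ↦ partLaw_step hT hX hX2 h hδ (S := S) hS hr hη hs' hk hf hf2 hCb
  have hsum := mul_le_mul_of_nonneg_left (Finset.sum_le_sum hpart) hd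
  have hkkt := h.kkt C hC hKC
  have hCg := hCb g
  have e1 : ∀ p : Ω × ℝ, (g ⬝ᵥ (X p.1 - f (observe T X g p)) + (g ⬝ᵥ K₀.mulVec g) / s
      * (g ⬝ᵥ (X p.1 - f (observe T X g p)))) ^ 2
      = (1 + (g ⬝ᵥ K₀.mulVec g) / s) ^ 2 * (g ⬝ᵥ (X p.1 - f (observe T X g p))) ^ 2 :=
    fun p ↦ by ring
  simp_rw [e1] at hCg
  rw [integral_const_mul] at hCg
  generalize ∫ p, (g ⬝ᵥ (X p.1 - f (observe T X g p))) ^ 2 ∂(ρ.prod (gaussNoise s)) = I at hJ hCg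
  rw [← hσ] at hkkt
  have hγσ : g ⬝ᵥ K₀.mulVec g = σ - 1 := by rw [hσ]; ring
  rw [hγσ] at hCg hkkt hγ
  have hσ0 : 0 < σ := by linarith
  generalize g ⬝ᵥ C.mulVec g = Cg at hCg hkkt
  have hsσ : s + (σ - 1) = (1 + r + η) * σ := by rw [hs]; ring
  -- Along g the error has second moment at most s - s²J; with s + (σ - 1) = (1 + r + η)σ this
  -- becomes an upper bound for gᵀCg in terms of J.
  have hgC : η / (1 + r) * ((1 + r + η) * σ * J - 1) ≤ (σ - 1) / σ - Cg / σ := by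
    have h1 : (1 + (σ - 1) / s) ^ 2 * I ≤ (1 + (σ - 1) / s) ^ 2 * (s - s ^ 2 * J) :=
      mul_le_mul_of_nonneg_left hJ (sq_nonneg _)
    have h2 : (1 + (σ - 1) / s) ^ 2 * (s - s ^ 2 * J)
        = (s + (σ - 1)) ^ 2 / s - (s + (σ - 1)) ^ 2 * J := by field_simp
    have h2' : (s + (σ - 1)) ^ 2 / s = s + 2 * (σ - 1) + (σ - 1) ^ 2 / s := by field_simp; ring
    have h3 : k * (1 + r) * Cg ≤ k * (1 + r) * (σ - 1)
        + k ^ 2 * ((1 + r + η) * σ - ((1 + r + η) * σ) ^ 2 * J) := by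
      rw [hCg]
      rw [h2, h2'] at h1
      have h4 := mul_le_mul_of_nonneg_left h1 (sq_nonneg k)
      have h5 : k ^ 2 * (σ - 1) ^ 2 / s = k ^ 2 * ((σ - 1) ^ 2 / s) := by ring
      rw [h5]
      rw [← hsσ]
      linarith
    rw [← sub_div, le_div_iff₀ hσ0, div_mul_eq_mul_div, div_mul_eq_mul_div,
      div_le_iff₀ (by positivity)]
    have h6 : k * (η * ((1 + r + η) * σ * J - 1) * σ) ≤ k * ((σ - 1 - Cg) * (1 + r)) := by
      have h7 : k * (η * ((1 + r + η) * σ * J - 1) * σ)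
          = k ^ 2 * (((1 + r + η) * σ) ^ 2 * J - (1 + r + η) * σ) := by
        linear_combination (-k * σ * ((1 + r + η) * σ * J - 1)) * hk
      rw [h7]; linarith
    exact le_of_mul_le_mul_left h6 hk0
  have hleft : η / (1 + r) * ((1 + r + η) * (c / 2 * (σ * J - 1 / (1 + (r + η)))))
      = c / 2 * (η / (1 + r) * ((1 + r + η) * σ * J - 1)) := by
    field_simp
    ring
  rw [hleft]
  have hcg := mul_le_mul_of_nonneg_left hgC (by positivity : 0 ≤ c / 2)
  simp only [Finset.sum_sub_distrib, Finset.sum_add_distrib, ← Finset.mul_sum, mul_sub, mul_add,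
    Finset.sum_const, nsmul_eq_mul] at hsum hkkt hcg ⊢
  linarith

/-- The Gaussian bound for the entropies at a stationary point. -/
theorem sum_condEnt_le {K K₀ : Matrix ι ι ℝ} (hK : ∀ i j, ∫ ω, X ω i * X ω j ∂ρ = K i j)
    {g : ι → ℝ} {parts : Finset (Finset ι)} {c d δ : ℝ}
    {a : Finset ι → ι → ℝ} (h : IsStationary K K₀ g parts c d δ a) (hδ : 0 ≤ δ) (hc : 0 ≤ c)
    (hd : 0 ≤ d) :
    d * ∑ S ∈ parts, condEnt (ρ.map fun ω ↦ (((fun j : S ↦ X ω j), T ω), g ⬝ᵥ X ω)) 1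
        - c * condEnt (ρ.map fun ω ↦ (T ω, g ⬝ᵥ X ω)) 1
      ≤ d * ∑ S ∈ parts, (1 / 2 * Real.log (2 * Real.pi * residVar K₀ g δ (a S)) + 1 / 2)
        - c * (1 / 2 * Real.log (2 * Real.pi * (1 + g ⬝ᵥ K₀.mulVec g)) + 1 / 2) := by
  have hprob : IsProbabilityMeasure (ρ.map fun ω ↦ (T ω, g ⬝ᵥ X ω)) :=
    Measure.isProbabilityMeasure_map (by fun_prop)
  set θ := ρ.map fun ω ↦ (T ω, g ⬝ᵥ X ω) with hθ
  have hθ2 : MemLp (fun w : τ × ℝ ↦ w.2) 2 θ := by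
    rw [hθ, memLp_map_measure_iff (by fun_prop) (by fun_prop)]
    exact memLp_dotProduct hX2 g
  have hγ : 0 ≤ g ⬝ᵥ K₀.mulVec g := (posSemidef_iff_real.1 h.posSemidef).2 g
  obtain ⟨σ, hσ⟩ : ∃ σ, σ = 1 + g ⬝ᵥ K₀.mulVec g := ⟨_, rfl⟩
  have hσ1 : 1 ≤ σ := by linarith
  set v : Finset ι → ℝ := fun S ↦ residVar K₀ g δ (a S) with hv
  have hv1 : ∀ S, 1 ≤ v S := fun S ↦ h.one_le_residVar hδ
  -- F - H is the monotone quantity. It is the left side of the claim at time 0, and subtracting ½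
  -- log(1 + r) keeps the entropies from diverging as r → ∞.
  set F : ℝ → ℝ := fun r ↦ d * ∑ S ∈ parts, (condEnt (partLaw ρ T X K₀ g δ S (a S) r)
    (1 + r * v S) - 1 / 2 * Real.log (1 + r)) with hF
  set H : ℝ → ℝ := fun r ↦ c * (condEnt θ (1 + r * σ) - 1 / 2 * Real.log (1 + r)) with hH
  have hmono : ∀ b, 0 ≤ b → F 0 - H 0 ≤ F b - H b := fun b hb ↦ by
    have := sub_le_sub_of_step (F := F) (H := H)
      (h := fun r ↦ c / 2 * (σ * fisherInfo θ (1 + r * σ) - 1 / (1 + r))) hb ?_ ?_ ?_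
    · linarith
    · intro r hr
      have hr0 := hr.1
      have h1 : HasDerivAt (fun r ↦ 1 + r * σ) σ r := by
        simpa using ((hasDerivAt_id r).mul_const σ).const_add 1
      have h2 := (hasDerivAt_condEnt hθ2 (s := 1 + r * σ) (by positivity)).comp r h1
      have h3 : HasDerivAt (fun r : ℝ ↦ Real.log (1 + r)) (1 / (1 + r)) r :=
        ((hasDerivAt_id r).const_add 1).log (by simp; positivity)
      exact ((h2.sub (h3.const_mul (1 / 2))).const_mul c).congr_deriv (by ring)
    · intro r hr
      have hr0 := hr.1
      have h1 : ContinuousAt (fun r ↦ fisherInfo θ (1 + r * σ)) r :=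
        ContinuousAt.comp (f := fun r ↦ 1 + r * σ) (g := fisherInfo θ)
          (continuousAt_fisherInfo θ (by positivity)) (by fun_prop)
      have h2 : ContinuousAt (fun r : ℝ ↦ 1 / (1 + r)) r :=
        continuousAt_const.div (by fun_prop) (by positivity)
      exact (continuousAt_const.mul ((continuousAt_const.mul h1).sub h2)).continuousWithinAt
    · intro r η hr hη _
      exact sum_partLaw_step hT hX hX2 hK h hδ hc hd hσ hr hη
  -- At large times the noise dominates: its own entropy bounds the output entropy below, and
  -- maximum entropy bounds the conditional ones above. In the latter `a S` removes the injected
  -- noise exactly, so the error on the signal does not grow with time.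
  have hA : ∀ b, 0 ≤ b → 1 / 2 * Real.log (2 * Real.pi * (1 + b * σ)) + 1 / 2
      ≤ condEnt θ (1 + b * σ) := fun b hb ↦ le_condEnt (by positivity) hθ2
  have hB : ∀ b, 0 ≤ b → ∀ S ∈ parts, condEnt (partLaw ρ T X K₀ g δ S (a S) b) (1 + b * v S)
      ≤ 1 / 2 * Real.log (2 * Real.pi * (∫ ω, ((g - a S) ⬝ᵥ X ω) ^ 2 ∂ρ + (1 + b * v S)))
        + 1 / 2 := fun b hb S hS ↦ by
    have hvS := hv1 S
    have hQ : Measurable (fun ω (j : S) ↦ X ω j) := by fun_prop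
    have hpr : IsProbabilityMeasure (partLaw ρ T X K₀ g δ S (a S) b) :=
      isProbabilityMeasure_heatLaw hT hQ (by fun_prop) _ _ _
    have hdir := partLaw_dir h hS
    have e1 : ∀ ω : Ω × ℝ, g ⬝ᵥ X ω.1 + √(1 + g ⬝ᵥ K₀.mulVec g - residVar K₀ g δ (a S)) * ω.2
        - (fun j : S ↦ a S j) ⬝ᵥ ((fun j : S ↦ X ω.1 j) + ω.2 • fun j : S ↦
          √(1 + g ⬝ᵥ K₀.mulVec g - residVar K₀ g δ (a S)) / (a S ⬝ᵥ a S) * a S j)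
        = (g - a S) ⬝ᵥ X ω.1 := fun ω ↦ by
      rw [dotProduct_add, dotProduct_smul, hdir, sum_subtype_of_supp (h.supp S hS), sub_dotProduct,
        smul_eq_mul]
      ring
    refine condEnt_le_log (θ := partLaw ρ T X K₀ g δ S (a S) b) (by positivity)
      (memLp_heatLaw hT hQ (by fun_prop) _ _ (memLp_dotProduct hX2 g) _)
      (b := fun u ↦ (fun j : S ↦ a S j) ⬝ᵥ u.1) (by fun_prop) ?_ (le_of_eq ?_)
    · rw [partLaw, heatLaw, memLp_map_measure_iff (by fun_prop) (by fun_prop)]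
      refine (MemLp.ae_eq (Filter.Eventually.of_forall fun ω ↦ (e1 ω).symm)
        ((memLp_dotProduct hX2 (g - a S)).comp_fst _))
    · rw [partLaw, heatLaw, integral_map (by fun_prop) (by fun_prop)]
      simp_rw [e1]
      rw [integral_fun_fst (fun ω ↦ ((g - a S) ⬝ᵥ X ω) ^ 2)]
      simp
  have h0 : F 0 - H 0 = d * ∑ S ∈ parts, condEnt (ρ.map fun ω ↦
      (((fun j : S ↦ X ω j), T ω), g ⬝ᵥ X ω)) 1 - c * condEnt θ 1 := by
    have e : ∀ S, partLaw ρ T X K₀ g δ S (a S) 0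
        = ρ.map fun ω ↦ (((fun j : S ↦ X ω j), T ω), g ⬝ᵥ X ω) := fun S ↦ by
      rw [partLaw, heatLaw]
      have hg0 : gaussNoise 0 = Measure.dirac 0 := by simp [gaussNoise]
      rw [hg0, Measure.prod_dirac, Measure.map_map (by fun_prop) (by fun_prop)]
      congr 1
      ext ω <;> simp
    simp only [hF, hH, zero_mul, add_zero, Real.log_one, mul_zero, sub_zero]
    congr 2
    refine Finset.sum_congr rfl fun S _ ↦ ?_
    congr 1
    exact e S
  rw [← h0]
  have hlim : ∀ A B : ℝ, 0 < B → Filter.Tendsto (fun b : ℝ ↦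
      1 / 2 * Real.log (2 * Real.pi * ((A + b * B) / (1 + b))) + 1 / 2) Filter.atTop
      (nhds (1 / 2 * Real.log (2 * Real.pi * B) + 1 / 2)) := fun A B hB ↦ by
    have h1 : Filter.Tendsto (fun b : ℝ ↦ (A - B) / (1 + b) + B) Filter.atTop (nhds (0 + B)) :=
      (Filter.Tendsto.div_atTop tendsto_const_nhds
        (Filter.tendsto_atTop_add_const_left _ _ Filter.tendsto_id)).add_const B
    rw [zero_add] at h1
    have h2 : Filter.Tendsto (fun b : ℝ ↦ (A + b * B) / (1 + b)) Filter.atTop (nhds B) := by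
      refine h1.congr' ?_
      filter_upwards [Filter.eventually_ge_atTop 0] with b hb
      field_simp
      ring
    exact (((h2.const_mul _).log (by positivity)).const_mul _).add_const _
  have hT1 : Filter.Tendsto (fun b : ℝ ↦ d * ∑ S ∈ parts, (1 / 2 * Real.log (2 * Real.pi *
      (((∫ ω, ((g - a S) ⬝ᵥ X ω) ^ 2 ∂ρ + 1) + b * v S) / (1 + b))) + 1 / 2)
      - c * (1 / 2 * Real.log (2 * Real.pi * ((1 + b * σ) / (1 + b))) + 1 / 2)) Filter.atTop
      (nhds (d * ∑ S ∈ parts, (1 / 2 * Real.log (2 * Real.pi * v S) + 1 / 2)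
        - c * (1 / 2 * Real.log (2 * Real.pi * σ) + 1 / 2))) :=
    ((tendsto_finsetSum _ fun S _ ↦ hlim _ _ (by linarith [hv1 S])).const_mul d).sub
      ((hlim 1 σ (by linarith)).const_mul c)
  rw [← hσ]
  refine ge_of_tendsto hT1 ?_
  filter_upwards [Filter.eventually_ge_atTop 0] with b hb
  refine (hmono b hb).trans (sub_le_sub ?_ ?_)
  · refine mul_le_mul_of_nonneg_left (Finset.sum_le_sum fun S hS ↦ ?_) hd
    have hvS := hv1 S
    have hI : 0 ≤ ∫ ω, ((g - a S) ⬝ᵥ X ω) ^ 2 ∂ρ := integral_nonneg fun ω ↦ sq_nonneg _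
    have h1 := hB b hb S hS
    rw [← mul_div_assoc, Real.log_div (by positivity) (by positivity), add_assoc]
    linarith
  · refine mul_le_mul_of_nonneg_left ?_ hc
    have h1 := hA b hb
    rw [← mul_div_assoc, Real.log_div (by positivity) (by positivity)]
    linarith

end Stationary

/-! ### The Gaussian optimisation problem -/

section Optimisation

variable {ι : Type*} [Fintype ι]

/-- Fredholm's alternative: the range of a symmetric matrix is the orthogonal complement of its
kernel. -/
lemma exists_mulVec_eq [DecidableEq ι] {N : Matrix ι ι ℝ} (hN : ∀ i j, N i j = N j i) {y : ι → ℝ}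
    (hy : ∀ x, N.mulVec x = 0 → x ⬝ᵥ y = 0) : ∃ a, N.mulVec a = y := by
  have hH : N.IsHermitian := Matrix.IsHermitian.ext fun i j ↦ by simp [hN i j]
  have hT := Matrix.isSymmetric_toEuclideanLin_iff.2 hH
  have h1 : WithLp.toLp 2 y ∈ LinearMap.range (Matrix.toEuclideanLin N) := by
    rw [← Submodule.orthogonal_orthogonal (LinearMap.range (Matrix.toEuclideanLin N)),
      hT.orthogonal_range, Submodule.mem_orthogonal]
    intro u hu
    have h2 : N.mulVec u.ofLp = 0 := by
      rw [LinearMap.mem_ker, Matrix.toLpLin_apply] at hu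
      simpa using congrArg WithLp.ofLp hu
    have h3 := hy _ h2
    rw [EuclideanSpace.inner_eq_star_dotProduct, star_trivial, dotProduct_comm]
    exact h3
  obtain ⟨x, hx⟩ := h1
  refine ⟨x.ofLp, ?_⟩
  rw [Matrix.toLpLin_apply] at hx
  simpa using congrArg WithLp.ofLp hx

lemma mulVec_eq_zero_of_dotProduct {C : Matrix ι ι ℝ} (hC : C.PosSemidef) {x : ι → ℝ}
    (hx : x ⬝ᵥ C.mulVec x = 0) (b : ι → ℝ) : x ⬝ᵥ C.mulVec b = 0 := by
  have := sq_dotProduct_mulVec_le hC x b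
  rw [hx, zero_mul] at this
  exact pow_eq_zero_iff two_ne_zero |>.1 (le_antisymm this (sq_nonneg _))

/-- The normal equations of the regularised linear estimation problem are solvable. -/
lemma exists_normal {C : Matrix ι ι ℝ} (hC : C.PosSemidef) (g : ι → ℝ) {δ : ℝ} (hδ : 0 ≤ δ)
    (S : Finset ι) : ∃ a : ι → ℝ, (∀ i ∉ S, a i = 0) ∧ ∀ i ∈ S, C.mulVec (g - a) i = δ * a i := by
  classical
  have hC' := posSemidef_iff_real.1 hC
  -- The block of C + δ on S, extended by zero. It may be singular, as δ = 0 is allowed; but C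
  -- annihilates the restriction to S of any vector in its kernel, so the right side is in its
  -- range.
  set N : Matrix ι ι ℝ := Matrix.of fun i j ↦
    if i ∈ S then if j ∈ S then C i j + if i = j then δ else 0 else 0 else 0 with hN
  set R : (ι → ℝ) → ι → ℝ := fun x j ↦ if j ∈ S then x j else 0 with hR
  have hNx : ∀ x i, N.mulVec x i = if i ∈ S then C.mulVec (R x) i + δ * x i else 0 := by
    intro x i
    simp only [hN, hR, Matrix.mulVec, dotProduct, Matrix.of_apply]
    by_cases hi : i ∈ S
    · simp only [hi, if_true]
      have : δ * x i = ∑ j, if i = j then δ * x j else 0 := by simp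
      rw [this, ← Finset.sum_add_distrib]
      refine Finset.sum_congr rfl fun j _ ↦ ?_
      by_cases hj : j ∈ S
      · by_cases hij : i = j <;> simp [hj, hij, add_mul]
      · have hij : i ≠ j := fun h ↦ hj (h ▸ hi)
        simp [hj, hij]
    · simp [hi]
  have hRdot : ∀ x z : ι → ℝ, (x ⬝ᵥ fun i ↦ if i ∈ S then z i else 0) = R x ⬝ᵥ z := by
    intro x z
    simp only [dotProduct, hR]
    refine Finset.sum_congr rfl fun j _ ↦ ?_
    by_cases hj : j ∈ S <;> simp [hj]
  obtain ⟨a, ha⟩ := exists_mulVec_eq (N := N) (y := fun i ↦ if i ∈ S then C.mulVec g i else 0)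
    (fun i j ↦ by
      by_cases hi : i ∈ S <;> by_cases hj : j ∈ S <;> simp [hN, hi, hj, hC'.1 i j, eq_comm])
    (fun x hx ↦ by
      have h1 : R x ⬝ᵥ C.mulVec (R x) + δ * (R x ⬝ᵥ R x) = 0 := by
        have h2 : x ⬝ᵥ N.mulVec x = 0 := by rw [hx, dotProduct_zero]
        rw [← h2, ← smul_eq_mul, ← dotProduct_smul, ← dotProduct_add, ← hRdot]
        congr 1 with i
        rw [hNx]
        by_cases hi : i ∈ S <;> simp [hR, hi]
      have h3 := hC'.2 (R x)
      have h4 : 0 ≤ δ * (R x ⬝ᵥ R x) := mul_nonneg hδ (dotProduct_self_star_nonneg (R x))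
      rw [hRdot]
      exact mulVec_eq_zero_of_dotProduct hC (by linarith) g)
  refine ⟨R a, fun i hi ↦ by simp [hR, hi], fun i hi ↦ ?_⟩
  have h1 := congrFun ha i
  rw [hNx] at h1
  simp only [hi, if_true] at h1
  rw [Matrix.mulVec_sub, Pi.sub_apply, ← h1]
  simp [hR, hi]

/-- The second order expansion of the residual variance around a solution of perturbed normal
equations. -/
lemma residVar_add {C : Matrix ι ι ℝ} (hC : ∀ i j, C i j = C j i) (g : ι → ℝ) (δ : ℝ)
    (a h : ι → ℝ) : residVar C g δ (a + h)
      = residVar C g δ a - 2 * (h ⬝ᵥ (C.mulVec (g - a) - δ • a)) + h ⬝ᵥ C.mulVec h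
        + δ * (h ⬝ᵥ h) := by
  have e : g - (a + h) = (g - a) - h := by abel
  simp only [residVar, e, Matrix.mulVec_sub, sub_dotProduct, dotProduct_sub, add_dotProduct, dotProduct_add, dotProduct_smul, smul_eq_mul, dotProduct_comm a h,
    dotProduct_mulVec_comm hC g h, dotProduct_mulVec_comm hC a h, dotProduct_mulVec_comm hC a g]
  ring

lemma dotProduct_eq_zero_of_supp {S : Finset ι} {h z : ι → ℝ} (hh : ∀ i ∉ S, h i = 0)
    (hz : ∀ i ∈ S, z i = 0) : h ⬝ᵥ z = 0 :=
  Finset.sum_eq_zero fun i _ ↦ by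
    by_cases hi : i ∈ S
    · rw [hz i hi, mul_zero]
    · rw [hh i hi, zero_mul]

/-- Admissible covariance matrices. -/
def admissible (K : Matrix ι ι ℝ) : Set (Matrix ι ι ℝ) := {C | C.PosSemidef ∧ (K - C).PosSemidef}

lemma residVar_le_of_normal {C : Matrix ι ι ℝ} (hC : C.PosSemidef) {g : ι → ℝ} {δ : ℝ}
    (hδ : 0 ≤ δ) {S : Finset ι} {a b : ι → ℝ} (ha : ∀ i ∉ S, a i = 0)
    (hn : ∀ i ∈ S, C.mulVec (g - a) i = δ * a i) (hb : ∀ i ∉ S, b i = 0) :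
    residVar C g δ a ≤ residVar C g δ b := by
  have hC' := posSemidef_iff_real.1 hC
  have e := residVar_add hC'.1 g δ a (b - a)
  rw [add_sub_cancel] at e
  rw [e, dotProduct_eq_zero_of_supp (S := S) (fun i hi ↦ by simp [ha i hi, hb i hi])
    (fun i hi ↦ by simp [hn i hi])]
  have h1 := hC'.2 (b - a)
  have h2 := mul_nonneg hδ (dotProduct_self_star_nonneg (b - a))
  simp only [star_trivial] at h2
  linarith

lemma one_le_residVar {C : Matrix ι ι ℝ} (hC : C.PosSemidef) (g : ι → ℝ) {δ : ℝ} (hδ : 0 ≤ δ)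
    (a : ι → ℝ) : 1 ≤ residVar C g δ a := by
  have h1 := (posSemidef_iff_real.1 hC).2 (g - a)
  have h2 := mul_nonneg hδ (dotProduct_self_star_nonneg a)
  simp only [star_trivial] at h2
  rw [residVar]
  linarith

open Classical in
/-- The optimal regularised linear estimator of the output from the inputs in `S`. -/
def optEst (C : Matrix ι ι ℝ) (g : ι → ℝ) (δ : ℝ) (S : Finset ι) : ι → ℝ :=
  if h : C.PosSemidef ∧ 0 ≤ δ then (exists_normal h.1 g h.2 S).choose else 0

section OptEst

variable {C : Matrix ι ι ℝ} (hC : C.PosSemidef) (g : ι → ℝ) {δ : ℝ} (hδ : 0 ≤ δ) (S : Finset ι)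

include hC hδ

lemma optEst_supp : ∀ i ∉ S, optEst C g δ S i = 0 := by
  rw [optEst, dif_pos ⟨hC, hδ⟩]
  exact (exists_normal hC g hδ S).choose_spec.1

lemma optEst_normal : ∀ i ∈ S, C.mulVec (g - optEst C g δ S) i = δ * optEst C g δ S i := by
  rw [optEst, dif_pos ⟨hC, hδ⟩]
  exact (exists_normal hC g hδ S).choose_spec.2

lemma residVar_optEst_le {b : ι → ℝ} (hb : ∀ i ∉ S, b i = 0) :
    residVar C g δ (optEst C g δ S) ≤ residVar C g δ b :=
  residVar_le_of_normal hC hδ (optEst_supp hC g hδ S) (optEst_normal hC g hδ S) hb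

end OptEst

/-- The Gaussian value of the Lagrangian for given linear estimators. -/
def gaussVal (g : ι → ℝ) (parts : Finset (Finset ι)) (c d δ : ℝ) (C : Matrix ι ι ℝ)
    (a : Finset ι → ι → ℝ) : ℝ :=
  c * Real.log (1 + g ⬝ᵥ C.mulVec g) - d * ∑ S ∈ parts, Real.log (residVar C g δ (a S))

/-- The value at the optimal estimators is thus a supremum, over fixed estimators, of functions
continuous in C. This gives lower semicontinuity and closed sublevel sets without continuity of
`optEst`. -/
lemma gaussVal_le_optEst (g : ι → ℝ) (parts : Finset (Finset ι)) (c : ℝ) {d δ : ℝ} (hd : 0 ≤ d)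
    (hδ : 0 ≤ δ) {C : Matrix ι ι ℝ} (hC : C.PosSemidef) {a : Finset ι → ι → ℝ}
    (ha : ∀ S, ∀ i ∉ S, a S i = 0) :
    gaussVal g parts c d δ C a ≤ gaussVal g parts c d δ C (optEst C g δ) := by
  refine sub_le_sub_left (mul_le_mul_of_nonneg_left (Finset.sum_le_sum fun S _ ↦ ?_) hd) _
  exact Real.log_le_log (by linarith [one_le_residVar hC g hδ (optEst C g δ S)])
    (residVar_optEst_le hC g hδ S (ha S))

lemma isClosed_posSemidef : IsClosed {C : Matrix ι ι ℝ | C.PosSemidef} := by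
  have : {C : Matrix ι ι ℝ | C.PosSemidef} = (⋂ (i) (j), {C | C i j = C j i})
      ∩ ⋂ b : ι → ℝ, {C | 0 ≤ b ⬝ᵥ C.mulVec b} := by
    ext C; simp [posSemidef_iff_real]
  rw [this]
  refine IsClosed.inter (isClosed_iInter fun i ↦ isClosed_iInter fun j ↦ isClosed_eq
    (continuous_id.matrix_elem i j) (continuous_id.matrix_elem j i)) (isClosed_iInter fun b ↦ ?_)
  exact isClosed_le continuous_const
    (continuous_const.dotProduct (continuous_id.matrix_mulVec continuous_const))

/-- Boundedness follows from (C i j)² ≤ C i i C j j ≤ K i i K j j and |x| ≤ 1 + x². -/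
lemma isCompact_admissible [DecidableEq ι] (K : Matrix ι ι ℝ) : IsCompact (admissible K) := by
  have hcl : IsClosed (admissible K) := isClosed_posSemidef.inter
    (isClosed_posSemidef.preimage (continuous_const.sub continuous_id))
  have hbox : IsCompact (Set.pi Set.univ fun i ↦ Set.pi Set.univ fun j ↦
      Set.Icc (-(1 + K i i * K j j)) (1 + K i i * K j j) : Set (ι → ι → ℝ)) :=
    isCompact_univ_pi fun i ↦ isCompact_univ_pi fun j ↦ isCompact_Icc
  refine IsCompact.of_isClosed_subset hbox hcl fun C hC ↦ ?_
  have hs : ∀ (A : Matrix ι ι ℝ) (i j : ι),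
      Pi.single i 1 ⬝ᵥ A.mulVec (Pi.single j 1) = A i j := fun A i j ↦ by simp
  have hC' := posSemidef_iff_real.1 hC.1
  have hd : ∀ i, 0 ≤ C i i ∧ C i i ≤ K i i := fun i ↦ by
    have h1 := hC'.2 (Pi.single i 1)
    have h2 := (posSemidef_iff_real.1 hC.2).2 (Pi.single i 1)
    rw [hs] at h1 h2
    rw [Matrix.sub_apply] at h2
    exact ⟨h1, by linarith⟩
  intro i _ j _
  have h1 := sq_dotProduct_mulVec_le hC.1 (Pi.single i 1) (Pi.single j 1)
  rw [hs, hs, hs] at h1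
  have h2 := mul_le_mul (hd i).2 (hd j).2 (hd j).1 ((hd i).1.trans (hd i).2)
  have h3 : -(1 + K i i * K j j) ≤ C i j ∧ C i j ≤ 1 + K i i * K j j := by
    constructor <;> nlinarith [sq_nonneg (C i j - 1), sq_nonneg (C i j + 1)]
  exact h3

lemma continuous_residVar (g : ι → ℝ) (δ : ℝ) (a : ι → ℝ) :
    Continuous fun C : Matrix ι ι ℝ ↦ residVar C g δ a := by
  unfold residVar
  exact (continuous_const.add (continuous_const.dotProduct
    (continuous_id.matrix_mulVec continuous_const))).add continuous_const

lemma continuousOn_gaussVal (g : ι → ℝ) (parts : Finset (Finset ι)) (c d : ℝ) {δ : ℝ} (hδ : 0 ≤ δ)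
    (K : Matrix ι ι ℝ) (a : Finset ι → ι → ℝ) :
    ContinuousOn (fun C ↦ gaussVal g parts c d δ C a) (admissible K) := by
  unfold gaussVal
  refine ContinuousOn.sub (continuousOn_const.mul (ContinuousOn.log ?_ fun C hC ↦ ?_))
    (continuousOn_const.mul (continuousOn_finsetSum _ fun S _ ↦ ContinuousOn.log
      (continuous_residVar g δ (a S)).continuousOn fun C hC ↦ ?_))
  · exact (continuous_const.add (continuous_const.dotProduct
      (continuous_id.matrix_mulVec continuous_const))).continuousOn
  · linarith [(posSemidef_iff_real.1 hC.1).2 g]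
  · linarith [one_le_residVar hC.1 g hδ (a S)]

lemma lowerSemicontinuousOn_gaussVal (g : ι → ℝ) (parts : Finset (Finset ι)) (c : ℝ) {d δ : ℝ}
    (hd : 0 ≤ d) (hδ : 0 ≤ δ) (K : Matrix ι ι ℝ) :
    LowerSemicontinuousOn (fun C ↦ gaussVal g parts c d δ C (optEst C g δ)) (admissible K) := by
  intro C hC y hy
  filter_upwards [(continuousOn_gaussVal g parts c d hδ K (optEst C g δ) C hC).eventually
    (lt_mem_nhds hy), self_mem_nhdsWithin] with C' h1 h2
  exact h1.trans_le (gaussVal_le_optEst g parts c hd hδ h2.1 fun S ↦ optEst_supp hC.1 g hδ S)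

end Optimisation

/-! ### First order conditions, removal of the regularisation, splitting off a mean. -/

section Minimiser

variable {ι : Type*} [Fintype ι]

lemma nonneg_of_hasDerivAt_of_le {φ : ℝ → ℝ} {φ' : ℝ} (h : HasDerivAt φ φ' 0)
    (hle : ∀ᶠ ε in nhdsWithin (0 : ℝ) (Set.Ioi 0), φ 0 ≤ φ ε) : 0 ≤ φ' := by
  have h1 := (hasDerivWithinAt_iff_tendsto_slope' (by simp)).1 (h.hasDerivWithinAt (s := Set.Ioi 0))
  refine ge_of_tendsto h1 ?_
  filter_upwards [hle, self_mem_nhdsWithin] with ε h2 h3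
  rw [slope_def_field]
  exact div_nonneg (by linarith) (by simpa using (Set.mem_Ioi.1 h3).le)

lemma posSemidef_segment {C₀ C : Matrix ι ι ℝ} (h₀ : C₀.PosSemidef) (h : C.PosSemidef) {ε : ℝ}
    (hε : 0 ≤ ε) (hε1 : ε ≤ 1) : (C₀ + ε • (C - C₀)).PosSemidef := by
  rw [posSemidef_iff_real] at *
  refine ⟨fun i j ↦ ?_, fun b ↦ ?_⟩
  · simp [h₀.1 i j, h.1 i j]
  · simp only [Matrix.add_mulVec, Matrix.smul_mulVec, Matrix.sub_mulVec, dotProduct_add,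
      dotProduct_smul, dotProduct_sub, smul_eq_mul]
    nlinarith [mul_nonneg hε (h.2 b), mul_nonneg (sub_nonneg.2 hε1) (h₀.2 b)]

/-- An envelope theorem: to first order in ε the estimator may be frozen. Completing the square in b
- a, the ridge term δ |b - a|² pays for any change of estimator at a cost of order ε²/δ; here δ > 0
is essential. -/
lemma le_residVar_segment {C₀ C : Matrix ι ι ℝ} (h₀ : C₀.PosSemidef) (h : C.PosSemidef)
    (g : ι → ℝ) {δ : ℝ} (hδ : 0 < δ) (S : Finset ι) {ε : ℝ} (hε : 0 ≤ ε) (hε1 : ε ≤ 1)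
    {b : ι → ℝ} (hb : ∀ i ∉ S, b i = 0) :
    residVar C₀ g δ (optEst C₀ g δ S)
      + ε * ((g - optEst C₀ g δ S) ⬝ᵥ (C - C₀).mulVec (g - optEst C₀ g δ S))
      - ε ^ 2 * (((C - C₀).mulVec (g - optEst C₀ g δ S) ⬝ᵥ
          (C - C₀).mulVec (g - optEst C₀ g δ S)) / δ)
      ≤ residVar (C₀ + ε • (C - C₀)) g δ b := by
  have hε' := posSemidef_iff_real.1 (posSemidef_segment h₀ h hε hε1)
  set a := optEst C₀ g δ S with ha
  set z := (C - C₀).mulVec (g - a) with hz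
  have e := residVar_add hε'.1 g δ a (b - a)
  rw [add_sub_cancel] at e
  have hsa := optEst_supp h₀ g hδ.le S
  have hna := optEst_normal h₀ g hδ.le S
  have e1 : (b - a) ⬝ᵥ ((C₀ + ε • (C - C₀)).mulVec (g - a) - δ • a) = ε * ((b - a) ⬝ᵥ z) := by
    have h1 : (C₀ + ε • (C - C₀)).mulVec (g - a) - δ • a
        = (C₀.mulVec (g - a) - δ • a) + ε • z := by
      rw [Matrix.add_mulVec, Matrix.smul_mulVec]; abel
    rw [h1, dotProduct_add, dotProduct_eq_zero_of_supp (S := S)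
      (fun i hi ↦ by simp [ha, hsa i hi, hb i hi]) (fun i hi ↦ by simp [ha, hna i hi])]
    simp
  have e2 : residVar (C₀ + ε • (C - C₀)) g δ a = residVar C₀ g δ a + ε * ((g - a) ⬝ᵥ z) := by
    simp only [residVar, Matrix.add_mulVec, Matrix.smul_mulVec, dotProduct_add, dotProduct_smul,
      smul_eq_mul, hz]
    ring
  have h1 := hε'.2 (b - a)
  have h2 : 0 ≤ δ * (((b - a) - (ε / δ) • z) ⬝ᵥ ((b - a) - (ε / δ) • z)) :=
    mul_nonneg hδ.le (dotProduct_self_star_nonneg _)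
  have h3 : δ * (((b - a) - (ε / δ) • z) ⬝ᵥ ((b - a) - (ε / δ) • z))
      = δ * ((b - a) ⬝ᵥ (b - a)) - 2 * (ε * ((b - a) ⬝ᵥ z)) + ε ^ 2 * ((z ⬝ᵥ z) / δ) := by
    rw [sub_dotProduct, dotProduct_sub (b - a), dotProduct_sub ((ε / δ) • z)]
    simp only [smul_dotProduct, dotProduct_smul, smul_eq_mul, dotProduct_comm z (b - a)]
    field_simp
    ring
  rw [e, e1, e2]
  linarith

/-- On the segment from K₀ to C, admissible by convexity, `φ` majorises the Gaussian value for small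
ε and agrees with it at ε = 0. Minimality of K₀ then makes φ'(0) nonnegative, which is the first
order condition. -/
lemma isStationary_of_forall_le {K K₀ : Matrix ι ι ℝ} {g : ι → ℝ} {parts : Finset (Finset ι)}
    {c d δ : ℝ} (hd : 0 ≤ d) (hδ : 0 < δ) (hK₀ : K₀ ∈ admissible K)
    (hmin : ∀ C ∈ admissible K, gaussVal g parts c d δ K₀ (optEst K₀ g δ)
      ≤ gaussVal g parts c d δ C (optEst C g δ)) :
    IsStationary K K₀ g parts c d δ (optEst K₀ g δ) where
  posSemidef := hK₀.1
  le := hK₀.2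
  supp S _ := optEst_supp hK₀.1 g hδ.le S
  normal S _ := optEst_normal hK₀.1 g hδ.le S
  kkt C hC hKC := by
    set a := optEst K₀ g δ with ha
    set p := g ⬝ᵥ (C - K₀).mulVec g with hp
    set q : Finset ι → ℝ := fun S ↦ (g - a S) ⬝ᵥ (C - K₀).mulVec (g - a S) with hq
    set R : Finset ι → ℝ := fun S ↦ ((C - K₀).mulVec (g - a S) ⬝ᵥ
      (C - K₀).mulVec (g - a S)) / δ with hR
    set v : Finset ι → ℝ := fun S ↦ residVar K₀ g δ (a S) with hv
    have hv1 : ∀ S, 1 ≤ v S := fun S ↦ one_le_residVar hK₀.1 g hδ.le _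
    set σ := 1 + g ⬝ᵥ K₀.mulVec g with hσ
    have hσ0 : 0 < σ := by linarith [(posSemidef_iff_real.1 hK₀.1).2 g]
    set φ : ℝ → ℝ := fun ε ↦ c * Real.log (σ + ε * p)
      - d * ∑ S ∈ parts, Real.log (v S + ε * q S - ε ^ 2 * R S) with hφ
    have hpoly : ∀ S, HasDerivAt (fun ε : ℝ ↦ v S + ε * q S - ε ^ 2 * R S) (q S) 0 := fun S ↦ by
      have := (((hasDerivAt_id (0 : ℝ)).mul_const (q S)).const_add (v S)).sub
        ((hasDerivAt_pow 2 (0 : ℝ)).mul_const (R S))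
      exact this.congr_deriv (by simp)
    have hder : HasDerivAt φ (c * (p / σ) - d * ∑ S ∈ parts, q S / v S) 0 := by
      refine HasDerivAt.sub (HasDerivAt.const_mul c ?_) (HasDerivAt.const_mul d
        (HasDerivAt.fun_sum fun S _ ↦ ?_))
      · have := (((hasDerivAt_id (0 : ℝ)).mul_const p).const_add σ).log (by simpa using hσ0.ne')
        exact this.congr_deriv (by simp)
      · exact ((hpoly S).log (by simpa using (by linarith [hv1 S] : v S ≠ 0))).congr_deriv (by simp)
    have hev : ∀ᶠ ε in nhdsWithin (0 : ℝ) (Set.Ioi 0),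
        ∀ S ∈ parts, 0 < v S + ε * q S - ε ^ 2 * R S := by
      refine (Finset.eventually_all parts).2 fun S _ ↦ ?_
      refine nhdsWithin_le_nhds ((hpoly S).continuousAt.eventually (lt_mem_nhds ?_))
      simpa using by linarith [hv1 S]
    have key := nonneg_of_hasDerivAt_of_le hder ?_
    · have hsum : ∑ S ∈ parts, q S / v S = ∑ S ∈ parts, ((g - a S) ⬝ᵥ C.mulVec (g - a S)) / v S
          - ∑ S ∈ parts, ((g - a S) ⬝ᵥ K₀.mulVec (g - a S)) / v S := by
        rw [← Finset.sum_sub_distrib]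
        refine Finset.sum_congr rfl fun S _ ↦ ?_
        rw [← sub_div, ← dotProduct_sub, ← Matrix.sub_mulVec]
      rw [hsum, hp, Matrix.sub_mulVec, dotProduct_sub, sub_div] at key
      linarith
    · filter_upwards [hev, self_mem_nhdsWithin, nhdsWithin_le_nhds (gt_mem_nhds zero_lt_one)]
        with ε h1 h2 h3
      have hε0 : 0 ≤ ε := (Set.mem_Ioi.1 h2).le
      have hKe : K - (K₀ + ε • (C - K₀)) = (K - K₀) + ε • ((K - C) - (K - K₀)) := by
        rw [sub_sub_sub_cancel_left, ← neg_sub C K₀, smul_neg]; abel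
      have hCe : K₀ + ε • (C - K₀) ∈ admissible K := by
        refine ⟨posSemidef_segment hK₀.1 hC hε0 h3.le, ?_⟩
        rw [hKe]
        exact posSemidef_segment hK₀.2 hKC hε0 h3.le
      have h4 := hmin _ hCe
      have h5 : φ 0 = gaussVal g parts c d δ K₀ a := by simp [hφ, gaussVal, hσ, hv]
      rw [h5]
      refine h4.trans (sub_le_sub (le_of_eq ?_) (mul_le_mul_of_nonneg_left
        (Finset.sum_le_sum fun S hS ↦ Real.log_le_log (h1 S hS) ?_) hd))
      · rw [Matrix.add_mulVec, Matrix.smul_mulVec, dotProduct_add, dotProduct_smul, hσ, hp,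
          smul_eq_mul, add_assoc]
      · exact le_residVar_segment hK₀.1 hC g hδ S hε0 h3.le (optEst_supp hCe.1 g hδ.le S)

lemma residVar_mono {C C' : Matrix ι ι ℝ} (h : (C' - C).PosSemidef) (g : ι → ℝ) {δ δ' : ℝ}
    (hδ : δ ≤ δ') (a : ι → ℝ) : residVar C g δ a ≤ residVar C' g δ' a := by
  have h1 := (posSemidef_iff_real.1 h).2 (g - a)
  rw [Matrix.sub_mulVec, dotProduct_sub] at h1
  have h2 := mul_le_mul_of_nonneg_right hδ (dotProduct_self_star_nonneg a)
  simp only [star_trivial] at h2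
  rw [residVar, residVar]
  linarith

/-- Larger covariances and larger regularisation decrease the Gaussian value, as long as the output
variance is kept. -/
lemma gaussVal_optEst_anti {C C' : Matrix ι ι ℝ} (hC : C.PosSemidef) (hC' : C'.PosSemidef)
    (h : (C' - C).PosSemidef) {g : ι → ℝ} (hg : g ⬝ᵥ C'.mulVec g = g ⬝ᵥ C.mulVec g)
    (parts : Finset (Finset ι)) (c : ℝ) {d δ δ' : ℝ} (hd : 0 ≤ d) (hδ0 : 0 ≤ δ) (hδ : δ ≤ δ') :
    gaussVal g parts c d δ' C' (optEst C' g δ') ≤ gaussVal g parts c d δ C (optEst C g δ) := by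
  rw [gaussVal, gaussVal, hg]
  refine sub_le_sub_left (mul_le_mul_of_nonneg_left (Finset.sum_le_sum fun S _ ↦ ?_) hd) _
  refine Real.log_le_log (by linarith [one_le_residVar hC g hδ0 (optEst C g δ S)]) ?_
  exact (residVar_optEst_le hC g hδ0 S (optEst_supp hC' g (hδ0.trans hδ) S)).trans
    (residVar_mono h g hδ _)

lemma admissible_self {ι : Type*} {K : Matrix ι ι ℝ} (hK : K.PosSemidef) : K ∈ admissible K :=
  ⟨hK, by rw [sub_self]; exact Matrix.PosSemidef.zero⟩

/-- The unregularised problem: an admissible covariance whose Gaussian value is below every upper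
bound of the values at the stationary points of the regularised problems. -/
lemma exists_admissible_le {K : Matrix ι ι ℝ} (hK : K.PosSemidef) (g : ι → ℝ)
    (parts : Finset (Finset ι)) (c : ℝ) {d : ℝ} (hd : 0 ≤ d) :
    ∃ K₀ ∈ admissible K, ∀ L, (∀ δ > 0, ∀ C a, IsStationary K C g parts c d δ a →
      gaussVal g parts c d δ C a ≤ L) → gaussVal g parts c d 0 K₀ (optEst K₀ g 0) ≤ L := by
  classical
  have hcpt := isCompact_admissible K
  have hne : (admissible K).Nonempty := ⟨K, admissible_self hK⟩
  set δ : ℕ → ℝ := fun n ↦ 1 / ((n : ℝ) + 1) with hδ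
  have hδ0 : ∀ n, 0 < δ n := fun n ↦ by simp only [hδ]; positivity
  have hδanti : ∀ n, δ (n + 1) ≤ δ n := fun n ↦ by
    simp only [hδ]
    push_cast
    exact one_div_le_one_div_of_le (by positivity) (by linarith)
  set G : ℕ → Matrix ι ι ℝ → ℝ := fun n C ↦ gaussVal g parts c d (δ n) C (optEst C g (δ n)) with hG
  have hlsc : ∀ n, LowerSemicontinuousOn (G n) (admissible K) := fun n ↦
    lowerSemicontinuousOn_gaussVal g parts c hd (hδ0 n).le K
  choose C hC hmin using fun n ↦ (hlsc n).exists_isMinOn hne hcpt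
  have hmin' : ∀ n, ∀ C' ∈ admissible K, G n (C n) ≤ G n C' := fun n C' hC' ↦ hmin n hC'
  have hst := fun n ↦ isStationary_of_forall_le hd (hδ0 n) (hC n) (hmin' n)
  have hbdd : BddAbove (Set.range fun n ↦ G n (C n)) := by
    refine ⟨gaussVal g parts c d 0 K (optEst K g 0), ?_⟩
    rintro _ ⟨n, rfl⟩
    refine (hmin' n K (admissible_self hK)).trans ?_
    exact gaussVal_optEst_anti hK hK (admissible_self hK).2 rfl parts c hd le_rfl (hδ0 n).le
  set L₀ := ⨆ n, G n (C n) with hL₀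
  -- `G n` grows with n since δ n decreases, so these sublevel sets at a common level are nested;
  -- each contains the minimiser `C n`. A point of the intersection serves all δ n at once.
  set Z : ℕ → Set (Matrix ι ι ℝ) := fun n ↦ {C' ∈ admissible K | G n C' ≤ L₀} with hZ
  have hZcl : ∀ n, IsClosed (Z n) := fun n ↦ by
    have e : Z n = ⋂ a : {a : Finset ι → ι → ℝ // ∀ S, ∀ i ∉ S, a S i = 0},
        {C' ∈ admissible K | gaussVal g parts c d (δ n) C' a.1 ≤ L₀} := by
      ext C'
      simp only [hZ, Set.mem_ofPred_eq, Set.mem_iInter]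
      constructor
      · rintro ⟨h1, h2⟩ a
        exact ⟨h1, (gaussVal_le_optEst g parts c hd (hδ0 n).le h1.1 a.2).trans h2⟩
      · intro h
        have h1 := (h ⟨fun _ ↦ 0, fun _ _ _ ↦ rfl⟩).1
        exact ⟨h1, (h ⟨optEst C' g (δ n), fun S ↦ optEst_supp h1.1 g (hδ0 n).le S⟩).2⟩
    rw [e]
    refine isClosed_iInter fun a ↦ ?_
    have := (continuousOn_gaussVal g parts c d (hδ0 n).le K a.1).preimage_isClosed_of_isClosed
      hcpt.isClosed (isClosed_Iic (a := L₀))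
    exact this
  obtain ⟨K₀, hK₀⟩ := IsCompact.nonempty_iInter_of_sequence_nonempty_isCompact_isClosed Z
    (fun n C' h ↦ ⟨h.1, (gaussVal_optEst_anti h.1.1 h.1.1 (admissible_self h.1.1).2 rfl parts c hd
        (hδ0 (n + 1)).le (hδanti n)).trans h.2⟩)
    (fun n ↦ ⟨C n, hC n, le_ciSup hbdd n⟩)
    (hcpt.of_isClosed_subset (hZcl 0) fun C' h ↦ h.1) hZcl
  rw [Set.mem_iInter] at hK₀
  have hK₀a := (hK₀ 0).1
  refine ⟨K₀, hK₀a, fun L hL ↦ ?_⟩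
  have hL₀L : L₀ ≤ L := ciSup_le fun n ↦ hL _ (hδ0 n) _ _ (hst n)
  refine le_trans ?_ hL₀L
  -- With the estimator frozen at its optimum for δ = 0, only the ridge term varies, so no
  -- continuity of `optEst` in δ is needed.
  have hlim : Filter.Tendsto (fun n ↦ gaussVal g parts c d (δ n) K₀ (optEst K₀ g 0)) Filter.atTop
      (nhds (gaussVal g parts c d 0 K₀ (optEst K₀ g 0))) := by
    have h0 : Filter.Tendsto δ Filter.atTop (nhds 0) := tendsto_one_div_add_atTop_nhds_zero_nat
    have hr : ∀ S, Filter.Tendsto (fun n ↦ residVar K₀ g (δ n) (optEst K₀ g 0 S)) Filter.atTop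
        (nhds (residVar K₀ g 0 (optEst K₀ g 0 S))) := fun S ↦
      tendsto_const_nhds.add (h0.mul_const _)
    exact tendsto_const_nhds.sub ((tendsto_finsetSum _ fun S _ ↦ (hr S).log
      (by linarith [one_le_residVar hK₀a.1 g le_rfl (optEst K₀ g 0 S)])).const_mul d)
  refine le_of_tendsto' hlim fun n ↦ ?_
  exact (gaussVal_le_optEst g parts c hd (hδ0 n).le hK₀a.1
    fun S ↦ optEst_supp hK₀a.1 g le_rfl S).trans (hK₀ n).2

/-- Splitting the second moment matrix into a covariance and a mean without loss. -/
lemma exists_mean_cov {K : Matrix ι ι ℝ} (hK : K.PosSemidef) (g : ι → ℝ)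
    (parts : Finset (Finset ι)) (c : ℝ) {d : ℝ} (hd : 0 ≤ d) :
    ∃ (K₁ : Matrix ι ι ℝ) (m : ι → ℝ), K₁.PosSemidef ∧ (∀ i j, K₁ i j + m i * m j = K i j) ∧
      ∀ L, (∀ δ > 0, ∀ C a, IsStationary K C g parts c d δ a →
        gaussVal g parts c d δ C a ≤ L) → gaussVal g parts c d 0 K₁ (optEst K₁ g 0) ≤ L := by
  obtain ⟨K₀, hK₀, hL⟩ := exists_admissible_le hK g parts c hd
  have hD := posSemidef_iff_real.1 hK₀.2
  set D := K - K₀ with hDdef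
  set y := D.mulVec g with hy
  have hq : 0 ≤ g ⬝ᵥ y := hD.2 g
  -- mmᵀ is the rank one part of D carrying all its variance along g: mmᵀ ⪯ D by Cauchy-Schwarz,
  -- with equality along g. If gᵀDg = 0, the inverse of zero gives m = 0, as it should.
  set m : ι → ℝ := (√(g ⬝ᵥ y))⁻¹ • y with hm
  have hbm : ∀ b, (b ⬝ᵥ m) ^ 2 ≤ b ⬝ᵥ D.mulVec b := fun b ↦ by
    have h1 := sq_dotProduct_mulVec_le hK₀.2 b g
    rw [hm, dotProduct_smul, smul_eq_mul, mul_pow, inv_pow, Real.sq_sqrt hq]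
    by_cases h0 : g ⬝ᵥ y = 0
    · rw [h0, inv_zero, zero_mul]; exact hD.2 b
    · have hq' : 0 < g ⬝ᵥ y := lt_of_le_of_ne hq (Ne.symm h0)
      rw [inv_mul_le_iff₀ hq', mul_comm]
      exact h1
  have hgm : (g ⬝ᵥ m) ^ 2 = g ⬝ᵥ D.mulVec g := by
    rw [hm, dotProduct_smul, smul_eq_mul, mul_pow, inv_pow, Real.sq_sqrt hq, ← hy]
    by_cases h0 : g ⬝ᵥ y = 0
    · rw [h0]; simp
    · field_simp
  set K₁ := K - Matrix.vecMulVec m m with hK₁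
  have hquad : ∀ b, b ⬝ᵥ (K₁ - K₀).mulVec b = b ⬝ᵥ D.mulVec b - (b ⬝ᵥ m) ^ 2 := fun b ↦ by
    have : K₁ - K₀ = D - Matrix.vecMulVec m m := by rw [hK₁, hDdef]; abel
    rw [this, Matrix.sub_mulVec, dotProduct_sub, Matrix.vecMulVec_mulVec]
    simp [dotProduct_comm m b, sq]
  have hle : (K₁ - K₀).PosSemidef := posSemidef_iff_real.2 ⟨fun i j ↦ by
    have h1 := hD.1 i j
    simp only [hDdef, Matrix.sub_apply] at h1
    simp only [hK₁, Matrix.sub_apply, Matrix.vecMulVec_apply, mul_comm (m i)]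
    linarith, fun b ↦ by rw [hquad]; linarith [hbm b]⟩
  have hK₁p : K₁.PosSemidef := by
    have := hle.add hK₀.1
    rwa [sub_add_cancel] at this
  refine ⟨K₁, m, hK₁p, fun i j ↦ by simp [hK₁, Matrix.vecMulVec_apply], fun L h ↦ ?_⟩
  refine (gaussVal_optEst_anti hK₀.1 hK₁p hle ?_ parts c hd le_rfl le_rfl).trans (hL L h)
  have h1 := hquad g
  rw [← hgm, sub_self, Matrix.sub_mulVec, dotProduct_sub] at h1
  linarith

end Minimiser

/-! ### Gaussian inputs -/

section GaussianInput

/-- Given V the output is normal with mean b(V) and variance q + 1. Exhibiting this conditional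
density suffices by `neg_integral_log_le_condEnt`; the disintegration kernel need not be identified.
-/
lemma le_condEnt_of_indepFun {Ω γ : Type*} [MeasurableSpace Ω] [MeasurableSpace γ] {P : Measure Ω}
    [IsProbabilityMeasure P] {V : Ω → γ} {W : Ω → ℝ} (hV : Measurable V) (hW : Measurable W)
    (hind : IndepFun V W P) {q : ℝ} (hq : 0 ≤ q) (hWq : P.map W = gaussNoise q) {b : γ → ℝ}
    (hb : Measurable b) (hb2 : MemLp (fun ω ↦ b (V ω)) 2 P) :
    1 / 2 * Real.log (2 * Real.pi * (q + 1)) + 1 / 2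
      ≤ condEnt (P.map fun ω ↦ (V ω, b (V ω) + W ω)) 1 := by
  have hprob : IsProbabilityMeasure (P.map fun ω ↦ (V ω, b (V ω) + W ω)) :=
    Measure.isProbabilityMeasure_map (by fun_prop)
  have hVprob : IsProbabilityMeasure (P.map V) := Measure.isProbabilityMeasure_map (by fun_prop)
  set θ := P.map fun ω ↦ (V ω, b (V ω) + W ω) with hθ
  have hq1 : 0 < q + 1 := by positivity
  have hW2 : MemLp W 2 P := by
    have := memLp_id_gaussNoise q
    rw [← hWq, memLp_map_measure_iff (by fun_prop) (by fun_prop)] at this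
    exact this
  have hθ2 : MemLp (fun w : γ × ℝ ↦ w.2) 2 θ := by
    rw [hθ, memLp_map_measure_iff (by fun_prop) (by fun_prop)]
    exact hb2.add hW2
  have hres : MemLp (fun w : γ × ℝ ↦ w.2 - b w.1) 2 θ := by
    rw [hθ, memLp_map_measure_iff (by fun_prop) (by fun_prop)]
    refine hW2.ae_eq (Filter.Eventually.of_forall fun ω ↦ ?_)
    simp
  have hresq : ∫ w, (w.2 - b w.1) ^ 2 ∂θ = q := by
    rw [hθ, integral_map (by fun_prop) (by fun_prop)]
    simp only [add_sub_cancel_left]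
    rw [← integral_sq_gaussNoise hq, ← hWq, integral_map (by fun_prop) (by fun_prop)]
  have hjoint : P.map (fun ω ↦ (V ω, W ω)) = (P.map V).prod (gaussNoise q) := by
    rw [(indepFun_iff_map_prod_eq_prod_map_map (by fun_prop) (by fun_prop)).1 hind, hWq]
  have hθ' : θ = ((P.map V).prod (gaussNoise q)).map fun w ↦ (w.1, b w.1 + w.2) := by
    rw [← hjoint, Measure.map_map (by fun_prop) (by fun_prop)]
    rfl
  have hfst : θ.fst = P.map V := by
    rw [hθ, Measure.fst, Measure.map_map measurable_fst (by fun_prop)]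
    rfl
  set f : γ × ℝ → ℝ := fun z ↦ gaussDensity (q + 1) (z.2 - b z.1) with hf
  have hfm : Measurable f := by rw [hf]; fun_prop
  have hfd : noisyLaw θ 1 = (θ.fst.prod volume).withDensity fun z ↦ ENNReal.ofReal (f z) := by
    refine Measure.ext_of_lintegral _ fun F hF ↦ ?_
    have hF1 : Measurable fun w : γ × ℝ ↦ ∫⁻ n, F (w.1, w.2 + n) ∂gaussNoise 1 :=
      Measurable.lintegral_prod_right' (f := fun x : (γ × ℝ) × ℝ ↦ F (x.1.1, x.1.2 + x.2))
        (by fun_prop)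
    rw [lintegral_withDensity_eq_lintegral_mul _ (by fun_prop) hF, hfst,
      lintegral_prod _ (by fun_prop), noisyLaw, lintegral_map hF (by fun_prop),
      lintegral_prod _ (by fun_prop), hθ', lintegral_map hF1 (by fun_prop),
      lintegral_prod _ (by
        exact (hF1.comp (f := fun w : γ × ℝ ↦ (w.1, b w.1 + w.2)) (by fun_prop)).aemeasurable)]
    refine lintegral_congr fun v ↦ ?_
    have e := lintegral_gaussNoise_add hq zero_le_one (F := fun z ↦ F (v, b v + z)) (by fun_prop)
    simp_rw [add_assoc]
    rw [e, lintegral_gaussNoise hq1 (by fun_prop), ← lintegral_sub_right_eq_self _ (b v)]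
    refine lintegral_congr fun y ↦ ?_
    simp [hf]
  have hsum : MemLp (fun w : (γ × ℝ) × ℝ ↦ (w.1.2 - b w.1.1) + w.2) 2 (θ.prod (gaussNoise 1)) :=
    (hres.comp_fst _).add ((memLp_id_gaussNoise 1).comp_snd _)
  have e1 : ∀ w : (γ × ℝ) × ℝ, Real.log (f (w.1.1, w.1.2 + w.2))
      = -(1 / 2 * Real.log (2 * Real.pi * (q + 1)))
        - ((w.1.2 - b w.1.1) + w.2) ^ 2 / (2 * (q + 1)) := fun w ↦ by
    rw [hf, log_gaussDensity hq1]
    ring_nf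
  have hfi : Integrable (fun z ↦ Real.log (f z)) (noisyLaw θ 1) := by
    rw [noisyLaw, integrable_map_measure hfm.log.aestronglyMeasurable (by fun_prop)]
    refine ((integrable_const _).sub (hsum.integrable_sq.div_const _)).congr
      (Filter.Eventually.of_forall fun w ↦ (e1 w).symm)
  refine le_trans (le_of_eq ?_) (neg_integral_log_le_condEnt one_pos hθ2 hfm
    (fun z ↦ gaussDensity_pos hq1 _) hfd hfi)
  rw [integral_noisyLaw (by fun_prop)]
  simp_rw [e1]
  rw [integral_sub (integrable_const _) (hsum.integrable_sq.div_const _), integral_div,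
    integral_add_gaussNoise_sq hres zero_le_one, hresq]
  simp
  field_simp
  ring

variable {ι : Type*} [Fintype ι]

/-- The linear form with coefficients `w`. -/
def dotForm (w : ι → ℝ) : (ι → ℝ) →L[ℝ] ℝ := ∑ i, w i • ContinuousLinearMap.proj i

lemma dotForm_apply (w x : ι → ℝ) : dotForm w x = w ⬝ᵥ x := by
  simp [dotForm, dotProduct]

/-- Existence of a Gaussian law with given mean and covariance. -/
lemma exists_isGaussian [DecidableEq ι] {C : Matrix ι ι ℝ} (hC : C.PosSemidef) (m : ι → ℝ) :
    ∃ (μ : Measure (ι → ℝ)) (_ : IsGaussian μ), (∀ i, ∫ x, x i ∂μ = m i) ∧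
      ∀ i j, ∫ x, x i * x j ∂μ = C i j + m i * m j := by
  set P := multivariateGaussian (WithLp.toLp 2 m) C with hP
  set L := PiLp.continuousLinearEquiv 2 ℝ (fun _ : ι ↦ ℝ)
  have hLm : Measurable L := L.continuous.measurable
  have hcoord : ∀ i, MemLp (fun x : EuclideanSpace ℝ ι ↦ x i) 2 P := fun i ↦ by
    have := (IsGaussian.memLp_dual P (EuclideanSpace.proj i) 2 (by simp))
    exact this
  have hmean : ∀ i, ∫ x, x i ∂P = m i := fun i ↦ by
    have h1 := ContinuousLinearMap.integral_comp_comm (EuclideanSpace.proj (𝕜 := ℝ) i)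
      (IsGaussian.integrable_fun_id (μ := P))
    rw [integral_id_multivariateGaussian] at h1
    exact h1
  refine ⟨P.map L, inferInstance, fun i ↦ ?_, fun i j ↦ ?_⟩
  · rw [integral_map hLm.aemeasurable
      (Measurable.aestronglyMeasurable (f := fun x : ι → ℝ ↦ x i) (by fun_prop))]
    exact hmean i
  · rw [integral_map hLm.aemeasurable
      (Measurable.aestronglyMeasurable (f := fun x : ι → ℝ ↦ x i * x j) (by fun_prop))]
    have h1 := covariance_eval_multivariateGaussian (μ := WithLp.toLp 2 m) hC i j
    rw [covariance_eq_sub (hcoord i) (hcoord j), hmean, hmean] at h1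
    rw [← h1]
    simp [L]

variable {μ : Measure (ι → ℝ)} [IsGaussian μ] {C : Matrix ι ι ℝ} {m : ι → ℝ}

lemma memLp_eval_of_isGaussian (i : ι) : MemLp (fun x : ι → ℝ ↦ x i) 2 μ :=
  IsGaussian.memLp_dual μ (ContinuousLinearMap.proj i) 2 (by simp)

lemma integral_dotProduct_of_mean (hm : ∀ i, ∫ x, x i ∂μ = m i) (w : ι → ℝ) :
    ∫ x, w ⬝ᵥ x ∂μ = w ⬝ᵥ m := by
  simp only [dotProduct]
  rw [integral_finsetSum _ fun i _ ↦
    ((memLp_eval_of_isGaussian i).integrable one_le_two).const_mul (w i)]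
  simp_rw [integral_const_mul, hm]

lemma integral_centred_mul (hm : ∀ i, ∫ x, x i ∂μ = m i)
    (hC : ∀ i j, ∫ x, x i * x j ∂μ = C i j + m i * m j) (b c : ι → ℝ) :
    ∫ x, (b ⬝ᵥ (x - m)) * (c ⬝ᵥ (x - m)) ∂μ = b ⬝ᵥ C.mulVec c := by
  have h2 : ∀ i, MemLp (fun x : ι → ℝ ↦ (x - m) i) 2 μ := fun i ↦
    (memLp_eval_of_isGaussian i).sub (memLp_const _)
  rw [integral_dotProduct_mul (X := fun x ↦ x - m) h2]
  congr 2
  ext i j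
  have i1 : Integrable (fun x : ι → ℝ ↦ x i * x j) μ :=
    (memLp_eval_of_isGaussian i).integrable_mul (memLp_eval_of_isGaussian j)
  have i2 := ((memLp_eval_of_isGaussian (μ := μ) i).integrable one_le_two).mul_const (m j)
  have i3 := ((memLp_eval_of_isGaussian (μ := μ) j).integrable one_le_two).const_mul (m i)
  have e : ∀ x : ι → ℝ, (x - m) i * (x - m) j = x i * x j - x i * m j - (m i * x j - m i * m j) :=
    fun x ↦ by simp; ring
  simp_rw [Matrix.of_apply, e]
  rw [integral_sub (by exact i1.sub i2) (by exact i3.sub (integrable_const _)), integral_sub i1 i2,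
    integral_sub i3 (integrable_const _), integral_mul_const, integral_const_mul, hm, hm, hC]
  simp

/-- The conditional entropy of the output for Gaussian inputs. -/
lemma condEnt_gaussian (hm : ∀ i, ∫ x, x i ∂μ = m i)
    (hC : ∀ i j, ∫ x, x i * x j ∂μ = C i j + m i * m j) (hC0 : C.PosSemidef) {g a : ι → ℝ}
    {S : Finset ι} (hn : ∀ i ∈ S, C.mulVec (g - a) i = 0)
    {γ : Type*} [MeasurableSpace γ] {V : (S → ℝ) → γ} (hV : Measurable V) {b : γ → ℝ}
    (hb : Measurable b) (hbV : ∀ x : ι → ℝ, b (V fun j ↦ x j) = a ⬝ᵥ x) :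
    condEnt (μ.map fun x ↦ (V fun j ↦ x j, g ⬝ᵥ x)) 1
      = 1 / 2 * Real.log (2 * Real.pi * residVar C g 0 a) + 1 / 2 := by
  classical
  set w := g - a with hw
  have hq : 0 ≤ w ⬝ᵥ C.mulVec w := (posSemidef_iff_real.1 hC0).2 w
  set q := w ⬝ᵥ C.mulVec w with hqd
  have hv : residVar C g 0 a = q + 1 := by rw [residVar]; ring
  have hX2 : ∀ i, MemLp (fun x : ι → ℝ ↦ x i) 2 μ := memLp_eval_of_isGaussian
  have hga : ∀ x, g ⬝ᵥ x = b (V fun j ↦ x j) + w ⬝ᵥ x := fun x ↦ by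
    rw [hbV, hw, sub_dotProduct]; ring
  have hmeanw := integral_dotProduct_of_mean hm w
  have hvar : ∫ x, (w ⬝ᵥ x - w ⬝ᵥ m) ^ 2 ∂μ = q := by
    rw [hqd, ← integral_centred_mul hm hC]
    simp_rw [dotProduct_sub, sq]
  have hVm : Measurable fun x : ι → ℝ ↦ V fun j ↦ x j := by fun_prop
  rw [hv]
  refine le_antisymm ?_ ?_
  · have hprob : IsProbabilityMeasure (μ.map fun x ↦ (V fun j ↦ x j, g ⬝ᵥ x)) :=
      Measure.isProbabilityMeasure_map (by fun_prop)
    have e : ∀ x : ι → ℝ, g ⬝ᵥ x - (b (V fun j ↦ x j) + w ⬝ᵥ m) = w ⬝ᵥ x - w ⬝ᵥ m := fun x ↦ by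
      rw [hga x]; ring
    refine condEnt_le_log one_pos ?_ (b := fun y ↦ b y + w ⬝ᵥ m) (by fun_prop) ?_ (le_of_eq ?_)
    · rw [memLp_map_measure_iff (by fun_prop) (by fun_prop)]
      exact memLp_dotProduct hX2 g
    · rw [memLp_map_measure_iff (by fun_prop) (by fun_prop)]
      exact MemLp.ae_eq (Filter.Eventually.of_forall fun x ↦ (e x).symm)
        ((memLp_dotProduct hX2 w).sub (memLp_const (w ⬝ᵥ m)))
    · rw [integral_map (by fun_prop) (by fun_prop)]
      simp_rw [e]
      rw [hvar]
  · have hG : HasGaussianLaw (fun x : ι → ℝ ↦ ((fun j : S ↦ x j), fun _ : Unit ↦ w ⬝ᵥ x)) μ := by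
      have := (IsGaussian.hasGaussianLaw_id (μ := μ)).map_fun
        ((ContinuousLinearMap.pi fun j : S ↦ ContinuousLinearMap.proj (j : ι)).prod
          (ContinuousLinearMap.pi fun _ : Unit ↦ dotForm w))
      have e : (fun x : ι → ℝ ↦ ((fun j : S ↦ x j), fun _ : Unit ↦ w ⬝ᵥ x)) = fun x ↦
          ((ContinuousLinearMap.pi fun j : S ↦ ContinuousLinearMap.proj (j : ι)).prod
            (ContinuousLinearMap.pi fun _ : Unit ↦ dotForm w)) (id x) := by
        ext x <;> simp [dotForm_apply]
      rw [e]
      exact this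
    have hGw : HasGaussianLaw (fun x : ι → ℝ ↦ w ⬝ᵥ x) μ := hG.snd.eval ()
    have hcov : ∀ (i : S) (_ : Unit), cov[fun x : ι → ℝ ↦ x i, fun x ↦ w ⬝ᵥ x; μ] = 0 := by
      intro i _
      rw [covariance, hmeanw, hm]
      have h1 := integral_centred_mul hm hC (Pi.single (i : ι) 1) w
      rw [single_one_dotProduct, hn i i.2] at h1
      rw [← h1]
      congr 1 with x
      rw [single_one_dotProduct, dotProduct_sub]
      rfl
    have hind0 := hG.indepFun_of_covariance_eval hcov
    have hind : IndepFun (fun x : ι → ℝ ↦ V fun j ↦ x j) (fun x ↦ w ⬝ᵥ x - w ⬝ᵥ m) μ :=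
      hind0.comp (φ := V) (ψ := fun y : Unit → ℝ ↦ y () - w ⬝ᵥ m) hV (by fun_prop)
    have hlaw : μ.map (fun x ↦ w ⬝ᵥ x - w ⬝ᵥ m) = gaussNoise q := by
      have h1 := hGw.map_eq_gaussianReal
      rw [hmeanw, variance_eq_integral (by fun_prop), hmeanw, hvar] at h1
      have h2 := gaussianReal_map_sub_const (μ := w ⬝ᵥ m) (v := q.toNNReal) (w ⬝ᵥ m)
      rw [← h1, Measure.map_map (by fun_prop) (by fun_prop), sub_self] at h2
      exact h2
    have key := le_condEnt_of_indepFun hVm (by fun_prop) hind hq hlaw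
      (b := fun y ↦ b y + w ⬝ᵥ m) (by fun_prop) (by
        simp_rw [hbV]
        exact (memLp_dotProduct hX2 a).add (memLp_const _))
    refine key.trans_eq ?_
    congr 2
    ext x
    · rfl
    · simp only
      rw [hga x]; ring

end GaussianInput

/-! ### The Lagrangian in terms of entropies -/

section Lagrangian

variable {J : ℕ} {τ : Type*} [MeasurableSpace τ]

lemma toReal_condMutualInfo_channel {α γ : Type*} [MeasurableSpace α] [StandardBorelSpace α]
    [Nonempty α] [MeasurableSpace γ] (g : Fin J → ℝ) {ρ : Measure (τ × (Fin J → ℝ))}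
    [IsProbabilityMeasure ρ] (hX2 : ∀ i, MemLp (fun ω : τ × (Fin J → ℝ) ↦ ω.2 i) 2 ρ)
    {U : τ × (Fin J → ℝ) → α} {W : τ × (Fin J → ℝ) → γ} (hU : Measurable U) (hW : Measurable W)
    {D : γ × α → ℝ} (hD : Measurable D) (hDg : ∀ ω, D (W ω, U ω) = g ⬝ᵥ ω.2) :
    (condMutualInfo (fun ω ↦ U ω.1) (outputY g) (fun ω ↦ W ω.1) (channelLaw ρ)).toReal
      = condEnt (ρ.map fun ω ↦ (W ω, g ⬝ᵥ ω.2)) 1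
        - (1 / 2 * Real.log (2 * Real.pi * 1) + 1 / 2) := by
  have hprob : IsProbabilityMeasure (ρ.map fun ω ↦ (W ω, g ⬝ᵥ ω.2)) :=
    Measure.isProbabilityMeasure_map (by fun_prop)
  have hY : Measurable (outputY g : (τ × (Fin J → ℝ)) × ℝ → ℝ) := by
    unfold outputY; fun_prop
  have hg1 : gaussianReal 0 1 = gaussNoise 1 := by simp [gaussNoise]
  have hWU : (channelLaw ρ).map (fun ω ↦ (W ω.1, U ω.1)) = ρ.map fun ω ↦ (W ω, U ω) := by
    have h1 : (channelLaw ρ).map Prod.fst = ρ := Measure.fst_prod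
    conv_rhs => rw [← h1]
    rw [Measure.map_map (by fun_prop) measurable_fst]
    rfl
  refine toReal_condMutualInfo (by fun_prop) hY (by fun_prop) hD ?_ ?_ ?_
  · rw [hWU]
    have h2 : (ρ.map fun ω ↦ (W ω, U ω)).prod (gaussNoise 1)
        = (ρ.prod (gaussNoise 1)).map (Prod.map (fun ω ↦ (W ω, U ω)) id) := by
      rw [← Measure.map_prod_map _ _ (by fun_prop) (by fun_prop), Measure.map_id]
    rw [h2, Measure.map_map (by fun_prop) (by fun_prop), channelLaw, hg1]
    congr 1
    ext ω
    · rfl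
    · rfl
    · simp only [Function.comp_apply, Prod.map, hDg, id]
      rfl
  · rw [hWU, Measure.map_map (by fun_prop) (by fun_prop)]
    congr 1
    ext ω
    · rfl
    · exact hDg ω
  · rw [memLp_map_measure_iff (by fun_prop) (by fun_prop)]
    exact memLp_dotProduct hX2 g

/-- In each information the two input arguments together determine the signal g ⬝ᵥ X, so that only
the entropy of the noise is subtracted. -/
lemma lagrangian_eq (g : Fin J → ℝ) (Q : Finpartition (Finset.univ : Finset (Fin J))) (lam : ℝ)
    (ρ : Measure (τ × (Fin J → ℝ))) [IsProbabilityMeasure ρ]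
    (hX2 : ∀ i, MemLp (fun ω : τ × (Fin J → ℝ) ↦ ω.2 i) 2 ρ) :
    lagrangian g Q lam ρ = (lam - 1) * (condEnt (ρ.map fun ω ↦ (ω.1, g ⬝ᵥ ω.2)) 1
        - (1 / 2 * Real.log (2 * Real.pi * 1) + 1 / 2))
      - lam / ((Q.parts.card : ℝ) - 1) * ∑ S ∈ Q.parts,
        (condEnt (ρ.map fun ω ↦ (((fun j : S ↦ ω.2 j), ω.1), g ⬝ᵥ ω.2)) 1
          - (1 / 2 * Real.log (2 * Real.pi * 1) + 1 / 2)) := by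
  have h1 := toReal_condMutualInfo_channel g hX2 (U := fun ω ↦ ω.2) (W := fun ω ↦ ω.1)
    (by fun_prop) (by fun_prop) (D := fun y ↦ g ⬝ᵥ y.2) (by fun_prop) (fun ω ↦ rfl)
  have h2 : ∀ S : Finset (Fin J), _ := fun S ↦ toReal_condMutualInfo_channel g hX2
    (U := fun ω (j : (Sᶜ : Finset (Fin J))) ↦ ω.2 j) (W := fun ω ↦ ((fun j : S ↦ ω.2 j), ω.1))
    (by fun_prop) (by fun_prop)
    (D := fun y ↦ (fun j : S ↦ g j) ⬝ᵥ y.1.1 + (fun j : (Sᶜ : Finset (Fin J)) ↦ g j) ⬝ᵥ y.2)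
    (by fun_prop) (fun ω ↦ by
      simp only [dotProduct]
      rw [Finset.sum_coe_sort S (fun j ↦ g j * ω.2 j),
        Finset.sum_coe_sort Sᶜ (fun j ↦ g j * ω.2 j), Finset.sum_add_sum_compl])
  rw [lagrangian]
  congr 2
  refine Finset.sum_congr rfl fun S _ ↦ ?_
  exact h2 S

/-- The Lagrangian of a Gaussian input. -/
lemma lagrangianConst_gaussian (g : Fin J → ℝ) (Q : Finpartition (Finset.univ : Finset (Fin J)))
    (lam : ℝ) {μ : Measure (Fin J → ℝ)} [IsGaussian μ] {C : Matrix (Fin J) (Fin J) ℝ}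
    {m : Fin J → ℝ} (hm : ∀ i, ∫ x, x i ∂μ = m i)
    (hC : ∀ i j, ∫ x, x i * x j ∂μ = C i j + m i * m j) (hC0 : C.PosSemidef) :
    lagrangianConst g Q lam μ = 1 / 2 * gaussVal g Q.parts (lam - 1)
      (lam / ((Q.parts.card : ℝ) - 1)) 0 C (optEst C g 0) := by
  have hρ : (Measure.dirac ()).prod μ = μ.map (Prod.mk ()) := Measure.dirac_prod _
  have hX2 : ∀ i, MemLp (fun ω : Unit × (Fin J → ℝ) ↦ ω.2 i) 2 ((Measure.dirac ()).prod μ) :=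
    fun i ↦ (memLp_eval_of_isGaussian i).comp_snd _
  have hY : condEnt (((Measure.dirac ()).prod μ).map fun ω ↦ (ω.1, g ⬝ᵥ ω.2)) 1
      = 1 / 2 * Real.log (2 * Real.pi * (1 + g ⬝ᵥ C.mulVec g)) + 1 / 2 := by
    have h1 := condEnt_gaussian hm hC hC0 (g := g) (a := 0) (S := ∅) (by simp) (V := fun _ ↦ ())
      (by fun_prop) (b := fun _ ↦ 0) (by fun_prop) (fun x ↦ by simp)
    rw [residVar] at h1
    simp only [sub_zero, zero_mul, add_zero] at h1
    rw [← h1]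
    congr 1
    rw [hρ, Measure.map_map (by fun_prop) (by fun_prop)]
    rfl
  have hS : ∀ S : Finset (Fin J), condEnt (((Measure.dirac ()).prod μ).map
      fun ω ↦ (((fun j : S ↦ ω.2 j), ω.1), g ⬝ᵥ ω.2)) 1
      = 1 / 2 * Real.log (2 * Real.pi * residVar C g 0 (optEst C g 0 S)) + 1 / 2 := fun S ↦ by
    have h1 := condEnt_gaussian hm hC hC0 (g := g) (a := optEst C g 0 S) (S := S)
      (fun i hi ↦ by rw [optEst_normal hC0 g le_rfl S i hi, zero_mul]) (V := fun x ↦ (x, ()))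
      (by fun_prop) (b := fun y ↦ (fun j : S ↦ optEst C g 0 S j) ⬝ᵥ y.1) (by fun_prop)
      (fun x ↦ sum_subtype_of_supp (optEst_supp hC0 g le_rfl S) x)
    rw [← h1]
    congr 1
    rw [hρ, Measure.map_map (by fun_prop) (by fun_prop)]
    rfl
  have hlog : ∀ v : ℝ, 1 ≤ v → Real.log (2 * Real.pi * v)
      = Real.log (2 * Real.pi * 1) + Real.log v := fun v hv ↦ by
    rw [mul_one, Real.log_mul (by positivity) (by positivity)]
  rw [lagrangianConst, lagrangian_eq g Q lam _ hX2, hY, gaussVal]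
  simp_rw [hS, hlog _ (one_le_residVar hC0 g le_rfl (optEst C g 0 _))]
  rw [hlog _ (by linarith [(posSemidef_iff_real.1 hC0).2 g])]
  have e : ∀ S : Finset (Fin J), 1 / 2 * (Real.log (2 * Real.pi * 1)
      + Real.log (residVar C g 0 (optEst C g 0 S))) + 1 / 2
      - (1 / 2 * Real.log (2 * Real.pi * 1) + 1 / 2)
      = 1 / 2 * Real.log (residVar C g 0 (optEst C g 0 S)) := fun S ↦ by ring
  simp_rw [e, ← Finset.mul_sum]
  ring

/-- Max-entropy bound for the Lagrangian when `λ ≤ 1`. -/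
lemma gaussVal_le_lagrangian_of_le_one (g : Fin J → ℝ)
    (Q : Finpartition (Finset.univ : Finset (Fin J))) (hQ : 2 ≤ Q.parts.card) {lam : ℝ}
    (hlam : 0 ≤ lam) (hlam1 : lam ≤ 1) {K : Matrix (Fin J) (Fin J) ℝ} (hK : K.PosSemidef)
    {ρ : Measure (τ × (Fin J → ℝ))} [IsProbabilityMeasure ρ]
    (hX2 : ∀ i, MemLp (fun ω : τ × (Fin J → ℝ) ↦ ω.2 i) 2 ρ)
    (hXK : ∀ i j, ∫ ω, ω.2 i * ω.2 j ∂ρ = K i j) :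
    1 / 2 * gaussVal g Q.parts (lam - 1) (lam / ((Q.parts.card : ℝ) - 1)) 0 K (optEst K g 0)
      ≤ lagrangian g Q lam ρ := by
  have hcard : (2 : ℝ) ≤ Q.parts.card := by exact_mod_cast hQ
  have hd : 0 ≤ lam / ((Q.parts.card : ℝ) - 1) := div_nonneg hlam (by linarith)
  have hKb : ∀ b : Fin J → ℝ, ∫ ω, (b ⬝ᵥ ω.2) ^ 2 ∂ρ = b ⬝ᵥ K.mulVec b := fun b ↦ by
    have := integral_dotProduct_mul (X := fun ω : τ × (Fin J → ℝ) ↦ ω.2) hX2 b b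
    simp_rw [← sq] at this
    rw [this]
    congr 2
    ext i j
    exact hXK i j
  have hY : condEnt (ρ.map fun ω ↦ (ω.1, g ⬝ᵥ ω.2)) 1
      ≤ 1 / 2 * Real.log (2 * Real.pi * (1 + g ⬝ᵥ K.mulVec g)) + 1 / 2 := by
    have : IsProbabilityMeasure (ρ.map fun ω ↦ (ω.1, g ⬝ᵥ ω.2)) :=
      Measure.isProbabilityMeasure_map (by fun_prop)
    have h2 : MemLp (fun w : τ × ℝ ↦ w.2) 2 (ρ.map fun ω ↦ (ω.1, g ⬝ᵥ ω.2)) := by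
      rw [memLp_map_measure_iff (by fun_prop) (by fun_prop)]
      exact memLp_dotProduct hX2 g
    refine condEnt_le_log one_pos h2 (b := fun _ ↦ 0) (by fun_prop) (by simpa using h2) (le_of_eq ?_)
    rw [integral_map (by fun_prop) (by fun_prop)]
    simp only [sub_zero]
    rw [hKb]
    ring
  have hS : ∀ S : Finset (Fin J), condEnt (ρ.map fun ω ↦ (((fun j : S ↦ ω.2 j), ω.1), g ⬝ᵥ ω.2)) 1
      ≤ 1 / 2 * Real.log (2 * Real.pi * residVar K g 0 (optEst K g 0 S)) + 1 / 2 := fun S ↦ by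
    have : IsProbabilityMeasure (ρ.map fun ω ↦ (((fun j : S ↦ ω.2 j), ω.1), g ⬝ᵥ ω.2)) :=
      Measure.isProbabilityMeasure_map (by fun_prop)
    have e : ∀ ω : τ × (Fin J → ℝ), g ⬝ᵥ ω.2 - (fun j : S ↦ optEst K g 0 S j) ⬝ᵥ (fun j : S ↦ ω.2 j)
        = (g - optEst K g 0 S) ⬝ᵥ ω.2 := fun ω ↦ by
      rw [sum_subtype_of_supp (optEst_supp hK g le_rfl S), sub_dotProduct]
    refine condEnt_le_log one_pos ?_ (b := fun y ↦ (fun j : S ↦ optEst K g 0 S j) ⬝ᵥ y.1)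
      (by fun_prop) ?_ (le_of_eq ?_)
    · rw [memLp_map_measure_iff (by fun_prop) (by fun_prop)]
      exact memLp_dotProduct hX2 g
    · rw [memLp_map_measure_iff (by fun_prop) (by fun_prop)]
      exact MemLp.ae_eq (Filter.Eventually.of_forall fun ω ↦ (e ω).symm)
        (memLp_dotProduct hX2 (g - optEst K g 0 S))
    · rw [integral_map (by fun_prop) (by fun_prop)]
      simp_rw [e]
      rw [hKb, residVar]
      ring
  have hlog : ∀ v : ℝ, 1 ≤ v → Real.log (2 * Real.pi * v)
      = Real.log (2 * Real.pi * 1) + Real.log v := fun v hv ↦ by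
    rw [mul_one, Real.log_mul (by positivity) (by positivity)]
  rw [hlog _ (by linarith [(posSemidef_iff_real.1 hK).2 g])] at hY
  simp_rw [hlog _ (one_le_residVar hK g le_rfl (optEst K g 0 _))] at hS
  rw [lagrangian_eq g Q lam ρ hX2, gaussVal, mul_sub]
  -- As λ - 1 ≤ 0 and -λ/(M - 1) ≤ 0, upper bounds for the entropies are lower bounds for both
  -- terms.
  refine sub_le_sub ?_ ?_
  · nlinarith
  · rw [mul_left_comm]
    refine mul_le_mul_of_nonneg_left ?_ hd
    rw [Finset.mul_sum]
    exact Finset.sum_le_sum fun S _ ↦ by linarith [hS S]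

/-- Every stationary point of a regularised Gaussian problem gives a lower bound for the Lagrangian
when `1 ≤ λ`. -/
lemma gaussVal_le_lagrangian_of_one_le (g : Fin J → ℝ)
    (Q : Finpartition (Finset.univ : Finset (Fin J))) (hQ : 2 ≤ Q.parts.card) {lam : ℝ}
    (hlam1 : 1 ≤ lam) {K C : Matrix (Fin J) (Fin J) ℝ} {δ : ℝ} (hδ : 0 ≤ δ)
    {a : Finset (Fin J) → Fin J → ℝ}
    (h : IsStationary K C g Q.parts (lam - 1) (lam / ((Q.parts.card : ℝ) - 1)) δ a)
    {ρ : Measure (τ × (Fin J → ℝ))} [IsProbabilityMeasure ρ]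
    (hX2 : ∀ i, MemLp (fun ω : τ × (Fin J → ℝ) ↦ ω.2 i) 2 ρ)
    (hXK : ∀ i j, ∫ ω, ω.2 i * ω.2 j ∂ρ = K i j) :
    gaussVal g Q.parts (lam - 1) (lam / ((Q.parts.card : ℝ) - 1)) δ C a
      ≤ 2 * lagrangian g Q lam ρ := by
  have hcard : (2 : ℝ) ≤ Q.parts.card := by exact_mod_cast hQ
  have hd : 0 ≤ lam / ((Q.parts.card : ℝ) - 1) := div_nonneg (by linarith) (by linarith)
  have key := sum_condEnt_le (T := fun ω : τ × (Fin J → ℝ) ↦ ω.1)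
    (X := fun ω : τ × (Fin J → ℝ) ↦ ω.2) measurable_fst measurable_snd hX2 hXK h hδ
    (by linarith) hd
  have hlog : ∀ v : ℝ, 1 ≤ v → Real.log (2 * Real.pi * v)
      = Real.log (2 * Real.pi * 1) + Real.log v := fun v hv ↦ by
    rw [mul_one, Real.log_mul (by positivity) (by positivity)]
  simp_rw [hlog _ (one_le_residVar h.posSemidef g hδ (a _))] at key
  rw [hlog (1 + g ⬝ᵥ C.mulVec g) (by linarith [(posSemidef_iff_real.1 h.posSemidef).2 g])] at key
  rw [lagrangian_eq g Q lam ρ hX2, gaussVal]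
  simp only [Finset.sum_sub_distrib, Finset.sum_add_distrib, ← Finset.mul_sum, mul_add,
    Finset.sum_const, nsmul_eq_mul] at key ⊢
  linarith

/-- The bound holds for every joint law of (T, X) with second moment K, so it passes through both
infima. Only for λ ≥ 1 may a nonzero mean be required. -/
lemma exists_gaussian_optimum (g : Fin J → ℝ) (Q : Finpartition (Finset.univ : Finset (Fin J)))
    (hQ : 2 ≤ Q.parts.card) {lam : ℝ} (hlam : 0 ≤ lam) {K : Matrix (Fin J) (Fin J) ℝ}
    (hK : K.PosSemidef) : ∃ (C : Matrix (Fin J) (Fin J) ℝ) (m : Fin J → ℝ), C.PosSemidef ∧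
      (∀ i j, C i j + m i * m j = K i j) ∧
      ((1 / 2 * gaussVal g Q.parts (lam - 1) (lam / ((Q.parts.card : ℝ) - 1)) 0 C (optEst C g 0)
        : ℝ) : EReal) ≤ dualFunction g Q lam K := by
  have hcard : (2 : ℝ) ≤ Q.parts.card := by exact_mod_cast hQ
  have hd : 0 ≤ lam / ((Q.parts.card : ℝ) - 1) := div_nonneg hlam (by linarith)
  obtain ⟨C, m, hC, hCm, hbound⟩ : ∃ (C : Matrix (Fin J) (Fin J) ℝ) (m : Fin J → ℝ),
      C.PosSemidef ∧ (∀ i j, C i j + m i * m j = K i j) ∧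
      ∀ (τ : Type) (_ : MeasurableSpace τ) (ρ : Measure (τ × (Fin J → ℝ)))
        (_ : IsProbabilityMeasure ρ), (∀ i, MemLp (fun ω : τ × (Fin J → ℝ) ↦ ω.2 i) 2 ρ) →
        (∀ i j, ∫ ω, ω.2 i * ω.2 j ∂ρ = K i j) →
        1 / 2 * gaussVal g Q.parts (lam - 1) (lam / ((Q.parts.card : ℝ) - 1)) 0 C (optEst C g 0)
          ≤ lagrangian g Q lam ρ := by
    rcases le_total lam 1 with h1 | h1
    · exact ⟨K, 0, hK, by simp, fun τ _ ρ _ hX2 hXK ↦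
        gaussVal_le_lagrangian_of_le_one g Q hQ hlam h1 hK hX2 hXK⟩
    · obtain ⟨C, m, hC, hCm, hL⟩ := exists_mean_cov hK g Q.parts (lam - 1) hd
      refine ⟨C, m, hC, hCm, fun τ _ ρ _ hX2 hXK ↦ ?_⟩
      have := hL (2 * lagrangian g Q lam ρ) fun δ hδ C' a hst ↦
        gaussVal_le_lagrangian_of_one_le g Q hQ h1 hδ.le hst hX2 hXK
      linarith
  refine ⟨C, m, hC, hCm, ?_⟩
  refine le_iInf fun μ ↦ le_iInf fun _ ↦ le_iInf fun hμ ↦ le_iInf fun τ ↦ le_iInf fun _ ↦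
    le_iInf fun _ ↦ le_iInf fun ρ ↦ le_iInf fun hρ ↦ le_iInf fun hsnd ↦ ?_
  refine EReal.coe_le_coe_iff.2 (hbound τ _ ρ hρ (fun i ↦ ?_) fun i j ↦ ?_)
  · have := hμ.1 i
    rw [← hsnd, Measure.snd, memLp_map_measure_iff (Measurable.aestronglyMeasurable
      (f := fun x : Fin J → ℝ ↦ x i) (by fun_prop)) (by fun_prop)] at this
    exact this
  · rw [← hμ.2 i j, ← hsnd, Measure.snd, integral_map (by fun_prop)
      (Measurable.aestronglyMeasurable (f := fun x : Fin J → ℝ ↦ x i * x j) (by fun_prop))]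

lemma dualFunction_le (g : Fin J → ℝ) (Q : Finpartition (Finset.univ : Finset (Fin J))) (lam : ℝ)
    {K : Matrix (Fin J) (Fin J) ℝ} (μ : Measure (Fin J → ℝ)) [IsProbabilityMeasure μ]
    (hμ : HasSecondMoment μ K) :
    dualFunction g Q lam K ≤ ((lagrangianConst g Q lam μ : ℝ) : EReal) := by
  unfold dualFunction envelope
  exact iInf_le_of_le μ (iInf_le_of_le ‹_› (iInf_le_of_le hμ (iInf_le_of_le Unit
    (iInf_le_of_le (inferInstance : MeasurableSpace Unit)
      (iInf_le_of_le (inferInstance : StandardBorelSpace Unit)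
        (iInf_le_of_le ((Measure.dirac ()).prod μ)
          (iInf_le_of_le inferInstance (iInf_le_of_le Measure.snd_prod le_rfl))))))))

end Lagrangian

end GMAC

end

theorem lemma2 {J : ℕ} (g : Fin J → ℝ) (Q : Finpartition (Finset.univ : Finset (Fin J)))
    (hQ : 2 ≤ Q.parts.card) (lam : ℝ) (hlam : 0 ≤ lam)
    (K : Matrix (Fin J) (Fin J) ℝ) (hK : K.PosSemidef) :
    (∃ (μ : Measure (Fin J → ℝ)) (_ : IsGaussian μ), GMAC.HasSecondMoment μ K ∧
      ((GMAC.lagrangianConst g Q lam μ : ℝ) : EReal) = GMAC.dualFunction g Q lam K) ∧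
    (∃ (ν : Measure (Fin J → ℝ)) (_ : IsGaussian ν) (K' : Matrix (Fin J) (Fin J) ℝ),
      (∀ i, ∫ x, x i ∂ν = 0) ∧ GMAC.HasSecondMoment ν K' ∧ (K - K').PosSemidef ∧
      ((GMAC.lagrangianConst g Q lam ν : ℝ) : EReal) = GMAC.dualFunction g Q lam K) := by
  obtain ⟨C, m, hC, hCm, hle⟩ := GMAC.exists_gaussian_optimum g Q hQ hlam hK
  obtain ⟨μ, hμ, hμm, hμC⟩ := GMAC.exists_isGaussian hC m
  -- The Lagrangian of a Gaussian depends only on its covariance C. Hence the centred law has the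
  -- same value, and its second moment matrix C satisfies K - C = mmᵀ ⪰ 0.
  obtain ⟨ν, hν, hνm, hνC⟩ := GMAC.exists_isGaussian hC 0
  have hμK : GMAC.HasSecondMoment μ K :=
    ⟨fun i ↦ GMAC.memLp_eval_of_isGaussian i, fun i j ↦ by rw [hμC, hCm]⟩
  have hval := GMAC.lagrangianConst_gaussian g Q lam hμm hμC hC
  have hdual : ((GMAC.lagrangianConst g Q lam μ : ℝ) : EReal) = GMAC.dualFunction g Q lam K :=
    le_antisymm (by rw [hval]; exact hle) (GMAC.dualFunction_le g Q lam μ hμK)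
  refine ⟨⟨μ, hμ, hμK, hdual⟩, ν, hν, C, hνm,
    ⟨fun i ↦ GMAC.memLp_eval_of_isGaussian i, fun i j ↦ by simp [hνC]⟩, ?_, ?_⟩
  · have e : K - C = Matrix.vecMulVec m (star m) := by
      ext i j
      rw [Matrix.sub_apply, ← hCm i j, Matrix.vecMulVec_apply]
      simp
    rw [e]
    exact Matrix.posSemidef_vecMulVec_self_star m
  · rw [← hdual, hval, GMAC.lagrangianConst_gaussian g Q lam hνm hνC hC]
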